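/- There are a deterministic algorithm for the word RAM and absolute constants $c$ and $C$ such that the following holds for every $n \ge 2$ and every connected chordal graph $G=(V,E)$ with $n$ vertices and $m$ edges, where chordal means that every cycle of length at least four has a chord. Given the adjacency lists of $G$ (with the vertices numbered in any way and every list in any order), the algorithm outputs natural numbers $\hat e(v)$, $v \in V$, such that $$\hat e(v) \;\le\; e_G(v) \;\le\; \hat e(v)+1 \qquad \text{for every } v \in V,$$ where $e_G(v)=\max_{u\in V} dist_G(v,u)$ is the eccentricity of $v$, and it halts after at most $C\, m\log n$ steps. That is, an additive $+1$-approximation, with one-sided error, of all eccentricities of a chordal graph is computed in total $O(m\log n)$ time. Here every elementary operation (constant, register access, memory access at a computed address, addition, truncated subtraction, comparison, assignment, branching) costs one step, and all addresses, values and intermediate results are natural numbers smaller than $n^{c}$, so that words have $O(\log n)$ bits. -/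

import Mathlib

/-- A simple graph is chordal if every cycle of length at least four has a chord: an edge of the
graph that joins two vertices of the cycle but is not an edge of the cycle. -/
def SimpleGraph.IsChordal {V : Type*} (G : SimpleGraph V) : Prop :=
  ∀ (v : V) (p : G.Walk v v), p.IsCycle → 4 ≤ p.length →
    ∃ x ∈ p.support, ∃ y ∈ p.support, G.Adj x y ∧ s(x, y) ∉ p.edges

/-!
A word RAM with structured control flow.  The machine has registers and a random access memory,
both indexed by natural numbers; a program mentions only finitely many registers.  Every
elementary operation (reading a constant or a register, an indirect memory access, an addition, a
truncated subtraction, a comparison, an assignment, a branching) takes one unit of time.  All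
values, addresses and intermediate results must be smaller than a bound `W`: a word
has `log W` bits, and a computation that exceeds the bound is stuck.
-/

namespace WordRAM

/-- The state of the machine. -/
structure State where
  reg : ℕ → ℕ
  mem : ℕ → ℕ

/-- Expressions that an instruction may evaluate; `load e` reads the memory cell whose address is
the value of `e`. -/
inductive Expr where
  | const (k : ℕ)
  | reg (i : ℕ)
  | load (e : Expr)
  | add (e f : Expr)
  | sub (e f : Expr)

namespace Expr

/-- The value of an expression (subtraction is truncated at `0`). -/
def val (s : State) : Expr → ℕ
  | const k => k
  | reg i => s.reg i
  | load e => s.mem (e.val s)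
  | add e f => e.val s + f.val s
  | sub e f => e.val s - f.val s

/-- The number of elementary operations in the evaluation of an expression. -/
def cost : Expr → ℕ
  | const _ => 1
  | reg _ => 1
  | load e => e.cost + 1
  | add e f => e.cost + f.cost + 1
  | sub e f => e.cost + f.cost + 1

/-- Every value and every address that occurs in the evaluation is smaller than `W`. -/
def Fits (W : ℕ) (s : State) : Expr → Prop
  | const k => k < W
  | reg i => s.reg i < W
  | load e => e.Fits W s ∧ s.mem (e.val s) < W
  | add e f => e.Fits W s ∧ f.Fits W s ∧ e.val s + f.val s < W
  | sub e f => e.Fits W s ∧ f.Fits W s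

end Expr

/-- Conditions of branchings and loops. -/
inductive Test where
  | lt (e f : Expr)
  | eq (e f : Expr)
  | not (b : Test)
  | and (b c : Test)

namespace Test

/-- The truth value of a condition. -/
def Holds (s : State) : Test → Prop
  | lt e f => e.val s < f.val s
  | eq e f => e.val s = f.val s
  | not b => ¬ b.Holds s
  | and b c => b.Holds s ∧ c.Holds s

/-- The number of elementary operations in the evaluation of a condition. -/
def cost : Test → ℕ
  | lt e f => e.cost + f.cost + 1
  | eq e f => e.cost + f.cost + 1
  | not b => b.cost + 1
  | and b c => b.cost + c.cost + 1

/-- Every value and every address that occurs in the evaluation is smaller than `W`. -/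
def Fits (W : ℕ) (s : State) : Test → Prop
  | lt e f => e.Fits W s ∧ f.Fits W s
  | eq e f => e.Fits W s ∧ f.Fits W s
  | not b => b.Fits W s
  | and b c => b.Fits W s ∧ c.Fits W s

end Test

/-- Programs: `set i e` assigns `e` to register `i`, `store a e` assigns `e` to the memory cell
with address `a`, `loop b c` is "while `b` do `c`". -/
inductive Prog where
  | skip
  | set (i : ℕ) (e : Expr)
  | store (a e : Expr)
  | seq (c d : Prog)
  | ite (b : Test) (c d : Prog)
  | loop (b : Test) (c : Prog)

/-- `Exec W c s t s'`: with words smaller than `W`, the program `c` started in the state `s` halts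
after exactly `t` units of time in the state `s'`. -/
inductive Exec (W : ℕ) : Prog → State → ℕ → State → Prop where
  | skip (s : State) : Exec W .skip s 1 s
  | set (s : State) (i : ℕ) (e : Expr) (he : e.Fits W s) :
      Exec W (.set i e) s (e.cost + 1) { s with reg := Function.update s.reg i (e.val s) }
  | store (s : State) (a e : Expr) (ha : a.Fits W s) (he : e.Fits W s) :
      Exec W (.store a e) s (a.cost + e.cost + 1)
        { s with mem := Function.update s.mem (a.val s) (e.val s) }
  | seq {c d : Prog} {s s' s'' : State} {t t' : ℕ}
      (hc : Exec W c s t s') (hd : Exec W d s' t' s'') :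
      Exec W (.seq c d) s (t + t') s''
  | iteTrue {b : Test} {c : Prog} (d : Prog) {s s' : State} {t : ℕ}
      (hf : b.Fits W s) (hb : b.Holds s) (hc : Exec W c s t s') :
      Exec W (.ite b c d) s (b.cost + 1 + t) s'
  | iteFalse {b : Test} (c : Prog) {d : Prog} {s s' : State} {t : ℕ}
      (hf : b.Fits W s) (hb : ¬ b.Holds s) (hd : Exec W d s t s') :
      Exec W (.ite b c d) s (b.cost + 1 + t) s'
  | loopFalse {b : Test} (c : Prog) {s : State}
      (hf : b.Fits W s) (hb : ¬ b.Holds s) :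
      Exec W (.loop b c) s (b.cost + 1) s
  | loopTrue {b : Test} {c : Prog} {s s' s'' : State} {t t' : ℕ}
      (hf : b.Fits W s) (hb : b.Holds s) (hc : Exec W c s t s')
      (hl : Exec W (.loop b c) s' t' s'') :
      Exec W (.loop b c) s (b.cost + 1 + t + t') s''

/-- `adj` is an adjacency-list representation of `G`: the list `adj v` enumerates the neighbours
of `v`, each exactly once, in an arbitrary order. -/
def IsAdjList {n : ℕ} (G : SimpleGraph (Fin n)) (adj : Fin n → List (Fin n)) : Prop :=
  ∀ v, (adj v).Nodup ∧ ∀ w, w ∈ adj v ↔ G.Adj v w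

/-- The concatenation of the adjacency lists of the vertices `0, 1, …, n - 1`. -/
def neighbours {n : ℕ} (adj : Fin n → List (Fin n)) : List ℕ :=
  (List.ofFn fun v => (adj v).map Fin.val).flatten

/-- The address of the first entry of the adjacency list of the vertex `i`; for `i = n` it is the
first address after all adjacency lists. -/
def offset {n : ℕ} (adj : Fin n → List (Fin n)) (i : ℕ) : ℕ :=
  n + 2 + ((List.ofFn fun v => (adj v).length).take i).sum

/-- The input as a sequence of words: first `n`, then the `n + 1` addresses
`offset adj 0, …, offset adj n`, then the adjacency lists.  The neighbours of the vertex `v` are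
stored in the cells with addresses from `offset adj v` up to `offset adj (v + 1) - 1`. -/
def input {n : ℕ} (adj : Fin n → List (Fin n)) : List ℕ :=
  n :: ((List.range (n + 1)).map (offset adj) ++ neighbours adj)

/-- The initial state: all registers are `0`, the memory starts with the input and is `0`
beyond it. -/
def initial {n : ℕ} (adj : Fin n → List (Fin n)) : State where
  reg := fun _ => 0
  mem := fun a => (input adj).getD a 0

end WordRAM

/-! Number the vertices 1, …, n by maximum cardinality search. In a chordal graph the smaller
neighbours of every vertex then form a clique (`IsChordal.adj_of_search`), so a vertex together with
its smaller neighbours is a clique, its bag. With the greatest smaller neighbour as parent, the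
vertices form a tree in which every edge of the graph joins a node to an ancestor, and the smaller
neighbours of s separate the subtree of s from the rest of the graph (`IsElim.boundary`). Hence the
bag of t separates the subtree of each child of t from all other vertices.

Fix t and let d be the distance to its bag. The bag is a clique, so dist u v ≤ d u + d v + 1 for all
u and v (`IsElim.dist_le_add`); if t separates u from v, or is one of them, then also d u + d v ≤
dist u v (`IsSide.add_le_dist`). So d v plus the maximum of d over the nodes on the other sides of t
is at most some distance from v, and at least all distances from v to these nodes minus one. The
maximum over the other sides needs only the greatest value of d, its side, and the greatest value
outside this side.

All pairs are reached by centroid decomposition. At each level every component of the remaining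
forest is treated with its centroid t, and then the centroids are removed. Two vertices stay in a
common component until a centroid separates them or is one of them, so every pair is eventually
counted. The estimate of v is the maximum of its contributions: it never exceeds the eccentricity
and is too small by at most one. The components halve in size (`IsCentroid.two_mul_compSize_le`), so
there are O(log n) levels.

A level has to run in time O(n + m), although d refers to distances in the whole graph. The
distances are first propagated along the tree path from t up to the root r of the component
(`IsElim.distTo_of_up`), which also settles the smaller neighbours of r, and then downwards in
increasing order (`IsElim.distTo_of_not_up`). In both directions a distance is one plus a minimum
over the smaller neighbours of one node, so a component costs its total degree.

The search uses linked lists of vertices, one for each label, with lazy deletion. Programs are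
written for a machine with named registers and separate arrays, verified there with invariants and
potentials, and translated step by step to the word RAM (`Big.sim`). -/

set_option linter.constructorNameAsVariable false

/-! ### A machine with named registers and separate arrays -/


namespace RowMachine

/-- The names of the registers. -/
inductive Rg where
  | n | i | j | k | u | v | w | x | e | f | p | q | r | t | m | b | c | g | z
  deriving DecidableEq

/-- The names of the arrays. -/
inductive Rw where
  | inp | hd | vl | nx | lab | ord | pos | par | rem | sz | rt | cen | lh | ln | ds | stp | sd | est
  deriving DecidableEq

/-- The number of a register. -/
def Rg.idx : Rg → ℕ
  | n => 0 | i => 1 | j => 2 | k => 3 | u => 4 | v => 5 | w => 6 | x => 7 | e => 8 | f => 9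
  | p => 10 | q => 11 | r => 12 | t => 13 | m => 14 | b => 15 | c => 16 | g => 17 | z => 18

/-- The number of an array. -/
def Rw.idx : Rw → ℕ
  | inp => 0 | hd => 1 | vl => 2 | nx => 3 | lab => 4 | ord => 5 | pos => 6 | par => 7 | rem => 8
  | sz => 9 | rt => 10 | cen => 11 | lh => 12 | ln => 13 | ds => 14 | stp => 15 | sd => 16
  | est => 17

theorem Rg.idx_inj : Function.Injective Rg.idx := by
  intro a b h
  cases a <;> cases b <;> first | rfl | simp [Rg.idx] at h

theorem Rw.idx_inj : Function.Injective Rw.idx := by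
  intro a b h
  cases a <;> cases b <;> first | rfl | simp [Rw.idx] at h

theorem Rw.idx_lt (k : Rw) : k.idx < 18 := by
  cases k <;> simp [Rw.idx]

/-- A state: the contents of the registers and of the arrays. -/
structure St where
  r : Rg → ℕ
  a : Rw → ℕ → ℕ

/-- Expressions. -/
inductive Ex where
  | c (k : ℕ)
  | v (x : Rg)
  | ld (k : Rw) (e : Ex)
  | add (e f : Ex)
  | sub (e f : Ex)

namespace Ex

/-- The value of an expression. -/
@[simp] def val (s : St) : Ex → ℕ
  | c k => k
  | v x => s.r x
  | ld k e => s.a k (e.val s)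
  | add e f => e.val s + f.val s
  | sub e f => e.val s - f.val s

/-- Constants are `0` or `1`, and every sum is smaller than `L`. -/
@[simp] def Ok (L : ℕ) (s : St) : Ex → Prop
  | c k => k ≤ 1
  | v _ => True
  | ld _ e => e.Ok L s
  | add e f => e.Ok L s ∧ f.Ok L s ∧ e.val s + f.val s < L
  | sub e f => e.Ok L s ∧ f.Ok L s

/-- The translation to word RAM expressions. -/
def comp : Ex → WordRAM.Expr
  | c k => .const k
  -- The registers 0, …, 17 hold the base addresses of the 18 arrays, so the named registers start
  -- at 18.
  | v x => .reg (18 + x.idx)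
  | ld k e => .load (.add (.reg k.idx) e.comp)
  | add e f => .add e.comp f.comp
  | sub e f => .sub e.comp f.comp

/-- The number of elementary operations in the evaluation of an expression. -/
def cost : Ex → ℕ
  | c _ => 1
  | v _ => 1
  | ld _ e => e.cost + 3
  | add e f => e.cost + f.cost + 1
  | sub e f => e.cost + f.cost + 1

end Ex

/-- Conditions. -/
inductive Ts where
  | lt (e f : Ex)
  | eq (e f : Ex)
  | not (b : Ts)
  | and (b c : Ts)

namespace Ts

/-- The truth value of a condition. -/
@[simp] def Holds (s : St) : Ts → Prop
  | lt e f => e.val s < f.val s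
  | eq e f => e.val s = f.val s
  | not b => ¬ b.Holds s
  | and b c => b.Holds s ∧ c.Holds s

/-- All expressions of the condition can be evaluated. -/
@[simp] def Ok (L : ℕ) (s : St) : Ts → Prop
  | lt e f => e.Ok L s ∧ f.Ok L s
  | eq e f => e.Ok L s ∧ f.Ok L s
  | not b => b.Ok L s
  | and b c => b.Ok L s ∧ c.Ok L s

/-- The translation to word RAM conditions. -/
def comp : Ts → WordRAM.Test
  | lt e f => .lt e.comp f.comp
  | eq e f => .eq e.comp f.comp
  | not b => .not b.comp
  | and b c => .and b.comp c.comp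

/-- The number of elementary operations in the evaluation of a condition. -/
def cost : Ts → ℕ
  | lt e f => e.cost + f.cost + 1
  | eq e f => e.cost + f.cost + 1
  | not b => b.cost + 1
  | and b c => b.cost + c.cost + 1

instance decHolds (s : St) : (b : Ts) → Decidable (b.Holds s)
  | lt e f => inferInstanceAs (Decidable (e.val s < f.val s))
  | eq e f => inferInstanceAs (Decidable (e.val s = f.val s))
  | not b => @instDecidableNot _ (decHolds s b)
  | and b c => @instDecidableAnd _ _ (decHolds s b) (decHolds s c)

end Ts

/-- Programs. -/
inductive Pg where
  | skip
  | set (x : Rg) (e : Ex)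
  | store (k : Rw) (a e : Ex)
  | seq (c d : Pg)
  | ite (b : Ts) (c d : Pg)
  | loop (b : Ts) (c : Pg)

/-- Assignment to a register. -/
def St.setR (s : St) (x : Rg) (m : ℕ) : St := { s with r := Function.update s.r x m }

/-- Assignment to a cell of an array. -/
def St.setA (s : St) (k : Rw) (i m : ℕ) : St :=
  { s with a := Function.update s.a k (Function.update (s.a k) i m) }

@[simp] theorem St.setR_r (s : St) (x : Rg) (m : ℕ) :
    (s.setR x m).r = Function.update s.r x m := rfl

@[simp] theorem St.setR_a (s : St) (x : Rg) (m : ℕ) : (s.setR x m).a = s.a := rfl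

@[simp] theorem St.setA_r (s : St) (k : Rw) (i m : ℕ) : (s.setA k i m).r = s.r := rfl

@[simp] theorem St.setA_a (s : St) (k : Rw) (i m : ℕ) :
    (s.setA k i m).a = Function.update s.a k (Function.update (s.a k) i m) := rfl

/-- `Big L c s t s'`: the program `c` started in `s` halts after `t` units of time in `s'`. -/
inductive Big (L : ℕ) : Pg → St → ℕ → St → Prop where
  | skip (s : St) : Big L .skip s 1 s
  | set (s : St) (x : Rg) (e : Ex) (he : e.Ok L s) :
      Big L (.set x e) s (e.cost + 1) (s.setR x (e.val s))
  | store (s : St) (k : Rw) (a e : Ex) (ha : a.Ok L s) (he : e.Ok L s) :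
      Big L (.store k a e) s (a.cost + 2 + e.cost + 1) (s.setA k (a.val s) (e.val s))
  | seq {c d : Pg} {s s' s'' : St} {t t' : ℕ} (hc : Big L c s t s') (hd : Big L d s' t' s'') :
      Big L (.seq c d) s (t + t') s''
  | iteTrue {b : Ts} {c : Pg} (d : Pg) {s s' : St} {t : ℕ}
      (hf : b.Ok L s) (hb : b.Holds s) (hc : Big L c s t s') :
      Big L (.ite b c d) s (b.cost + 1 + t) s'
  | iteFalse {b : Ts} (c : Pg) {d : Pg} {s s' : St} {t : ℕ}
      (hf : b.Ok L s) (hb : ¬ b.Holds s) (hd : Big L d s t s') :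
      Big L (.ite b c d) s (b.cost + 1 + t) s'
  | loopFalse {b : Ts} (c : Pg) {s : St} (hf : b.Ok L s) (hb : ¬ b.Holds s) :
      Big L (.loop b c) s (b.cost + 1) s
  | loopTrue {b : Ts} {c : Pg} {s s' s'' : St} {t t' : ℕ}
      (hf : b.Ok L s) (hb : b.Holds s) (hc : Big L c s t s') (hl : Big L (.loop b c) s' t' s'') :
      Big L (.loop b c) s (b.cost + 1 + t + t') s''

namespace Pg

/-- The translation to word RAM programs. -/
def comp : Pg → WordRAM.Prog
  | skip => .skip
  | set x e => .set (18 + x.idx) e.comp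
  | store k a e => .store (.add (.reg k.idx) a.comp) e.comp
  | seq c d => .seq c.comp d.comp
  | ite b c d => .ite b.comp c.comp d.comp
  | loop b c => .loop b.comp c.comp

/-- Whether the program assigns to the register `x`. -/
def wr (x : Rg) : Pg → Bool
  | skip => false
  | set y _ => decide (x = y)
  | store _ _ _ => false
  | seq c d => c.wr x || d.wr x
  | ite _ c d => c.wr x || d.wr x
  | loop _ c => c.wr x

/-- Whether the program assigns to the array `k`. -/
def wa (k : Rw) : Pg → Bool
  | skip => false
  | set _ _ => false
  | store l _ _ => decide (k = l)
  | seq c d => c.wa k || d.wa k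
  | ite _ c d => c.wa k || d.wa k
  | loop _ c => c.wa k

/-- The effect of a program without loops. -/
@[simp] def den : Pg → St → St
  | skip, s => s
  | set x e, s => s.setR x (e.val s)
  | store k a e, s => s.setA k (a.val s) (e.val s)
  | seq c d, s => d.den (c.den s)
  | ite b c d, s => if b.Holds s then c.den s else d.den s
  -- A dummy value: `Pg.Ok` excludes loops.
  | loop _ _, s => s

/-- The program has no loops and can be executed. -/
@[simp] def Ok (L : ℕ) : Pg → St → Prop
  | skip, _ => True
  | set _ e, s => e.Ok L s
  | store _ a e, s => a.Ok L s ∧ e.Ok L s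
  | seq c d, s => c.Ok L s ∧ d.Ok L (c.den s)
  | ite b c d, s => b.Ok L s ∧ (b.Holds s → c.Ok L s) ∧ (¬ b.Holds s → d.Ok L s)
  | loop _ _, _ => False

/-- A bound on the running time of a program without loops. -/
def tm : Pg → ℕ
  | skip => 1
  | set _ e => e.cost + 1
  | store _ a e => a.cost + 2 + e.cost + 1
  | seq c d => c.tm + d.tm
  -- The sum of both branches is a crude bound, but `tm` depends only on the syntax, so that
  -- `decide` can compare it with numerals.
  | ite b c d => b.cost + 1 + (c.tm + d.tm)
  | loop b _ => b.cost + 1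

end Pg

/-- The two states differ only in registers and arrays to which `c` assigns. -/
def Frame (c : Pg) (s s' : St) : Prop :=
  (∀ x, c.wr x = false → s'.r x = s.r x) ∧ ∀ k, c.wa k = false → s'.a k = s.a k

/-- What a program never assigns to is unchanged. Since `wr` and `wa` are Booleans computed from the
syntax, invariants need not mention unrelated registers and arrays: `decide` recovers them. -/
theorem Big.frame {L : ℕ} {c : Pg} {s s' : St} {t : ℕ} (h : Big L c s t s') : Frame c s s' := by
  induction h with
  | skip s => exact ⟨fun _ _ => rfl, fun _ _ => rfl⟩
  | set s x e he =>
    refine ⟨fun y hy => ?_, fun _ _ => rfl⟩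
    simp only [Pg.wr, decide_eq_false_iff_not] at hy
    simp [hy]
  | store s k a e ha he =>
    refine ⟨fun _ _ => rfl, fun y hy => ?_⟩
    simp only [Pg.wa, decide_eq_false_iff_not] at hy
    simp [hy]
  | seq hc hd ih1 ih2 =>
    refine ⟨fun x hx => ?_, fun x hx => ?_⟩ <;>
      simp only [Pg.wr, Pg.wa, Bool.or_eq_false_iff] at hx
    · rw [ih2.1 x hx.2, ih1.1 x hx.1]
    · rw [ih2.2 x hx.2, ih1.2 x hx.1]
  | iteTrue d hf hb hc ih =>
    refine ⟨fun x hx => ?_, fun x hx => ?_⟩ <;>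
      simp only [Pg.wr, Pg.wa, Bool.or_eq_false_iff] at hx
    · exact ih.1 x hx.1
    · exact ih.2 x hx.1
  | iteFalse c hf hb hc ih =>
    refine ⟨fun x hx => ?_, fun x hx => ?_⟩ <;>
      simp only [Pg.wr, Pg.wa, Bool.or_eq_false_iff] at hx
    · exact ih.1 x hx.2
    · exact ih.2 x hx.2
  | loopFalse c hf hb => exact ⟨fun _ _ => rfl, fun _ _ => rfl⟩
  | loopTrue hf hb hc hl ih1 ih2 =>
    refine ⟨fun x hx => ?_, fun x hx => ?_⟩
    · rw [ih2.1 x hx, ih1.1 x hx]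
    · rw [ih2.2 x hx, ih1.2 x hx]

/-- Loop-free code is run symbolically: `den` is a function that `simp` can unfold, so only loops
require invariants. -/
theorem Pg.Ok.big {L : ℕ} {c : Pg} {s : St} (h : c.Ok L s) : ∃ t ≤ c.tm, Big L c s t (c.den s) := by
  induction c generalizing s with
  | skip => exact ⟨1, le_rfl, .skip s⟩
  | set x e => exact ⟨_, le_rfl, .set s x e h⟩
  | store k a e => exact ⟨_, le_rfl, .store s k a e h.1 h.2⟩
  | seq c d ih1 ih2 =>
    obtain ⟨t1, h1, hb1⟩ := ih1 h.1
    obtain ⟨t2, h2, hb2⟩ := ih2 h.2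
    exact ⟨t1 + t2, by simp only [tm]; omega, .seq hb1 hb2⟩
  | ite b c d ih1 ih2 =>
    by_cases hb : b.Holds s
    · obtain ⟨t1, h1, hb1⟩ := ih1 (h.2.1 hb)
      exact ⟨b.cost + 1 + t1, by simp only [tm]; omega, by simpa [hb] using Big.iteTrue d h.1 hb hb1⟩
    · obtain ⟨t1, h1, hb1⟩ := ih2 (h.2.2 hb)
      exact ⟨b.cost + 1 + t1, by simp only [tm]; omega, by simpa [hb] using Big.iteFalse c h.1 hb hb1⟩
  | loop b c => exact h.elim

/-! ### Simulation by the word RAM -/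

/-- The state `σ` of the word RAM represents `s`: the array number `k` starts at the address
`k * L`. -/
structure Rel (L : ℕ) (s : St) (σ : WordRAM.State) : Prop where
  reg : ∀ x : Rg, σ.reg (18 + x.idx) = s.r x
  base : ∀ k : Rw, σ.reg k.idx = k.idx * L
  mem : ∀ (k : Rw) i, i < L → σ.mem (k.idx * L + i) = s.a k i
  reg_lt : ∀ x, s.r x < L
  mem_lt : ∀ k i, i < L → s.a k i < L

/-- Values stay below L, but an address is a base plus an index, `k.idx * L + i`; this is why words
up to 18 * L are needed. -/
theorem Ex.sim {L W : ℕ} {s : St} {σ : WordRAM.State} (hL : 1 < L) (hW : 18 * L ≤ W)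
    (h : Rel L s σ) (e : Ex) (he : e.Ok L s) :
    e.val s < L ∧ e.comp.val σ = e.val s ∧ e.comp.Fits W σ ∧ e.comp.cost = e.cost := by
  induction e with
  | c k =>
    simp only [Ok] at he
    exact ⟨by simp; omega, rfl, show k < W by omega, rfl⟩
  | v x =>
    have := h.reg_lt x
    refine ⟨this, h.reg x, ?_, rfl⟩
    change σ.reg _ < W
    rw [h.reg]; omega
  | ld k e ih =>
    obtain ⟨h1, h2, h3, h4⟩ := ih he
    have hb := h.base k
    have hk := k.idx_lt
    have hle : (k.idx + 1) * L ≤ 18 * L := Nat.mul_le_mul_right _ hk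
    have hm := h.mem k _ h1
    have hml := h.mem_lt k _ h1
    refine ⟨hml, ?_, ⟨⟨?_, h3, ?_⟩, ?_⟩, ?_⟩
    · simp [comp, WordRAM.Expr.val, hb, h2, hm]
    · change σ.reg _ < W
      rw [hb]; nlinarith
    · simp only [WordRAM.Expr.val, hb, h2]; nlinarith
    · simp only [WordRAM.Expr.val, hb, h2, hm]; omega
    · simp only [comp, WordRAM.Expr.cost, cost, h4]; omega
  | add e f ih1 ih2 =>
    obtain ⟨h1, h2, h3, h4⟩ := ih1 he.1
    obtain ⟨g1, g2, g3, g4⟩ := ih2 he.2.1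
    refine ⟨he.2.2, by simp [comp, WordRAM.Expr.val, h2, g2], ⟨h3, g3, ?_⟩, ?_⟩
    · rw [h2, g2]; have := he.2.2; omega
    · simp [comp, WordRAM.Expr.cost, cost, h4, g4]
  | sub e f ih1 ih2 =>
    obtain ⟨h1, h2, h3, h4⟩ := ih1 he.1
    obtain ⟨g1, g2, g3, g4⟩ := ih2 he.2
    refine ⟨by simp only [val]; omega, by simp [comp, WordRAM.Expr.val, h2, g2], ⟨h3, g3⟩, ?_⟩
    simp [comp, WordRAM.Expr.cost, cost, h4, g4]

theorem Ts.sim {L W : ℕ} {s : St} {σ : WordRAM.State} (hL : 1 < L) (hW : 18 * L ≤ W)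
    (h : Rel L s σ) (b : Ts) (hb : b.Ok L s) :
    (b.comp.Holds σ ↔ b.Holds s) ∧ b.comp.Fits W σ ∧ b.comp.cost = b.cost := by
  induction b with
  | lt e f =>
    obtain ⟨h1, h2, h3, h4⟩ := e.sim hL hW h hb.1
    obtain ⟨g1, g2, g3, g4⟩ := f.sim hL hW h hb.2
    exact ⟨by simp [comp, WordRAM.Test.Holds, h2, g2], ⟨h3, g3⟩,
      by simp [comp, WordRAM.Test.cost, cost, h4, g4]⟩
  | eq e f =>
    obtain ⟨h1, h2, h3, h4⟩ := e.sim hL hW h hb.1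
    obtain ⟨g1, g2, g3, g4⟩ := f.sim hL hW h hb.2
    exact ⟨by simp [comp, WordRAM.Test.Holds, h2, g2], ⟨h3, g3⟩,
      by simp [comp, WordRAM.Test.cost, cost, h4, g4]⟩
  | not b ih =>
    obtain ⟨h1, h2, h3⟩ := ih hb
    exact ⟨by simp [comp, WordRAM.Test.Holds, h1], h2, by simp [comp, WordRAM.Test.cost, cost, h3]⟩
  | and b c ih1 ih2 =>
    obtain ⟨h1, h2, h3⟩ := ih1 hb.1
    obtain ⟨g1, g2, g3⟩ := ih2 hb.2
    exact ⟨by simp [comp, WordRAM.Test.Holds, h1, g1], ⟨h2, g2⟩,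
      by simp [comp, WordRAM.Test.cost, cost, h3, g3]⟩

/-- Division with remainder: the arrays occupy disjoint blocks of L cells. -/
theorem mul_add_inj {L k l i j : ℕ} (hi : i < L) (hj : j < L) (h : k * L + i = l * L + j) :
    k = l ∧ i = j := by
  have h1 : (k * L + i) / L = k := by
    rw [Nat.mul_comm, Nat.mul_add_div (by omega), Nat.div_eq_of_lt hi, Nat.add_zero]
  have h2 : (l * L + j) / L = l := by
    rw [Nat.mul_comm, Nat.mul_add_div (by omega), Nat.div_eq_of_lt hj, Nat.add_zero]
  have : k = l := by rw [← h1, h, h2]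
  subst this
  exact ⟨rfl, by omega⟩

/-- Costs were defined as the costs of the translated instructions, so the simulation takes exactly
the same number of steps. A store changes a single cell of a single block, by `mul_add_inj`. -/
theorem Big.sim {L W : ℕ} (hL : 1 < L) (hW : 18 * L ≤ W) {c : Pg} {s s' : St} {t : ℕ}
    (h : Big L c s t s') {σ : WordRAM.State} (hr : Rel L s σ) :
    ∃ σ', WordRAM.Exec W c.comp σ t σ' ∧ Rel L s' σ' := by
  induction h generalizing σ with
  | skip s => exact ⟨σ, .skip σ, hr⟩
  | set s x e he =>
    obtain ⟨h1, h2, h3, h4⟩ := e.sim hL hW hr he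
    have hx := WordRAM.Exec.set σ (18 + x.idx) e.comp h3
    rw [h4] at hx
    refine ⟨_, hx, ⟨fun y => ?_, fun k => ?_, hr.mem, fun y => ?_, hr.mem_lt⟩⟩
    · by_cases hxy : y = x
      · subst hxy; simp [h2]
      · have : 18 + y.idx ≠ 18 + x.idx := fun h => hxy (Rg.idx_inj (by omega))
        simp [hxy, Function.update_of_ne this, hr.reg]
    · have := k.idx_lt
      have : k.idx ≠ 18 + x.idx := by omega
      simp [Function.update_of_ne this, hr.base]
    · by_cases hxy : y = x
      · subst hxy; simpa using h1
      · simpa [hxy] using hr.reg_lt y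
  | store s k a e ha he =>
    obtain ⟨h1, h2, h3, h4⟩ := e.sim hL hW hr he
    obtain ⟨g1, g2, g3, g4⟩ := a.sim hL hW hr ha
    have hk := k.idx_lt
    have hb := hr.base k
    have hle : (k.idx + 1) * L ≤ 18 * L := Nat.mul_le_mul_right _ hk
    have hx := WordRAM.Exec.store (W := W) σ (.add (.reg k.idx) a.comp) e.comp
      ⟨by change σ.reg _ < W; rw [hb]; nlinarith, g3, by
        simp only [WordRAM.Expr.val, hb, g2]; nlinarith⟩ h3
    have hc : (WordRAM.Expr.add (.reg k.idx) a.comp).cost + e.comp.cost + 1 =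
        a.cost + 2 + e.cost + 1 := by
      simp only [WordRAM.Expr.cost, h4, g4]; omega
    rw [hc] at hx
    refine ⟨_, hx, ⟨hr.reg, hr.base, fun l i hi => ?_, hr.reg_lt, fun l i hi => ?_⟩⟩
    · simp only [WordRAM.Expr.val, hb, g2, h2, St.setA_a]
      by_cases hl : l = k
      · subst hl
        by_cases hia : i = a.val s
        · subst hia; simp
        · have : l.idx * L + i ≠ l.idx * L + a.val s := by omega
          rw [Function.update_of_ne this]
          simp [hia, hr.mem l i hi]
      · have : l.idx * L + i ≠ k.idx * L + a.val s := fun h =>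
          hl (Rw.idx_inj (mul_add_inj hi g1 h).1)
        rw [Function.update_of_ne this]
        simp [hl, hr.mem l i hi]
    · simp only [St.setA_a]
      by_cases hl : l = k
      · subst hl
        by_cases hia : i = a.val s
        · subst hia; simpa using h1
        · simpa [hia] using hr.mem_lt l i hi
      · simpa [hl] using hr.mem_lt l i hi
  | seq hc hd ih1 ih2 =>
    obtain ⟨σ1, h1, r1⟩ := ih1 hr
    obtain ⟨σ2, h2, r2⟩ := ih2 r1
    exact ⟨σ2, .seq h1 h2, r2⟩
  | @iteTrue b c d s s' t hf hb hc ih =>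
    obtain ⟨σ1, h1, r1⟩ := ih hr
    obtain ⟨b1, b2, b3⟩ := b.sim hL hW hr hf
    exact ⟨σ1, b3 ▸ .iteTrue _ b2 (b1.2 hb) h1, r1⟩
  | @iteFalse b c d s s' t hf hb hc ih =>
    obtain ⟨σ1, h1, r1⟩ := ih hr
    obtain ⟨b1, b2, b3⟩ := b.sim hL hW hr hf
    exact ⟨σ1, b3 ▸ .iteFalse _ b2 (fun h => hb (b1.1 h)) h1, r1⟩
  | @loopFalse b c s hf hb =>
    obtain ⟨b1, b2, b3⟩ := b.sim hL hW hr hf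
    exact ⟨σ, b3 ▸ .loopFalse _ b2 (fun h => hb (b1.1 h)), hr⟩
  | @loopTrue b c s s' s'' t t' hf hb hc hl ih1 ih2 =>
    obtain ⟨b1, b2, b3⟩ := b.sim hL hW hr hf
    obtain ⟨σ1, h1, r1⟩ := ih1 hr
    obtain ⟨σ2, h2, r2⟩ := ih2 r1
    exact ⟨σ2, b3 ▸ .loopTrue b2 (b1.2 hb) h1 h2, r2⟩

/-! ### Rules for proving that a program halts in time -/

/-- The program `c` started in `s` halts after at most `T` units of time in a state with `Q`. -/
def Run (L : ℕ) (c : Pg) (s : St) (T : ℕ) (Q : St → Prop) : Prop :=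
  ∃ t s', Big L c s t s' ∧ t ≤ T ∧ Q s'

namespace Run

variable {L : ℕ} {c d : Pg} {s : St} {T T' : ℕ} {Q Q' : St → Prop}

theorem mono (h : Run L c s T Q) (hT : T ≤ T') (hQ : ∀ s', Q s' → Q' s') : Run L c s T' Q' := by
  obtain ⟨t, s', h1, h2, h3⟩ := h
  exact ⟨t, s', h1, h2.trans hT, hQ _ h3⟩

theorem framed (h : Run L c s T Q) : Run L c s T (fun s' => Q s' ∧ Frame c s s') := by
  obtain ⟨t, s', h1, h2, h3⟩ := h
  exact ⟨t, s', h1, h2, h3, h1.frame⟩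

theorem straight (h : c.Ok L s) (hT : c.tm ≤ T) (hQ : Q (c.den s)) : Run L c s T Q := by
  obtain ⟨t, h1, h2⟩ := h.big
  exact ⟨t, _, h2, h1.trans hT, hQ⟩

theorem seq (h : Run L c s T Q) (h' : ∀ s', Q s' → Frame c s s' → Run L d s' T' Q') :
    Run L (.seq c d) s (T + T') Q' := by
  obtain ⟨t, s', h1, h2, h3⟩ := h
  obtain ⟨t', s'', g1, g2, g3⟩ := h' s' h3 h1.frame
  exact ⟨t + t', s'', .seq h1 g1, by omega, g3⟩

theorem ite {b : Ts} (hb : b.Ok L s) (h1 : b.Holds s → Run L c s T Q)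
    (h2 : ¬ b.Holds s → Run L d s T Q) : Run L (.ite b c d) s (b.cost + 1 + T) Q := by
  by_cases h : b.Holds s
  · obtain ⟨t, s', g1, g2, g3⟩ := h1 h
    exact ⟨_, s', .iteTrue d hb h g1, by omega, g3⟩
  · obtain ⟨t, s', g1, g2, g3⟩ := h2 h
    exact ⟨_, s', .iteFalse c hb h g1, by omega, g3⟩

/-- A loop whose potential `Φ` pays for the executions of the body. -/
theorem loop {b : Ts} (I : ℕ → St → Prop)
    (hok : ∀ Φ s, I Φ s → b.Ok L s)
    (hI : ∀ Φ s, I Φ s → b.Holds s →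
      ∃ T Φ', T + b.cost + 1 + Φ' ≤ Φ ∧ Φ' < Φ ∧ Run L c s T (fun s' => ∃ Φ'' ≤ Φ', I Φ'' s'))
    {Φ : ℕ} (h : I Φ s) :
    Run L (.loop b c) s (Φ + b.cost + 1) (fun s' => ¬ b.Holds s' ∧ ∃ Φ', I Φ' s') := by
  induction Φ using Nat.strong_induction_on generalizing s with
  | _ Φ ih =>
    by_cases hb : b.Holds s
    · obtain ⟨T, Φ', h1, h2, t, s', g1, g2, Φ'', h3, g3⟩ := hI Φ s h hb
      obtain ⟨t', s'', k1, k2, k3⟩ := ih Φ'' (by omega) g3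
      exact ⟨_, s'', .loopTrue (hok _ _ h) hb g1 k1, by omega, k3⟩
    · exact ⟨_, s, .loopFalse c (hok _ _ h) hb, by omega, hb, Φ, h⟩

/-- A loop in which every iteration has an invariant with a counter: `I a` holds before,
and every iteration changes `I i` to `I (i + 1)`, until `I b` holds. -/
theorem counted {t : Ts} (I : ℕ → St → Prop) (C : ℕ → ℕ) {a b : ℕ} (hab : a ≤ b)
    (hok : ∀ i s, I i s → t.Ok L s)
    (hlt : ∀ i s, a ≤ i → i ≤ b → I i s → (t.Holds s ↔ i < b))
    (hI : ∀ i s, a ≤ i → i < b → I i s → Run L c s (C i) (I (i + 1))) (h : I a s) :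
    Run L (.loop t c) s (∑ i ∈ Finset.Ico a b, (C i + t.cost + 1) + t.cost + 1) (I b) := by
  induction hd : b - a generalizing a s with
  | zero =>
    have : a = b := by omega
    subst this
    exact ⟨_, s, .loopFalse c (hok _ _ h) (by rw [hlt a s le_rfl le_rfl h]; omega), by simp, h⟩
  | succ k ih =>
    have hlt' : a < b := by omega
    obtain ⟨t1, s1, h1, h2, h3⟩ := hI a s le_rfl hlt' h
    obtain ⟨t2, s2, g1, g2, g3⟩ := ih (a := a + 1) (s := s1) (by omega)
      (fun i s h1 h2 => hlt i s (by omega) h2) (fun i s h1 h2 => hI i s (by omega) h2) h3 (by omega)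
    refine ⟨_, s2, .loopTrue (hok _ _ h) ((hlt a s le_rfl hab h).2 hlt') h1 g1, ?_, g3⟩
    rw [Finset.sum_eq_sum_Ico_succ_bot hlt']
    omega

end Run

end RowMachine

/-! ### Maximum cardinality search in chordal graphs -/

namespace SimpleGraph

variable {V : Type*} {G : SimpleGraph V}

/-- Passes from vertex sequences, convenient for index arithmetic, to walks, in terms of which
chordality is stated. The description of the edges serves to recognise that a supposed chord is an
edge of the cycle. -/
theorem exists_walk_of_seq (p : ℕ → V) (k : ℕ) (h : ∀ i < k, G.Adj (p i) (p (i + 1))) :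
    ∃ w : G.Walk (p 0) (p k), w.support = (List.range (k + 1)).map p ∧ w.length = k ∧
      ∀ e, e ∈ w.edges ↔ ∃ i < k, e = s(p i, p (i + 1)) := by
  induction k with
  | zero => exact ⟨.nil, by simp, rfl, by simp⟩
  | succ k ih =>
    obtain ⟨w, h1, h2, h3⟩ := ih (fun i hi => h i (by omega))
    refine ⟨w.concat (h k (by omega)), ?_, by simp [h2], fun e => ?_⟩
    · rw [Walk.support_concat, h1, List.range_succ (n := k + 1)]
      simp
    · rw [Walk.edges_concat]
      simp only [List.concat_eq_append, List.mem_append, h3, List.mem_singleton]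
      constructor
      · rintro (⟨i, hi, rfl⟩ | rfl)
        · exact ⟨i, by omega, rfl⟩
        · exact ⟨k, by omega, rfl⟩
      · rintro ⟨i, hi, rfl⟩
        rcases Nat.lt_succ_iff_lt_or_eq.1 hi with hi | rfl
        · exact .inl ⟨i, hi, rfl⟩
        · exact .inr rfl

/-- A chordal graph has no induced cycle `p 0, …, p k` with `k ≥ 3`. -/
theorem IsChordal.no_induced_cycle (hG : G.IsChordal) (p : ℕ → V) (k : ℕ) (hk : 3 ≤ k)
    (hadj : ∀ i < k, G.Adj (p i) (p (i + 1))) (hlast : G.Adj (p 0) (p k))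
    (hinj : ∀ i j, i < j → j ≤ k → p i ≠ p j)
    (hind : ∀ i j, i + 1 < j → j ≤ k → (i ≠ 0 ∨ j ≠ k) → ¬ G.Adj (p i) (p j)) : False := by
  obtain ⟨w, h1, h2, h3⟩ := exists_walk_of_seq p k hadj
  have hpath : w.IsPath := by
    rw [Walk.isPath_def, h1]
    refine (List.nodup_map_iff_inj_on List.nodup_range).2 fun i hi j hj hij => ?_
    simp only [List.mem_range] at hi hj
    rcases lt_trichotomy i j with h | h | h
    · exact (hinj i j h (by omega) hij).elim
    · exact h
    · exact (hinj j i h (by omega) hij.symm).elim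
  have hne : s(p k, p 0) ∉ w.edges := by
    rw [h3]
    rintro ⟨i, hi, h⟩
    rcases Sym2.eq_iff.1 h with ⟨ha, hb⟩ | ⟨ha, hb⟩
    · exact hinj i k hi le_rfl ha.symm
    · rcases Nat.eq_zero_or_pos i with rfl | h0
      · exact hinj 1 k (by omega) le_rfl ha.symm
      · exact hinj 0 i h0 (by omega) hb
  obtain ⟨x, hx, y, hy, hxy, he⟩ := hG _ (Walk.cons hlast.symm w)
    ((Walk.cons_isCycle_iff _ _).2 ⟨hpath, hne⟩) (by simp [h2]; omega)
  have key : ∀ i j, i < j → j ≤ k → G.Adj (p i) (p j) →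
      s(p i, p j) ∈ (Walk.cons hlast.symm w).edges := by
    intro i j hij hj ha
    rw [Walk.edges_cons, List.mem_cons, h3]
    by_cases h : j = i + 1
    · subst h
      exact .inr ⟨i, by omega, rfl⟩
    · by_cases h0 : i = 0 ∧ j = k
      · rw [h0.1, h0.2]; exact .inl Sym2.eq_swap
      · exact (hind i j (by omega) hj (by omega) ha).elim
  have hsup : ∀ z, z ∈ (Walk.cons hlast.symm w).support → ∃ i ≤ k, z = p i := by
    intro z hz
    rw [Walk.support_cons, List.mem_cons, h1] at hz
    rcases hz with rfl | hz
    · exact ⟨k, le_rfl, rfl⟩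
    · obtain ⟨i, hi, rfl⟩ := List.mem_map.1 hz
      exact ⟨i, by simp at hi; omega, rfl⟩
  obtain ⟨i, hi, rfl⟩ := hsup x hx
  obtain ⟨j, hj, rfl⟩ := hsup y hy
  rcases lt_trichotomy i j with h | h | h
  · exact he (key i j h hj hxy)
  · subst h; exact G.irrefl hxy
  · exact he (Sym2.eq_swap ▸ key j i h hi hxy.symm)

/-- In a chordal graph there is no induced path whose interior vertices come after both ends,
in an order in which every vertex has, with respect to every later one, a private earlier
neighbour as soon as the later one has such a neighbour. -/
theorem IsChordal.no_late_path (hG : G.IsChordal) (pos : V → ℕ) (hinjpos : Function.Injective pos)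
    (hP : ∀ x u v, pos x < pos u → pos u < pos v → G.Adj x v → ¬ G.Adj x u →
      ∃ y, pos y < pos u ∧ G.Adj y u ∧ ¬ G.Adj y v) (N : ℕ) :
    ∀ (p : ℕ → V) (k : ℕ), 2 ≤ k → (∀ i < k, G.Adj (p i) (p (i + 1))) →
      (∀ i j, i < j → j ≤ k → p i ≠ p j) →
      (∀ i j, i + 1 < j → j ≤ k → ¬ G.Adj (p i) (p j)) →
      pos (p 0) < pos (p k) → (∀ i, 0 < i → i < k → pos (p k) < pos (p i)) →
      pos (p k) = N → False := by
  induction N using Nat.strong_induction_on with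
  | _ N ih =>
    intro p k hk hadj hinj hind h0k hpos hN
    classical
    -- The vertex `p k` comes before `p 1` and, unlike `p 1`, is not adjacent to `p 0`. So it has an
    -- earlier neighbour y that is not adjacent to `p 1`.
    obtain ⟨y, hy1, hy2, hy3⟩ := hP (p 0) (p k) (p 1) h0k (hpos 1 (by omega) (by omega))
      (hadj 0 (by omega)) (hind 0 k (by omega) le_rfl)
    have hex : ∃ j, 1 ≤ j ∧ j ≤ k ∧ G.Adj y (p j) := ⟨k, by omega, le_rfl, hy2⟩
    -- With the first neighbour `p j` of y after `p 0`, the path `p 0`, …, `p j`, y is induced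
    -- except for a possible edge between `p 0` and y.
    set j := Nat.find hex with hj
    obtain ⟨j1, j2, j3⟩ := Nat.find_spec hex
    have hmin : ∀ i, 1 ≤ i → i < j → ¬ G.Adj y (p i) := fun i h1 h2 h3 =>
      Nat.find_min hex h2 ⟨h1, by omega, h3⟩
    rw [← hj] at j1 j2 j3
    have hj2 : 2 ≤ j := by
      rcases Nat.lt_or_ge j 2 with h | h
      · have : j = 1 := by omega
        rw [this] at j3; exact (hy3 j3).elim
      · exact h
    have hyk : ∀ i ≤ k, p i ≠ y := by
      intro i hi h
      rcases Nat.eq_zero_or_pos i with rfl | h0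
      · rw [← h] at hy2
        exact hind 0 k (by omega) le_rfl hy2
      · rcases Nat.lt_or_ge i k with h' | h'
        · have := hpos i h0 h'; rw [h] at this; omega
        · have : i = k := by omega
          subst this
          exact G.irrefl (h ▸ hy2)
    let p' : ℕ → V := fun i => if i ≤ j then p i else y
    have hp1 : ∀ i ≤ j, p' i = p i := fun i hi => by simp [p', hi]
    have hp2 : p' (j + 1) = y := by simp [p']
    have hadj' : ∀ i < j + 1, G.Adj (p' i) (p' (i + 1)) := by
      intro i hi
      rcases Nat.lt_or_ge i j with h | h
      · rw [hp1 i h.le, hp1 (i + 1) h]; exact hadj i (by omega)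
      · have : i = j := by omega
        subst this
        rw [hp1 _ le_rfl, hp2]; exact j3.symm
    have hinj' : ∀ a b, a < b → b ≤ j + 1 → p' a ≠ p' b := by
      intro a b hab hb
      rcases Nat.lt_or_ge j b with h | h
      · have : b = j + 1 := by omega
        subst this
        rw [hp1 a (by omega), hp2]; exact hyk a (by omega)
      · rw [hp1 a (by omega), hp1 b h]; exact hinj a b hab (by omega)
    -- If this edge is present, it closes an induced cycle; it has length at least four because j ≥
    -- 2.
    by_cases hy0 : G.Adj (p 0) y
    · refine hG.no_induced_cycle p' (j + 1) (by omega) hadj' ?_ hinj' ?_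
      · rw [hp1 0 (by omega), hp2]; exact hy0
      · intro a b hab hb hor
        rcases Nat.lt_or_ge j b with h | h
        · have : b = j + 1 := by omega
          subst this
          rw [hp1 a (by omega), hp2]
          exact fun h => hmin a (by omega) (by omega) h.symm
        · rw [hp1 a (by omega), hp1 b h]; exact hind a b hab (by omega)
    · have hind' : ∀ a b, a + 1 < b → b ≤ j + 1 → ¬ G.Adj (p' a) (p' b) := by
        intro a b hab hb
        rcases Nat.lt_or_ge j b with h | h
        · have : b = j + 1 := by omega
          subst this
          rw [hp1 a (by omega), hp2]
          rcases Nat.eq_zero_or_pos a with rfl | ha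
          · exact hy0
          · exact fun h => hmin a (by omega) (by omega) h.symm
        · rw [hp1 a (by omega), hp1 b h]; exact hind a b hab (by omega)
      have hint : ∀ i, 0 < i → i < j + 1 → pos (p k) ≤ pos (p' i) := by
        intro i h1 h2
        rw [hp1 i (by omega)]
        rcases Nat.lt_or_ge i k with h | h
        · exact (hpos i h1 h).le
        · have : i = k := by omega
          rw [this]
      -- Otherwise the new path is induced and both its ends come before `p k`, while its interior
      -- does not. Oriented towards its later end, it is a counterexample with a smaller position of
      -- that end.
      rcases lt_trichotomy (pos (p 0)) (pos y) with h | h | h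
      · refine ih (pos y) (by omega) p' (j + 1) (by omega) hadj' hinj' hind' ?_ ?_ ?_
        · rw [hp1 0 (by omega), hp2]; exact h
        · intro i h1 h2
          rw [hp2]
          have := hint i h1 h2
          omega
        · rw [hp2]
      · exact hyk 0 (by omega) (hinjpos h)
      · refine ih (pos (p 0)) (by omega) (fun i => p' (j + 1 - i)) (j + 1) (by omega)
          (fun i hi => ?_) (fun a b hab hb => ?_) (fun a b hab hb => ?_) ?_ (fun i h1 h2 => ?_) ?_
        · have := (hadj' (j + 1 - (i + 1)) (by omega)).symm
          rwa [show j + 1 - (i + 1) + 1 = j + 1 - i by omega] at this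
        · exact (hinj' (j + 1 - b) (j + 1 - a) (by omega) (by omega)).symm
        · exact fun h => hind' (j + 1 - b) (j + 1 - a) (by omega) (by omega) h.symm
        · simp only [Nat.sub_self, Nat.sub_zero]
          rw [hp1 0 (by omega), hp2]; exact h
        · have := hint (j + 1 - i) (by omega) (by omega)
          simp only [Nat.sub_self]
          rw [hp1 0 (by omega)]
          omega
        · simp only [Nat.sub_self]
          rw [hp1 0 (by omega)]

/-- The reverse of a maximum cardinality search order of a chordal graph is a perfect
elimination order. -/
theorem IsChordal.adj_of_search [Finite V] (hG : G.IsChordal) (pos : V → ℕ)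
    (hinj : Function.Injective pos)
    (hmax : ∀ u v, pos u < pos v →
      {x | G.Adj v x ∧ pos x < pos u}.ncard ≤ {x | G.Adj u x ∧ pos x < pos u}.ncard)
    {a b c : V} (hab : G.Adj a b) (hac : G.Adj a c) (hb : pos b < pos a) (hc : pos c < pos a)
    (hbc : b ≠ c) : G.Adj b c := by
  wlog h : pos b < pos c generalizing b c
  · exact (this hac hab hc hb hbc.symm
      (lt_of_le_of_ne (not_lt.1 h) fun h => hbc (hinj h).symm)).symm
  by_contra hn
  refine hG.no_late_path pos hinj (fun x u v hxu huv hxv hnx => ?_) (pos c)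
    (fun i => if i = 0 then b else if i = 1 then a else c) 2 le_rfl ?_ ?_ ?_ (by simpa) ?_
    (by simp)
  · by_contra hno
    push Not at hno
    -- If all earlier neighbours of u were neighbours of v, then x in addition would give v more
    -- numbered neighbours than u at the moment when u was chosen.
    refine (Set.ncard_lt_ncard (s := {x | G.Adj u x ∧ pos x < pos u})
      (t := {x | G.Adj v x ∧ pos x < pos u}) ?_ (Set.toFinite _)).not_ge (hmax u v huv)
    refine ⟨fun y hy => ⟨(hno y hy.2 hy.1.symm).symm, hy.2⟩, fun hs => ?_⟩
    exact hnx (hs (show x ∈ {x | G.Adj v x ∧ pos x < pos u} from ⟨hxv.symm, hxu⟩)).1.symm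
  · intro i hi
    interval_cases i
    · simpa using hab.symm
    · simpa using hac
  · intro i j hij hj
    interval_cases j <;> interval_cases i <;> simp [hbc, hab.ne', hac.ne]
  · intro i j hij hj
    interval_cases j
    · omega
    · omega
    · obtain rfl : i = 0 := by omega
      simpa using hn
  · intro i h1 h2
    interval_cases i
    simpa using hc

end SimpleGraph

/-! ### Climbing in a rooted forest on natural numbers -/

/-- `Up par R u a`: from `u` one reaches `a` by steps to the parent that avoid `R`. -/
def Up (par : ℕ → ℕ) (R : ℕ → Prop) : ℕ → ℕ → Prop :=
  Relation.ReflTransGen fun x y => y = par x ∧ ¬ R y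

namespace Up

variable {par : ℕ → ℕ} {R R' : ℕ → Prop} {n u v a b t r c : ℕ}

theorem refl : Up par R u u := Relation.ReflTransGen.refl

theorem trans (h : Up par R u a) (h' : Up par R a b) : Up par R u b :=
  Relation.ReflTransGen.trans h h'

theorem step (h : ¬ R (par u)) : Up par R u (par u) := Relation.ReflTransGen.single ⟨rfl, h⟩

theorem mono (hR : ∀ x, R x → R' x) (h : Up par R' u a) : Up par R u a :=
  Relation.ReflTransGen.mono (fun _ _ h => ⟨h.1, fun h' => h.2 (hR _ h')⟩) _ _ h

/-- The parent is a function, so two climbs from the same node are nested. -/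
theorem total (h : Up par R u a) (h' : Up par R u b) : Up par R a b ∨ Up par R b a :=
  Relation.ReflTransGen.total_of_right_unique (fun _ _ _ h1 h2 => h1.1.trans h2.1.symm) h h'

theorem eq_or_step (h : Up par R u a) : u = a ∨ ¬ R (par u) ∧ Up par R (par u) a := by
  rcases Relation.ReflTransGen.cases_head h with h | ⟨c, ⟨rfl, h1⟩, h2⟩
  · exact .inl h
  · exact .inr ⟨h1, h2⟩

/-- `Up` tests only the nodes that are entered, never the starting node; hence the case of an empty
climb is excluded. -/
theorem not_of_ne (h : Up par R u a) (hne : u ≠ a) : ¬ R a := by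
  rcases Relation.ReflTransGen.cases_tail h with h | ⟨c, _, h1⟩
  · exact (hne h.symm).elim
  · exact h1.2

theorem not_of_not (h : Up par R u a) (hu : ¬ R u) : ¬ R a := by
  by_cases hne : u = a
  · exact hne ▸ hu
  · exact h.not_of_ne hne

theorem exists_child (h : Up par R u a) (hu : ¬ R u) (hne : u ≠ a) :
    ∃ c, par c = a ∧ ¬ R c ∧ Up par R u c := by
  rcases Relation.ReflTransGen.cases_tail h with h | ⟨c, h0, h1⟩
  · exact (hne h.symm).elim
  · exact ⟨c, h1.1.symm, not_of_not h0 hu, h0⟩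

variable (hR : R 0) (hpar : ∀ x, 1 ≤ x → par x < x)
include hR hpar

/-- The number 0 is not a node; as the parent of the root it belongs to R, so climbs stop before it.
-/
theorem bounds (h : Up par R u a) (hu : 1 ≤ u) : 1 ≤ a ∧ a ≤ u := by
  induction h with
  | refl => exact ⟨hu, le_rfl⟩
  | @tail b c _ h ih =>
    have := hpar b ih.1
    refine ⟨Nat.one_le_iff_ne_zero.2 fun h0 => h.2 (h0 ▸ hR), ?_⟩
    rw [h.1]; omega

theorem antisymm (h : Up par R u a) (h' : Up par R a u) (hu : 1 ≤ u) : u = a :=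
  le_antisymm (h'.bounds hR hpar (h.bounds hR hpar hu).1).2 (h.bounds hR hpar hu).2

/-- The path of active nodes from `u` to `a` passes through every node `t` above `u` that is not
strictly above `a`. -/
theorem between (h : Up par R' u a) (h' : Up par R u t) (hu : 1 ≤ u) (hat : a ≤ t) :
    Up par R' u t := by
  induction h using Relation.ReflTransGen.head_induction_on with
  | refl =>
    have := (h'.bounds hR hpar hu).2
    have : t = a := by omega
    subst this
    exact .refl
  | @head x y hxy _ ih =>
    obtain ⟨rfl, hy⟩ := hxy
    rcases h'.eq_or_step with rfl | ⟨h1, h2⟩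
    · exact .refl
    · refine (step hy).trans (ih h2 ?_)
      exact Nat.one_le_iff_ne_zero.2 fun h0 => h1 (h0 ▸ hR)

end Up

/-- From `u` one reaches `a` by steps to the parent. -/
abbrev Anc (par : ℕ → ℕ) : ℕ → ℕ → Prop := Up par fun x => x = 0

theorem Anc.bounds {par : ℕ → ℕ} (hpar : ∀ x, 1 ≤ x → par x < x) {u a : ℕ} (h : Anc par u a)
    (hu : 1 ≤ u) : 1 ≤ a ∧ a ≤ u :=
  Up.bounds (R := fun x => x = 0) rfl hpar h hu

/-- Both nodes are active, and they are in the same component of the forest of active nodes. -/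
def Same (par : ℕ → ℕ) (R : ℕ → Prop) (u v : ℕ) : Prop :=
  ¬ R u ∧ ¬ R v ∧ ∃ a, Up par R u a ∧ Up par R v a

/-! ### Distances to a set -/

namespace SimpleGraph

variable {V : Type*} {H : SimpleGraph V}

/-- The distance of `x` to the set `S` is `d`. -/
def DistTo (H : SimpleGraph V) (S : Set V) (x : V) (d : ℕ) : Prop :=
  (∃ z ∈ S, H.dist x z = d) ∧ ∀ z ∈ S, d ≤ H.dist x z

theorem DistTo.unique {S : Set V} {x : V} {d e : ℕ} (h : H.DistTo S x d) (h' : H.DistTo S x e) :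
    d = e := by
  obtain ⟨⟨z, hz, h1⟩, h2⟩ := h
  obtain ⟨⟨y, hy, g1⟩, g2⟩ := h'
  have := h2 y hy
  have := g2 z hz
  omega

theorem DistTo.of_mem {S : Set V} {x : V} (h : x ∈ S) : H.DistTo S x 0 :=
  ⟨⟨x, h, by simp⟩, fun _ _ => Nat.zero_le _⟩

/-- The rule by which all positive distances are computed: T is a set of neighbours of x through
which some shortest path to each point of S passes, so the distance is one plus the minimum over T.
In the applications T consists of the smaller neighbours of one node. -/
theorem DistTo.step {S T : Set V} {x : V} {D : V → ℕ} {m : ℕ}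
    (hadj : ∀ y ∈ T, H.Adj x y) (hD : ∀ y ∈ T, H.DistTo S y (D y))
    (hm : ∃ y ∈ T, D y = m) (hm' : ∀ y ∈ T, m ≤ D y)
    (hsep : ∀ z ∈ S, ∃ y ∈ T, H.dist x z = H.dist x y + H.dist y z) :
    H.DistTo S x (m + 1) := by
  have hlow : ∀ z ∈ S, m + 1 ≤ H.dist x z := by
    intro z hz
    obtain ⟨y, hy, h⟩ := hsep z hz
    have h1 := dist_eq_one_iff_adj.2 (hadj y hy)
    have h2 := (hD y hy).2 z hz
    have h3 := hm' y hy
    omega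
  refine ⟨?_, hlow⟩
  obtain ⟨y, hy, h⟩ := hm
  obtain ⟨z, hz, h'⟩ := (hD y hy).1
  have h1 := dist_eq_one_iff_adj.2 (hadj y hy)
  have h2 := (hadj y hy).reachable.dist_triangle_left z
  exact ⟨z, hz, le_antisymm (by omega) (hlow z hz)⟩

/-- Shortest paths that leave `C` pass through its boundary. -/
theorem exists_dist_eq_add {C T : Set V} (hT : ∀ a ∈ C, ∀ b ∉ C, H.Adj a b → b ∈ T) {x z : V}
    (hr : H.Reachable x z) (hx : x ∈ C) (hz : z ∉ C) :
    ∃ y ∈ T, H.dist x z = H.dist x y + H.dist y z := by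
  classical
  obtain ⟨p, hp⟩ := hr.exists_walk_length_eq_dist
  obtain ⟨d, hd, h1, h2⟩ := p.exists_boundary_dart C hx hz
  have hs := p.dart_snd_mem_support_of_mem_darts hd
  refine ⟨d.snd, hT _ h1 _ h2 d.adj, le_antisymm ?_ ?_⟩
  · exact (p.takeUntil _ hs).reachable.dist_triangle_left z
  · rw [← hp, ← congrArg Walk.length (p.take_spec hs), Walk.length_append]
    exact Nat.add_le_add (dist_le _) (dist_le _)

/-! ### Perfect elimination orders -/

/-- The vertices `1, …, n` of `H` are numbered so that the smaller neighbours of every vertex form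
a clique; the greatest of them is `par i`. -/
structure IsElim (H : SimpleGraph ℕ) (n : ℕ) (par : ℕ → ℕ) : Prop where
  mem : ∀ {i j}, H.Adj i j → 1 ≤ i ∧ i ≤ n
  clique : ∀ {i j k}, H.Adj i j → H.Adj i k → j < i → k < i → j ≠ k → H.Adj j k
  le_par : ∀ {i j}, H.Adj i j → j < i → j ≤ par i
  par_adj : ∀ {i}, 2 ≤ i → i ≤ n → H.Adj i (par i)
  -- Required beyond n as well, so that the lemmas on climbing need no upper bound. For i = 1 it
  -- forces the parent 0.
  par_lt : ∀ i, 1 ≤ i → par i < i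
  reach : ∀ {i j}, 1 ≤ i → i ≤ n → 1 ≤ j → j ≤ n → H.Reachable i j
  dist_le : ∀ {i j}, 1 ≤ i → i ≤ n → 1 ≤ j → j ≤ n → H.dist i j ≤ n

/-- The smaller neighbours of `i`. -/
def dn (H : SimpleGraph ℕ) (i : ℕ) : Set ℕ := {x | H.Adj i x ∧ x < i}

/-- The vertex `i` and its smaller neighbours. -/
def bag (H : SimpleGraph ℕ) (i : ℕ) : Set ℕ := insert i (H.dn i)

namespace IsElim

variable {H : SimpleGraph ℕ} {n : ℕ} {par : ℕ → ℕ} (hH : H.IsElim n par)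
include hH

/-- Both j and `par i` are smaller neighbours of i, hence equal or adjacent; in the latter case the
edge from i to j can be replaced by the edge from `par i` to j. -/
theorem up_of_adj {i j : ℕ} (h : H.Adj i j) (hji : j < i) : Anc par i j := by
  induction i using Nat.strong_induction_on with
  | _ i ih =>
    have h1 := hH.mem h
    have h2 := hH.mem h.symm
    have h3 := hH.par_adj (i := i) (by omega) (by omega)
    have h4 := hH.par_lt i h1.1
    have h5 := hH.mem h3.symm
    have h0 : Anc par i (par i) := .step (by omega)
    rcases (hH.le_par h hji).eq_or_lt with h6 | h6
    · exact h6 ▸ h0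
    · exact h0.trans (ih _ h4 (hH.clique h3 h h4 hji (by omega)) h6)

/-- An edge that leaves the subtree of s leads to a smaller vertex y. As y and `par z` are both
smaller neighbours of z, they are adjacent, and the edge can be lifted along the tree until it
starts at s. Thus `dn s` separates the subtree of s from the rest. -/
theorem boundary {s z y : ℕ} (hz : Anc par z s) (hz1 : 1 ≤ z) (hzy : H.Adj z y) (hy : ¬ Anc par y s) :
    y ∈ H.dn s := by
  have hyz : y < z := by
    rcases lt_trichotomy z y with h | h | h
    · exact (hy ((hH.up_of_adj hzy.symm h).trans hz)).elim
    · exact (H.irrefl (h ▸ hzy)).elim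
    · exact h
  induction z using Nat.strong_induction_on with
  | _ z ih =>
    rcases hz.eq_or_step with rfl | ⟨h1, h2⟩
    · exact ⟨hzy, hyz⟩
    · have h3 := hH.le_par hzy hyz
      have hne : y ≠ par z := fun h => hy (h ▸ h2)
      have h4 := hH.mem hzy
      have h5 := hH.mem hzy.symm
      have h6 := hH.par_lt z hz1
      have h7 := hH.par_adj (i := z) (by omega) h4.2
      exact ih _ h6 h2 (by omega) (hH.clique h7 hzy h6 hyz hne.symm) (by omega)

theorem bag_mem {t z : ℕ} (ht : 1 ≤ t) (htn : t ≤ n) (hz : z ∈ H.bag t) :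
    1 ≤ z ∧ z ≤ n ∧ Anc par t z := by
  rcases hz with rfl | hz
  · exact ⟨ht, htn, .refl⟩
  · exact ⟨(hH.mem hz.1.symm).1, (hH.mem hz.1.symm).2, hH.up_of_adj hz.1 hz.2⟩

theorem bag_adj {t z y : ℕ} (hz : z ∈ H.bag t) (hy : y ∈ H.bag t) (hne : z ≠ y) : H.Adj z y := by
  rcases hz with rfl | hz
  · rcases hy with rfl | hy
    · exact (hne rfl).elim
    · exact hy.1
  · rcases hy with rfl | hy
    · exact hz.1.symm
    · exact hH.clique hz.1 hy.1 hz.2 hy.2 hne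

/-- The smaller neighbours of i form a clique with greatest element `par i`. -/
theorem dn_subset_bag_par {i : ℕ} (hi : 1 ≤ i) : H.dn i ⊆ H.bag (par i) := by
  intro y hy
  by_cases h : y = par i
  · exact .inl h
  · have h1 := hH.le_par hy.1 hy.2
    have h2 := hH.mem hy.1
    have h3 := hH.mem hy.1.symm
    have h4 := hH.par_lt i hi
    exact .inr ⟨hH.clique (hH.par_adj (by have := hy.2; omega) h2.2) hy.1 h4 hy.2 (Ne.symm h),
      by omega⟩

/-- The distance of a vertex to a bag, if the bag is not below the vertex. -/
theorem distTo_of_not_up {t s m : ℕ} {D : ℕ → ℕ} (ht : 1 ≤ t) (htn : t ≤ n) (hs : 1 ≤ s)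
    (hsn : s ≤ n) (hst : ¬ Anc par t s) (hD : ∀ y ∈ H.dn s, H.DistTo (H.bag t) y (D y))
    (hm : ∃ y ∈ H.dn s, D y = m) (hm' : ∀ y ∈ H.dn s, m ≤ D y) :
    H.DistTo (H.bag t) s (m + 1) := by
  -- The bag of t consists of ancestors of t. None of them lies below s, since t does not, so every
  -- shortest path from s to the bag passes through `dn s`.
  refine .step (T := H.dn s) (fun y hy => hy.1) hD hm hm' fun z hz => ?_
  obtain ⟨h1, h2, h3⟩ := hH.bag_mem ht htn hz
  refine exists_dist_eq_add (C := {x | 1 ≤ x ∧ Anc par x s}) (fun a ha b hb hab => ?_)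
    (hH.reach hs hsn h1 h2) ⟨hs, .refl⟩ fun h => hst (h3.trans h.2)
  exact hH.boundary ha.2 ha.1 hab fun h => hb ⟨(hH.mem hab.symm).1, h⟩

/-- The distance to a bag of a vertex which is in the bag of `par p` but not in the bag of `p`,
where `p` is above the first bag. -/
theorem distTo_of_up {t p y m : ℕ} {D : ℕ → ℕ} (ht : 1 ≤ t) (htn : t ≤ n) (hp : Anc par t p)
    (hy : y ∈ H.bag (par p)) (hyp : y ∉ H.bag p) (hp2 : 1 ≤ par p)
    (hD : ∀ y ∈ H.dn p, H.DistTo (H.bag t) y (D y))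
    (hm : ∃ y ∈ H.dn p, D y = m) (hm' : ∀ y ∈ H.dn p, m ≤ D y) :
    H.DistTo (H.bag t) y (m + 1) := by
  have hp1 : 1 ≤ p ∧ p ≤ t := Anc.bounds hH.par_lt hp ht
  have hpp := hH.par_lt p hp1.1
  have hyb := hH.bag_mem hp2 (by omega) hy
  have hyle := (Anc.bounds hH.par_lt hyb.2.2 hp2).2
  refine .step (T := H.dn p) (fun x hx => ?_) hD hm hm' fun z hz => ?_
  · exact hH.bag_adj hy (hH.dn_subset_bag_par hp1.1 hx) fun h => hyp (.inr (h ▸ hx))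
  · obtain ⟨h1, h2, h3⟩ := hH.bag_mem ht htn hz
    -- The members of the bag of t below p are separated from y by `dn p`. The others are neighbours
    -- of t outside the subtree of p, hence belong to `dn p` themselves.
    by_cases hzp : Anc par z p
    · obtain ⟨x, hx, h⟩ := exists_dist_eq_add (C := {x | 1 ≤ x ∧ Anc par x p}) (T := H.dn p)
        (fun a ha b hb hab =>
          hH.boundary ha.2 ha.1 hab fun h => hb ⟨(hH.mem hab.symm).1, h⟩)
        (hH.reach h1 h2 hyb.1 hyb.2.1) ⟨h1, hzp⟩ fun h => by
          have := (Anc.bounds hH.par_lt h.2 hyb.1).2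
          omega
      refine ⟨x, hx, ?_⟩
      rw [dist_comm, h, dist_comm, add_comm, dist_comm]
    · refine ⟨z, ?_, by simp⟩
      rcases hz with rfl | hz
      · exact (hzp hp).elim
      · exact hH.boundary hp ht hz.1 hzp

/-- Go from u and from v to nearest vertices of the bag; these are equal or adjacent. This single
edge is the source of the additive error. -/
theorem dist_le_add {t u v d e : ℕ} (ht : 1 ≤ t) (htn : t ≤ n) (hu : 1 ≤ u) (hun : u ≤ n)
    (hd : H.DistTo (H.bag t) u d) (he : H.DistTo (H.bag t) v e) :
    H.dist u v ≤ d + e + 1 := by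
  obtain ⟨⟨x, hx, h1⟩, -⟩ := hd
  obtain ⟨⟨y, hy, h2⟩, -⟩ := he
  obtain ⟨hx1, hx2, -⟩ := hH.bag_mem ht htn hx
  obtain ⟨hy1, hy2, -⟩ := hH.bag_mem ht htn hy
  have h3 := (hH.reach hu hun hx1 hx2).dist_triangle_left v
  have h4 := (hH.reach hx1 hx2 hy1 hy2).dist_triangle_left v
  have h5 : H.dist x y ≤ 1 := by
    by_cases h : x = y
    · simp [h]
    · exact (dist_eq_one_iff_adj.2 (hH.bag_adj hx hy h)).le
  have h6 : H.dist v y = H.dist y v := dist_comm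
  omega

-- The lower bound when one of the two vertices is t, which has distance 0 to its own bag.
omit hH in
theorem add_le_dist_self {t v d e : ℕ} (hd : H.DistTo (H.bag t) t d)
    (he : H.DistTo (H.bag t) v e) : d + e ≤ H.dist t v := by
  have h0 : d = 0 := hd.unique (.of_mem (.inl rfl))
  have := he.2 t (.inl rfl)
  rw [dist_comm]; omega

/-- A shortest path that leaves the subtree of the child c passes through `dn c`, which is contained
in the bag of t. -/
theorem add_le_dist_child {t c u v d e : ℕ} (hc : 1 ≤ c) (hct : par c = t)
    (hu : 1 ≤ u) (hun : u ≤ n) (hv : 1 ≤ v) (hvn : v ≤ n)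
    (huc : Anc par u c) (hvc : ¬ Anc par v c)
    (hd : H.DistTo (H.bag t) u d) (he : H.DistTo (H.bag t) v e) : d + e ≤ H.dist u v := by
  obtain ⟨y, hy, h⟩ := exists_dist_eq_add (C := {x | 1 ≤ x ∧ Anc par x c}) (T := H.dn c)
    (fun a ha b hb hab => hH.boundary ha.2 ha.1 hab fun h => hb ⟨(hH.mem hab.symm).1, h⟩)
    (hH.reach hu hun hv hvn) ⟨hu, huc⟩ fun h => hvc h.2
  have hyt : y ∈ H.bag t := hct ▸ hH.dn_subset_bag_par hc hy
  have h1 := hd.2 y hyt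
  have h2 := he.2 y hyt
  rw [dist_comm] at h2
  omega

end IsElim

end SimpleGraph

/-! ### Centroids of the components of a forest -/

section Centroid

open Classical in
/-- The number of active nodes from which one can climb to `i`. -/
noncomputable def branchSize (n : ℕ) (par : ℕ → ℕ) (R : ℕ → Prop) (i : ℕ) : ℕ :=
  ((Finset.Icc 1 n).filter fun u => ¬ R u ∧ Up par R u i).card

open Classical in
/-- The number of active nodes in the component of `v`. -/
noncomputable def compSize (n : ℕ) (par : ℕ → ℕ) (R : ℕ → Prop) (v : ℕ) : ℕ :=
  ((Finset.Icc 1 n).filter fun u => Same par R u v).card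

variable {n : ℕ} {par : ℕ → ℕ} {R R' : ℕ → Prop} {i r t u v : ℕ}
variable (hR : R 0) (hpar : ∀ x, 1 ≤ x → par x < x)

-- The recursion behind `sumSizes`: the nodes strictly below i are classified by the child of i
-- through which they climb.
include hR hpar in
open Classical in
theorem branchSize_eq (hi : 1 ≤ i) (hin : i ≤ n) (hRi : ¬ R i) :
    branchSize n par R i =
      1 + ∑ c ∈ (Finset.Icc 1 n).filter fun c => ¬ R c ∧ par c = i, branchSize n par R c := by
  have hset : ((Finset.Icc 1 n).filter fun u => ¬ R u ∧ Up par R u i) =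
      insert i (((Finset.Icc 1 n).filter fun c => ¬ R c ∧ par c = i).biUnion fun c =>
        (Finset.Icc 1 n).filter fun u => ¬ R u ∧ Up par R u c) := by
    ext u
    simp only [Finset.mem_filter, Finset.mem_Icc, Finset.mem_insert, Finset.mem_biUnion]
    constructor
    · rintro ⟨hu, hRu, hup⟩
      by_cases hne : u = i
      · exact .inl hne
      · obtain ⟨c, h1, h2, h3⟩ := hup.exists_child hRu hne
        have := h3.bounds hR hpar hu.1
        exact .inr ⟨c, ⟨⟨this.1, by omega⟩, h2, h1⟩, hu, hRu, h3⟩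
    · rintro (rfl | ⟨c, ⟨hc, h1, rfl⟩, hu, hRu, h3⟩)
      · exact ⟨⟨hi, hin⟩, hRi, .refl⟩
      · exact ⟨hu, hRu, h3.trans (.step hRi)⟩
  rw [branchSize, hset, Finset.card_insert_of_notMem, Finset.card_biUnion, add_comm]
  · rfl
  · intro c hc d hd hcd
    simp only [Finset.coe_filter, Finset.mem_Icc, Set.mem_ofPred_eq] at hc hd
    refine Finset.disjoint_left.2 fun u hu hu' => hcd ?_
    simp only [Finset.mem_filter, Finset.mem_Icc] at hu hu'
    have hc1 := hpar c hc.1.1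
    have hd1 := hpar d hd.1.1
    rcases hu.2.2.total hu'.2.2 with h | h
    · rcases h.eq_or_step with h | ⟨_, h⟩
      · exact h
      · have := (h.bounds hR hpar (by omega)).2
        omega
    · rcases h.eq_or_step with h | ⟨_, h⟩
      · exact h.symm
      · have := (h.bounds hR hpar (by omega)).2
        omega
  · simp only [Finset.mem_biUnion, Finset.mem_filter, Finset.mem_Icc, not_exists, not_and]
    intro c hc _ _ h
    have := (h.bounds hR hpar hi).2
    have := hpar c hc.1.1
    omega

theorem branchSize_le : branchSize n par R i ≤ n := by
  classical
  refine (Finset.card_filter_le _ _).trans ?_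
  simp

/-- Since the parent of r is inactive, every climb inside the component can be continued to r, and
not beyond. So a component is identified by its root. -/
theorem same_iff_up_root (hRv : ¬ R v) (hvr : Up par R v r) (hr : R (par r)) :
    Same par R u v ↔ ¬ R u ∧ Up par R u r := by
  constructor
  · rintro ⟨h1, _, a, h2, h3⟩
    refine ⟨h1, ?_⟩
    rcases h3.total hvr with h | h
    · exact h2.trans h
    · rcases h.eq_or_step with rfl | ⟨h, _⟩
      · exact h2
      · exact (h hr).elim
  · rintro ⟨h1, h2⟩
    exact ⟨h1, hRv, r, h2, hvr⟩

theorem compSize_eq (hRv : ¬ R v) (hvr : Up par R v r) (hr : R (par r)) :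
    compSize n par R v = branchSize n par R r := by
  unfold compSize branchSize
  congr 1
  ext u
  simp only [Finset.mem_filter]
  exact and_congr_right fun _ => same_iff_up_root hRv hvr hr

/-- `t` is a centroid of the component with root `r`. -/
structure IsCentroid (n : ℕ) (par : ℕ → ℕ) (R : ℕ → Prop) (r t : ℕ) : Prop where
  one_le : 1 ≤ t
  le : t ≤ n
  act : ¬ R t
  up : Up par R t r
  root : R (par r)
  half : branchSize n par R r ≤ 2 * branchSize n par R t
  -- Among the nodes with at least half of the component below them, t is the greatest. This is what
  -- a scan in increasing order delivers, and it covers the children of t because they are greater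
  -- than t.
  max : ∀ u, t < u → u ≤ n → ¬ R u → Up par R u r → 2 * branchSize n par R u < branchSize n par R r

include hR hpar in
open Classical in
/-- Removing centroids halves the size of the components. -/
theorem IsCentroid.two_mul_compSize_le (hc : IsCentroid n par R r t) (hRR : ∀ x, R x → R' x)
    (ht : R' t) (hv : 1 ≤ v) (hvn : v ≤ n) (hRv : ¬ R' v) (hvr : Up par R v r) :
    2 * compSize n par R' v ≤ compSize n par R v := by
  have hRv' : ¬ R v := fun h => hRv (hRR _ h)
  rw [compSize_eq hRv' hvr hc.root]
  -- After the removal of t, a climb that starts below t must stop strictly below t.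
  have key : ∀ u a, ¬ R' u → Up par R' u a → Up par R u t → 1 ≤ u → ¬ a ≤ t := by
    intro u a hu hua hut hu1 hat
    exact ((Up.between hR hpar hua hut hu1 hat).not_of_not hu) ht
  -- Below t, the new component lies in the branch of a child, which is too small by maximality of
  -- t. Elsewhere it is disjoint from the branch of t, which contains at least half of the nodes.
  by_cases hvt : Up par R v t
  · obtain ⟨c, hct, hRc, hvc⟩ := hvt.exists_child hRv' fun h => hRv (h ▸ ht)
    have hc1 := hvc.bounds hR hpar hv
    have hcp := hpar c hc1.1
    have hcr : Up par R c r := (Up.step (hct ▸ hc.act)).trans (hct ▸ hc.up)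
    have h1 := hc.max c (by omega) (by omega) hRc hcr
    have h2 : compSize n par R' v ≤ branchSize n par R c := by
      refine Finset.card_le_card fun u hu => ?_
      simp only [Finset.mem_filter] at hu ⊢
      obtain ⟨hu1, hRu, _, a, ha1, ha2⟩ := hu
      refine ⟨hu1, fun h => hRu (hRR _ h), ?_⟩
      have hat := key v a hRv ha2 hvt hv
      rcases (ha2.mono hRR).total hvc with h | h
      · exact (ha1.mono hRR).trans h
      · rcases h.eq_or_step with rfl | ⟨_, h⟩
        · exact ha1.mono hRR
        · rw [hct] at h
          exact (hat (h.bounds hR hpar hc.one_le).2).elim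
    omega
  · have h2 : compSize n par R' v + branchSize n par R t ≤ branchSize n par R r := by
      unfold compSize branchSize
      rw [← Finset.card_union_of_disjoint]
      · refine Finset.card_le_card fun u hu => ?_
        simp only [Finset.mem_union, Finset.mem_filter] at hu ⊢
        rcases hu with ⟨hu1, hS⟩ | ⟨hu1, hRu, h⟩
        · obtain ⟨hRu, _, a, ha1, ha2⟩ := hS
          refine ⟨hu1, (same_iff_up_root hRv' hvr hc.root).1
            ⟨fun h => hRu (hRR _ h), hRv', a, ha1.mono hRR, ha2.mono hRR⟩⟩
        · exact ⟨hu1, hRu, h.trans hc.up⟩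
      · refine Finset.disjoint_left.2 fun u hu hu' => hvt ?_
        simp only [Finset.mem_filter, Finset.mem_Icc] at hu hu'
        obtain ⟨hu1, hRu, _, a, ha1, ha2⟩ := hu
        have hat := key u a hRu ha1 hu'.2.2 hu1.1
        rcases (ha1.mono hRR).total hu'.2.2 with h | h
        · exact (ha2.mono hRR).trans h
        · exact (hat (h.bounds hR hpar hc.one_le).2).elim
    have := hc.half
    omega

/-- `sd` labels the nodes of the component with root `r` by the components that are left when `t`
is removed: `t` for `t` itself, `0` for the component of `r`, and a child of `t` for the nodes
below this child. -/
structure IsSide (n : ℕ) (par : ℕ → ℕ) (R : ℕ → Prop) (r t : ℕ) (sd : ℕ → ℕ) : Prop where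
  self : sd t = t
  child : ∀ u, 1 ≤ u → u ≤ n → ¬ R u → Up par R u r → u ≠ t → par u = t → sd u = u
  root : r ≠ t → par r ≠ t → sd r = 0
  other : ∀ u, 1 ≤ u → u ≤ n → ¬ R u → Up par R u r → u ≠ t → u ≠ r → par u ≠ t →
    sd u = sd (par u)

namespace IsSide

variable {sd : ℕ → ℕ} (hs : IsSide n par R r t sd) (hr : R (par r))
  (htr : Up par R t r) (ht : 1 ≤ t)
include hs hR hpar hr htr ht

-- The defining rules are local, each referring at most to the label of the parent. By induction a
-- label is either 0, with a climb to r that avoids t, or a child of t to which the node climbs.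
omit ht in
theorem spec (hu : 1 ≤ u) (hun : u ≤ n) (hRu : ¬ R u) (hur : Up par R u r) (hut : u ≠ t) :
    (sd u = 0 ∧ Up par (fun x => R x ∨ x = t) u r ∧ ¬ Up par R u t) ∨
      (par (sd u) = t ∧ Up par (fun x => R x ∨ x = t) u (sd u)) := by
  induction u using Nat.strong_induction_on with
  | _ u ih =>
    by_cases hp : par u = t
    · have := hs.child u hu hun hRu hur hut hp
      exact .inr ⟨by rw [this, hp], by rw [this]; exact .refl⟩
    by_cases hrt : u = r
    · subst hrt
      refine .inl ⟨hs.root hut hp, .refl, fun h => hut ?_⟩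
      exact Up.antisymm hR hpar h htr hu
    · rcases hur.eq_or_step with h | ⟨h1, h2⟩
      · exact (hrt h).elim
      · have hpu := hpar u hu
        have hpu1 : 1 ≤ par u := Nat.one_le_iff_ne_zero.2 fun h0 => h1 (h0 ▸ hR)
        have hst : Up par (fun x => R x ∨ x = t) u (par u) := .step (not_or.2 ⟨h1, hp⟩)
        rw [hs.other u hu hun hRu hur hut hrt hp]
        rcases ih (par u) hpu hpu1 (by omega) h1 h2 hp with ⟨h3, h4, h5⟩ | ⟨h3, h4⟩
        · refine .inl ⟨h3, hst.trans h4, fun h => ?_⟩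
          rcases h.eq_or_step with h | ⟨_, h⟩
          · exact hut h
          · exact h5 h
        · exact .inr ⟨h3, hst.trans h4⟩

theorem ne_self (hu : 1 ≤ u) (hun : u ≤ n) (hRu : ¬ R u) (hur : Up par R u r) (hut : u ≠ t) :
    sd u ≠ t := by
  intro h
  rcases hs.spec hR hpar hr htr hu hun hRu hur hut with ⟨h1, _⟩ | ⟨h1, _⟩
  · omega
  · have := hpar t ht
    rw [h] at h1; omega

omit ht in
theorem same_of_eq (hu : 1 ≤ u) (hun : u ≤ n) (hRu : ¬ R u) (hur : Up par R u r)
    (hv : 1 ≤ v) (hvn : v ≤ n) (hRv : ¬ R v) (hvr : Up par R v r) (hut : u ≠ t) (hvt : v ≠ t)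
    (h : sd u = sd v) : Same par (fun x => R x ∨ x = t) u v := by
  refine ⟨not_or.2 ⟨hRu, hut⟩, not_or.2 ⟨hRv, hvt⟩, ?_⟩
  rcases hs.spec hR hpar hr htr hu hun hRu hur hut with ⟨h1, h2, h3⟩ | ⟨h1, h2⟩
  · rcases hs.spec hR hpar hr htr hv hvn hRv hvr hvt with ⟨g1, g2, g3⟩ | ⟨g1, g2⟩
    · exact ⟨r, h2, g2⟩
    · have := (g2.bounds (.inl hR) hpar hv).1
      omega
  · rcases hs.spec hR hpar hr htr hv hvn hRv hvr hvt with ⟨g1, g2, g3⟩ | ⟨g1, g2⟩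
    · have := (h2.bounds (.inl hR) hpar hu).1
      omega
    · exact ⟨sd u, h2, h ▸ g2⟩

/-- Lower bounds of distances between nodes with different labels. -/
theorem add_le_dist {H : SimpleGraph ℕ} (hH : H.IsElim n par) (hu : 1 ≤ u) (hun : u ≤ n)
    (hRu : ¬ R u) (hur : Up par R u r) (hv : 1 ≤ v) (hvn : v ≤ n) (hRv : ¬ R v)
    (hvr : Up par R v r) (h : sd u ≠ sd v) {d e : ℕ}
    (hd : H.DistTo (H.bag t) u d) (he : H.DistTo (H.bag t) v e) : d + e ≤ H.dist u v := by
  by_cases hut : u = t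
  · subst hut; exact SimpleGraph.IsElim.add_le_dist_self hd he
  by_cases hvt : v = t
  · subst hvt
    rw [SimpleGraph.dist_comm, add_comm]; exact SimpleGraph.IsElim.add_le_dist_self he hd
  have anc : ∀ {x a : ℕ}, Up par (fun x => R x ∨ x = t) x a → Anc par x a := fun h =>
    h.mono (R' := fun x => R x ∨ x = t) fun x hx => .inl (hx ▸ hR)
  -- Two different labels cannot both be 0, so up to symmetry x lies below the child `sd x` of t and
  -- y does not.
  have main : ∀ {x y dx dy : ℕ}, 1 ≤ x → x ≤ n → 1 ≤ y → y ≤ n → ¬ R y → Up par R y r → y ≠ t →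
      sd x ≠ sd y → par (sd x) = t → Up par (fun x => R x ∨ x = t) x (sd x) →
      H.DistTo (H.bag t) x dx → H.DistTo (H.bag t) y dy → dx + dy ≤ H.dist x y := by
    intro x y dx dy hx hxn hy hyn hRy hyr hyt hxy h1 h2 hdx hdy
    have hc := h2.bounds (.inl hR) hpar hx
    refine hH.add_le_dist_child hc.1 h1 hx hxn hy hyn (anc h2) (fun hyc => ?_) hdx hdy
    rcases hs.spec hR hpar hr htr hy hyn hRy hyr hyt with ⟨g1, g2, g3⟩ | ⟨g1, g2⟩
    · refine g3 (Up.between (R := fun x => x = 0) rfl hpar hyr ?_ hy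
        (htr.bounds hR hpar ht).2)
      exact hyc.trans (h1 ▸ Up.step (by omega))
    · have hd := g2.bounds (.inl hR) hpar hy
      rcases hyc.total (anc g2) with h | h
      · rcases h.eq_or_step with h | ⟨_, h⟩
        · exact hxy h
        · have := (Anc.bounds hpar h (by omega)).2
          have := hpar _ hd.1
          omega
      · rcases h.eq_or_step with h | ⟨_, h⟩
        · exact hxy h.symm
        · have := (Anc.bounds hpar h (by omega)).2
          have := hpar _ hc.1
          omega
  rcases hs.spec hR hpar hr htr hu hun hRu hur hut with ⟨h1, h2, h3⟩ | ⟨h1, h2⟩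
  · rcases hs.spec hR hpar hr htr hv hvn hRv hvr hvt with ⟨g1, g2, g3⟩ | ⟨g1, g2⟩
    · omega
    · rw [SimpleGraph.dist_comm, add_comm]
      exact main hv hvn hu hun hRu hur hut (Ne.symm h) g1 g2 he hd
  · exact main hu hun hv hvn hRv hvr hvt h h1 h2 hd he

end IsSide

end Centroid

namespace RowMachine

/-! ### Loops over adjacency lists and linked lists -/

/-- The array `A` contains the adjacency lists `nb v`, `v < n`. -/
structure IsInput (L n : ℕ) (nb : ℕ → List ℕ) (A : ℕ → ℕ) : Prop where
  next : ∀ v < n, A (v + 2) = A (v + 1) + (nb v).length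
  entry : ∀ v < n, ∀ j (h : j < (nb v).length), A (A (v + 1) + j) = (nb v)[j]
  lt : ∀ v < n, A (v + 2) < L
  -- Distances are at most n, so the sum of two of them is a legal value.
  n_lt : 2 * n + 2 < L

/-- Execute `body` for all neighbours `w` of the vertex in register `v`. -/
def forNb (body : Pg) : Pg :=
  .seq (.set .e (.ld .inp (.add (.v .v) (.c 1))))
    (.seq (.set .f (.ld .inp (.add (.add (.v .v) (.c 1)) (.c 1))))
      (.loop (.lt (.v .e) (.v .f))
        (.seq (.seq (.set .w (.ld .inp (.v .e))) (.set .e (.add (.v .e) (.c 1)))) body)))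

/-- The invariant is indexed by the list of neighbours still to be processed; `hst` says that it
ignores the registers of the loop itself. -/
theorem Run.forNb {L n : ℕ} {nb : ℕ → List ℕ} {body : Pg} {s : St} {T : ℕ} {v : ℕ}
    (hin : IsInput L n nb (s.a .inp)) (hv : s.r .v = v) (hvn : v < n)
    (I : List ℕ → St → Prop)
    (hst : ∀ l s m, I l s → I l (s.setR .e m) ∧ I l (s.setR .f m) ∧ I l (s.setR .w m))
    (h1 : body.wr .e = false) (h2 : body.wr .f = false) (h3 : body.wa .inp = false)
    (hI : ∀ w l s, w ∈ nb v → I (w :: l) s → s.r .w = w → Run L body s T (I l))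
    (h : I (nb v) s) :
    Run L (forNb body) s ((nb v).length * (T + 30) + 30) (I []) := by
  have hnL := hin.n_lt
  have e1 := hin.next v hvn
  have e2 := hin.lt v hvn
  set A := s.a .inp with hA
  have hloop := Run.counted (L := L) (t := .lt (.v .e) (.v .f))
    (c := .seq (.seq (.set .w (.ld .inp (.v .e))) (.set .e (.add (.v .e) (.c 1)))) body)
    (fun i s => s.r .e = A (v + 1) + i ∧ s.r .f = A (v + 2) ∧ s.a .inp = A ∧ I ((nb v).drop i) s)
    (fun _ => 12 + T) (Nat.zero_le (nb v).length) (fun i s _ => by simp)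
    (fun i s _ hi hs => by simp [hs.1, hs.2.1, e1])
    (fun i s _ hi hs => ?_)
    (s := (s.setR .e (A (v + 1))).setR .f (A (v + 2))) ?_
  · refine Run.mono (Run.seq (T := 10) (Run.straight (Q := fun s' =>
      s' = s.setR .e (A (v + 1))) ?_ (by decide) ?_) fun s1 hs1 _ => Run.seq (T := 12)
      (Run.straight (Q := fun s' => s' = (s.setR .e (A (v + 1))).setR .f (A (v + 2))) ?_
      (by decide) ?_) fun s2 hs2 _ => hs2 ▸ hloop) ?_ fun s' hs' => by simpa using hs'.2.2.2
    · simp [hv]; omega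
    · simp [hv, hA]
    · subst hs1; simp [hv]; omega
    · subst hs1; simp [hv, hA]
    · simp [Ts.cost, Ex.cost]; ring_nf; omega
  · obtain ⟨q1, q2, q3, q4⟩ := hs
    refine Run.seq (Run.straight (Q := fun s' => s' = (s.setR .w (nb v)[i]).setR .e
      (A (v + 1) + (i + 1))) ?_ (by decide) ?_) fun s1 hs1 _ => ?_
    · simp [q1]; omega
    · simp [q1, q3, hin.entry v hvn i hi, add_assoc]
    · subst hs1
      have hd : (nb v).drop i = (nb v)[i] :: (nb v).drop (i + 1) := List.drop_eq_getElem_cons hi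
      rw [hd] at q4
      refine Run.mono (Run.framed (hI (nb v)[i] ((nb v).drop (i + 1)) _ (List.getElem_mem hi)
        (hst _ _ _ (hst _ _ _ q4).2.2).1 (by simp))) le_rfl ?_
      rintro s' ⟨h4, h5, h6⟩
      refine ⟨?_, ?_, ?_, h4⟩
      · rw [h5 _ h1]; simp
      · rw [h5 _ h2]; simp [q2]
      · rw [h6 _ h3]; simp [q3]
  · refine ⟨by simp, by simp, by simp [hA], ?_⟩
    simpa using (hst _ _ _ (hst _ _ _ h).1).2.1

/-- Execute `body` for all smaller neighbours `x` of the number in register `u`. -/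
def forDn (body : Pg) : Pg :=
  .seq (.set .v (.ld .ord (.v .u)))
    (forNb (.seq (.set .x (.ld .pos (.v .w))) (.ite (.lt (.v .x) (.v .u)) body .skip)))

/-- The list of smaller neighbours of `u`, if `O u` is the vertex with number `u` and `P w` is the
number of the vertex `w`. -/
def dnList (nb : ℕ → List ℕ) (O P : ℕ → ℕ) (u : ℕ) : List ℕ :=
  ((nb (O u)).map P).filter (· < u)

/-- The adjacency lists are neither renamed nor sorted: the whole list is scanned and numbers are
compared, so the cost is governed by the full degree of the vertex. -/
theorem Run.forDn {L n : ℕ} {nb : ℕ → List ℕ} {body : Pg} {s : St} {T : ℕ} {u : ℕ}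
    (hin : IsInput L n nb (s.a .inp)) (hu : s.r .u = u) (hun : s.a .ord u < n)
    (I : List ℕ → St → Prop)
    (hst : ∀ l s m, I l s → I l (s.setR .e m) ∧ I l (s.setR .f m) ∧ I l (s.setR .w m) ∧
      I l (s.setR .v m) ∧ I l (s.setR .x m))
    (h1 : body.wr .e = false) (h2 : body.wr .f = false) (h3 : body.wa .inp = false)
    (h4 : body.wr .u = false) (h5 : body.wa .pos = false)
    (hI : ∀ x l s', x ∈ dnList nb (s.a .ord) (s.a .pos) u → I (x :: l) s' → s'.r .x = x →
      s'.r .u = u → Run L body s' T (I l))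
    (h6 : body.wa .ord = false)
    (h : I (dnList nb (s.a .ord) (s.a .pos) u) s) :
    Run L (forDn body) s ((nb (s.a .ord u)).length * (T + 60) + 60) (I []) := by
  set O := s.a .ord with hO
  set P := s.a .pos with hP
  have hloop := Run.forNb (L := L) (n := n) (nb := nb) (T := T + 20)
    (body := .seq (.set .x (.ld .pos (.v .w))) (.ite (.lt (.v .x) (.v .u)) body .skip))
    (s := s.setR .v (O u)) (v := O u) (by simpa using hin) (by simp) hun
    (fun l s => s.a .ord = O ∧ s.a .pos = P ∧ s.r .u = u ∧ I ((l.map P).filter (· < u)) s)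
    ?_ (by simp [Pg.wr, h1]) (by simp [Pg.wr, h2]) (by simp [Pg.wa, h3]) ?_ ?_
  · refine Run.mono (Run.seq (T := 5) (Run.straight (Q := fun s' => s' = s.setR .v (O u)) ?_
      (by decide) ?_) fun s1 hs1 _ => hs1 ▸ hloop) ?_ fun s' hs' => by simpa using hs'.2.2.2
    · simp
    · simp [hu, hO]
    · ring_nf; omega
  · rintro l s m ⟨g1, g2, g3, g4⟩
    have := hst _ _ m g4
    exact ⟨⟨g1, g2, by simp [g3], this.1⟩, ⟨g1, g2, by simp [g3], this.2.1⟩,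
      ⟨g1, g2, by simp [g3], this.2.2.1⟩⟩
  · rintro w l s hw ⟨g1, g2, g3, g4⟩ g5
    refine Run.mono (Run.seq (T := 5) (Run.straight (Q := fun s' => s' = s.setR .x (P w)) ?_
      (by decide) ?_) fun s1 hs1 _ => Run.ite (T := T + 1) (Q := fun s' =>
        s'.a .ord = O ∧ s'.a .pos = P ∧ s'.r .u = u ∧ I ((l.map P).filter (· < u)) s')
        ?_ (fun hb => ?_) fun hb => ?_) ?_ fun s' hs' => hs'
    · simp
    · simp [g5, g2]
    · simp
    · subst hs1
      simp only [Ts.Holds, Ex.val, St.setR_r, Function.update_self, ne_eq, reduceCtorEq,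
        not_false_eq_true, Function.update_of_ne, g3] at hb
      have hx : P w ∈ dnList nb O P u :=
        List.mem_filter.2 ⟨List.mem_map.2 ⟨w, hw, rfl⟩, by simpa using hb⟩
      refine Run.mono (Run.framed (hI (P w) ((l.map P).filter (· < u)) _ hx ?_ (by simp)
        (by simpa using g3))) (by omega) ?_
      · have := (hst _ _ (P w) g4).2.2.2.2
        simpa [List.filter_cons, hb] using this
      · rintro s' ⟨k1, k2, k3⟩
        exact ⟨by rw [k3 _ h6]; simpa using g1, by rw [k3 _ h5]; simpa using g2,
          by rw [k2 _ h4]; simpa using g3, k1⟩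
    · subst hs1
      simp only [Ts.Holds, Ex.val, St.setR_r, Function.update_self, ne_eq, reduceCtorEq,
        not_false_eq_true, Function.update_of_ne, g3] at hb
      refine Run.straight trivial (by simp [Pg.tm]) ⟨g1, g2, by simpa using g3, ?_⟩
      have := (hst _ _ (P w) g4).2.2.2.2
      simpa [List.filter_cons, hb] using this
    · simp [Ts.cost, Ex.cost]; omega
  · exact ⟨by simp [hO], by simp [hP], by simp [hu], (hst _ _ _ h).2.2.2.1⟩

/-- The linked list with first element `p` and successor function `nx`; `0` marks the end. -/
def Lst (nx : ℕ → ℕ) : ℕ → List ℕ → Prop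
  | p, [] => p = 0
  | p, i :: l => p = i ∧ i ≠ 0 ∧ Lst nx (nx i) l

theorem Lst.congr {nx nx' : ℕ → ℕ} {p : ℕ} {l : List ℕ} (h : Lst nx p l)
    (hl : ∀ i ∈ l, nx' i = nx i) : Lst nx' p l := by
  induction l generalizing p with
  | nil => exact h
  | cons i l ih =>
    refine ⟨h.1, h.2.1, ?_⟩
    rw [hl i (by simp)]
    exact ih h.2.2 fun j hj => hl j (by simp [hj])

/-- Execute `body` for all elements `u` of the list that starts with the value of `u`. -/
def forList (body : Pg) : Pg :=
  .loop (.not (.eq (.v .u) (.c 0))) (.seq body (.set .u (.ld .ln (.v .u))))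

/-- Here the invariant is indexed by the processed prefix, as later nodes rely on earlier ones. The
cost may depend on the element, so that the costs add up to a total degree. -/
theorem Run.forList {L : ℕ} {body : Pg} {s : St} {T : ℕ → ℕ} {nx : ℕ → ℕ} (l : List ℕ)
    (I : List ℕ → St → Prop) (hst : ∀ l s m, I l s → I l (s.setR .u m))
    (h1 : body.wr .u = false) (h2 : body.wa .ln = false)
    (hI : ∀ d x t s, l = d ++ x :: t → I d s → s.r .u = x → Run L body s (T x) (I (d ++ [x])))
    (hl : Lst nx (s.r .u) l) (hnx : s.a .ln = nx) (h : I [] s) :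
    Run L (forList body) s ((l.map fun x => T x + 20).sum + 20) (I l) := by
  suffices H : ∀ (t d : List ℕ) (s : St), l = d ++ t → Lst nx (s.r .u) t → s.a .ln = nx → I d s →
      Run L (RowMachine.forList body) s ((t.map fun x => T x + 20).sum + 20) (I l) from
    H l [] s rfl hl hnx h
  intro t
  induction t with
  | nil =>
    intro d s hd hl hnx h
    refine ⟨_, s, .loopFalse _ (by simp) (by simpa [Lst] using hl), by simp [Ts.cost, Ex.cost], ?_⟩
    rw [hd, List.append_nil]
    exact h
  | cons x t ih =>
    intro d s hd hl hnx h
    obtain ⟨t1, s1, k1, k2, k3⟩ := hI d x t s hd h hl.1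
    obtain ⟨f1, f2⟩ := k1.frame
    have hu : s1.r .u = x := by rw [f1 _ h1]; exact hl.1
    have hn : s1.a .ln = nx := by rw [f2 _ h2]; exact hnx
    obtain ⟨t2, s2, g1, g2, g3⟩ := ih (d ++ [x]) (s1.setR .u (nx x)) (by simp [hd])
      (by simpa using hl.2.2) (by simpa using hn) (hst _ _ _ k3)
    have hset := Big.set (L := L) s1 .u (.ld .ln (.v .u)) (by simp)
    simp only [Ex.val, hu, hn] at hset
    refine ⟨_, s2, .loopTrue (by simp) ?_ (.seq k1 hset) g1, ?_, g3⟩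
    · simp only [Ts.Holds, Ex.val, hl.1]
      exact hl.2.1
    · simp only [Ts.cost, Ex.cost, List.map_cons, List.sum_cons]
      omega

end RowMachine

/-! ### Loops over the numbers from 1 to n, and the basic operations on smaller neighbours -/

namespace RowMachine

/-- Execute `body` for `i = 1, …, n`. -/
def forUp (body : Pg) : Pg :=
  .seq (.set .i (.c 1))
    (.loop (.not (.lt (.v .n) (.v .i))) (.seq body (.set .i (.add (.v .i) (.c 1)))))

theorem Run.forUp {L n : ℕ} {body : Pg} {s : St} (T : ℕ → ℕ) (I : ℕ → St → Prop)
    (hL : n + 1 < L) (hn : s.r .n = n) (hst : ∀ i s m, I i s → I i (s.setR .i m))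
    (h1 : body.wr .i = false) (h2 : body.wr .n = false)
    (hI : ∀ i s, 1 ≤ i → i ≤ n → s.r .n = n → s.r .i = i → I i s →
      Run L body s (T i) (I (i + 1)))
    (h : I 1 s) :
    Run L (forUp body) s (∑ i ∈ Finset.Icc 1 n, (T i + 20) + 20) (I (n + 1)) := by
  have hloop := Run.counted (L := L) (t := .not (.lt (.v .n) (.v .i)))
    (c := .seq body (.set .i (.add (.v .i) (.c 1)))) (s := s.setR .i 1)
    (fun i s => s.r .n = n ∧ s.r .i = i ∧ I i s) (fun i => T i + 4)
    (show 1 ≤ n + 1 by omega) (fun i s _ => by simp)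
    (fun i s _ _ hs => by simp only [Ts.Holds, Ex.val, hs.1, hs.2.1]; omega)
    (fun i s hi hi' hs => ?_) ⟨by simp [hn], by simp, hst _ _ _ h⟩
  · refine Run.mono (Run.seq (T := 2) (Run.straight (Q := fun s' => s' = s.setR .i 1) (by simp)
      (by decide) (by simp)) fun s1 hs1 _ => hs1 ▸ hloop) ?_ fun s' hs' => hs'.2.2
    have : Finset.Ico 1 (n + 1) = Finset.Icc 1 n := rfl
    rw [this]
    have : ∑ i ∈ Finset.Icc 1 n, (T i + 4 + (Ts.not (.lt (.v .n) (.v .i))).cost + 1) ≤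
        ∑ i ∈ Finset.Icc 1 n, (T i + 20) :=
      Finset.sum_le_sum fun i _ => by simp [Ts.cost, Ex.cost]
    have h4 : (Ts.not (.lt (.v .n) (.v .i))).cost = 4 := rfl
    omega
  · obtain ⟨g1, g2, g3⟩ := hs
    refine Run.seq (hI i s hi (by omega) g1 g2 g3) fun s1 hs1 hf => ?_
    have k1 : s1.r .n = n := by rw [hf.1 _ h2, g1]
    have k2 : s1.r .i = i := by rw [hf.1 _ h1, g2]
    refine Run.straight ?_ (by decide) ?_
    · simp [k2]; omega
    · exact ⟨by simp [k1], by simp [k2], hst _ _ _ hs1⟩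

/-- Execute `body` for `i = n, …, 1`. -/
def forDown (body : Pg) : Pg :=
  .seq (.set .i (.v .n))
    (.loop (.lt (.c 0) (.v .i)) (.seq body (.set .i (.sub (.v .i) (.c 1)))))

theorem Run.forDown {L n : ℕ} {body : Pg} {s : St} {T : ℕ} (I : ℕ → St → Prop)
    (hn : s.r .n = n) (hst : ∀ i s m, I i s → I i (s.setR .i m))
    (h1 : body.wr .i = false)
    (hI : ∀ i s, 1 ≤ i → i ≤ n → s.r .i = i → I i s → Run L body s T (I (i - 1)))
    (h : I n s) :
    Run L (forDown body) s (n * (T + 20) + 20) (I 0) := by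
  have hloop := Run.counted (L := L) (t := .lt (.c 0) (.v .i))
    (c := .seq body (.set .i (.sub (.v .i) (.c 1)))) (s := s.setR .i n)
    (fun k s => s.r .i = n - k ∧ I (n - k) s) (fun i => T + 4)
    (Nat.zero_le n) (fun i s _ => by simp)
    (fun i s _ _ hs => by simp [hs.1])
    (fun i s hi hi' hs => ?_) ⟨by simp, hst _ _ _ h⟩
  · refine Run.mono (Run.seq (T := 2) (Run.straight (Q := fun s' => s' = s.setR .i n) (by simp)
      (by decide) (by simp [hn])) fun s1 hs1 _ => hs1 ▸ hloop) ?_ fun s' hs' => by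
        simpa using hs'.2
    have h4 : (Ts.lt (.c 0) (.v .i)).cost = 3 := rfl
    simp only [h4, Finset.sum_const, Nat.card_Ico, smul_eq_mul, Nat.sub_zero]
    ring_nf; omega
  · obtain ⟨g2, g3⟩ := hs
    refine Run.seq (hI (n - i) s (by omega) (by omega) g2 g3) fun s1 hs1 hf => ?_
    have k2 : s1.r .i = n - i := by rw [hf.1 _ h1, g2]
    refine Run.straight ?_ (by decide) ?_
    · simp
    · exact ⟨by simp [k2]; omega, hst _ _ _ hs1⟩

/-! ### The elimination forest in memory -/

/-- A graph `H` with an elimination order, its adjacency lists and the arrays that describe it: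
`O u` is the vertex with number `u`, and `P` is the inverse function. -/
structure Inst where
  (n L : ℕ)
  nb : ℕ → List ℕ
  (A O P par : ℕ → ℕ)
  H : SimpleGraph ℕ

namespace Inst

/-- The parts of the description fit together. -/
structure Good (X : Inst) : Prop where
  input : IsInput X.L X.n X.nb X.A
  ord_lt : ∀ u, 1 ≤ u → u ≤ X.n → X.O u < X.n
  mem_dn : ∀ u, 1 ≤ u → u ≤ X.n → ∀ x, x ∈ dnList X.nb X.O X.P u ↔ x ∈ X.H.dn u
  elim : X.H.IsElim X.n X.par

/-- The memory contains the description. -/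
structure Tab (X : Inst) (s : St) : Prop where
  n : s.r .n = X.n
  inp : s.a .inp = X.A
  ord : s.a .ord = X.O
  pos : s.a .pos = X.P
  par : s.a .par = X.par

/-- The program does not change the description. -/
def keeps (c : Pg) : Bool :=
  !(c.wr .n || c.wa .inp || c.wa .ord || c.wa .pos || c.wa .par)

theorem Tab.frame {X : Inst} {s s' : St} {c : Pg} (h : X.Tab s) (hf : Frame c s s')
    (hc : keeps c = true) : X.Tab s' := by
  simp only [keeps, Bool.not_eq_true', Bool.or_eq_false_iff] at hc
  obtain ⟨⟨⟨⟨h1, h2⟩, h3⟩, h4⟩, h5⟩ := hc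
  exact ⟨by rw [hf.1 _ h1, h.n], by rw [hf.2 _ h2, h.inp], by rw [hf.2 _ h3, h.ord],
    by rw [hf.2 _ h4, h.pos], by rw [hf.2 _ h5, h.par]⟩

/-- The degree of the vertex number `u`. -/
def deg (X : Inst) (u : ℕ) : ℕ := (X.nb (X.O u)).length

end Inst

/-- `m` becomes one more than the minimum of `ds` over the smaller neighbours of `u`. -/
def minDn : Pg :=
  .seq (.set .m (.v .n))
    (.seq (forDn (.ite (.lt (.ld .ds (.v .x)) (.v .m)) (.set .m (.ld .ds (.v .x))) .skip))
      (.set .m (.add (.v .m) (.c 1))))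

/-- The starting value n of the minimum is harmless: the distances are at most n, and `dn u` is not
empty, because it contains `par u`. -/
theorem run_minDn {X : Inst} (hX : X.Good) {s : St} (hs : X.Tab s) {u : ℕ} (hu : s.r .u = u)
    (hu1 : 2 ≤ u) (hun : u ≤ X.n) (hd : ∀ x ∈ X.H.dn u, s.a .ds x ≤ X.n) :
    Run X.L minDn s (120 * (X.deg u + 1)) (fun s' => ∃ μ, s'.r .m = μ + 1 ∧
      (∃ y ∈ X.H.dn u, s.a .ds y = μ) ∧ ∀ y ∈ X.H.dn u, μ ≤ s.a .ds y) := by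
  have hnL := hX.input.n_lt
  have hmem := hX.mem_dn u (by omega) hun
  have hpar : X.par u ∈ X.H.dn u := ⟨hX.elim.par_adj hu1 hun, hX.elim.par_lt u (by omega)⟩
  have hloop := Run.forDn (L := X.L) (n := X.n) (nb := X.nb) (T := 20) (u := u)
    (s := s.setR .m X.n)
    (body := .ite (.lt (.ld .ds (.v .x)) (.v .m)) (.set .m (.ld .ds (.v .x))) .skip)
    (by simpa [hs.inp] using hX.input) (by simpa using hu)
    (by simpa [hs.ord] using hX.ord_lt u (by omega) hun)
    (fun l s' => s'.a .ds = s.a .ds ∧ (s'.r .m = X.n ∨ ∃ y ∈ X.H.dn u, s.a .ds y = s'.r .m) ∧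
      ∀ y ∈ X.H.dn u, s'.r .m ≤ s.a .ds y ∨ y ∈ l)
    (fun l s m h => ⟨by simpa using h, by simpa using h, by simpa using h, by simpa using h,
      by simpa using h⟩) (by decide) (by decide) (by decide) (by decide) (by decide)
    ?_ (by decide) ?_
  · have key : (s.setR .m X.n).a .ord = X.O := hs.ord
    rw [key] at hloop
    refine Run.mono (T := 2 + (((X.nb (X.O u)).length * (20 + 60) + 60) + 4))
      (Q := fun s2 => (∀ y ∈ X.H.dn u, s2.r .m ≤ s.a .ds y + 1) ∧
        ∃ y ∈ X.H.dn u, s.a .ds y + 1 = s2.r .m)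
      (Run.seq (Run.straight (Q := fun s' => s' = s.setR .m X.n) (by simp)
      (by decide) (by simp [hs.n])) fun s1 hs1 _ => ?_) ?_ fun s' hs' => ?_
    · subst hs1
      refine Run.seq hloop fun s2 hs2 _ => ?_
      obtain ⟨g1, g2, g3⟩ := hs2
      simp only [List.not_mem_nil, or_false] at g3
      have h5 := g3 _ hpar
      have h6 := hd _ hpar
      refine Run.straight ?_ (by decide) ⟨fun y hy => by simpa using g3 y hy, ?_⟩
      · simp; omega
      · rcases g2 with g2 | ⟨y, hy, g2⟩
        · refine ⟨_, hpar, ?_⟩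
          simp; omega
        · exact ⟨y, hy, by simp [g2]⟩
    · simp only [Inst.deg]; omega
    · obtain ⟨h1, y, hy, h2⟩ := hs'
      exact ⟨s.a .ds y, h2.symm, ⟨y, hy, rfl⟩, fun z hz => by have := h1 z hz; omega⟩
  · rintro x l s1 hx ⟨g1, g2, g3⟩ hx1 hu1
    have hx' : x ∈ X.H.dn u := by
      rw [← hmem]; simpa [hs.ord, hs.pos] using hx
    refine Run.straight (by simp) (by decide) ?_
    by_cases hlt : s1.a .ds (s1.r .x) < s1.r .m
    · simp only [Pg.den, Ts.Holds, Ex.val, hlt, if_true]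
      refine ⟨by simpa using g1, .inr ⟨x, hx', by simp [hx1, g1]⟩, fun y hy => ?_⟩
      rcases g3 y hy with h | h
      · left; simp; omega
      · rcases List.mem_cons.1 h with rfl | h
        · left; simp [hx1, g1]
        · exact .inr h
    · simp only [Pg.den, Ts.Holds, Ex.val, hlt, if_false]
      refine ⟨g1, g2, fun y hy => ?_⟩
      rcases g3 y hy with h | h
      · exact .inl h
      · rcases List.mem_cons.1 h with rfl | h
        · left; rw [← g1, ← hx1]; omega
        · exact .inr h
  · refine ⟨by simp, .inl (by simp), fun y hy => .inr ?_⟩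
    simpa [hs.ord, hs.pos] using (hmem y).2 hy

/-- The smaller neighbours of `u` without the mark `t` get this mark and the value `m` of `ds`. -/
def markDn : Pg :=
  forDn (.ite (.eq (.ld .stp (.v .x)) (.v .t)) .skip
    (.seq (.store .stp (.v .x) (.v .t)) (.store .ds (.v .x) (.v .m))))

/-- Vertices that already carry the mark keep their distance; only those reached for the first time
receive the value in m. -/
theorem run_markDn {X : Inst} (hX : X.Good) {s : St} (hs : X.Tab s) {u : ℕ} (hu : s.r .u = u)
    (hu1 : 1 ≤ u) (hun : u ≤ X.n) :
    Run X.L markDn s (120 * (X.deg u + 1)) (fun s' =>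
      (∀ y, s'.a .stp y = s.a .stp y ∨ (s'.a .stp y = s.r .t ∧ y ∈ X.H.dn u)) ∧
      (∀ y ∈ X.H.dn u, s'.a .stp y = s.r .t) ∧
      (∀ y, s.a .stp y = s.r .t → s'.a .stp y = s.r .t ∧ s'.a .ds y = s.a .ds y) ∧
      (∀ y, s.a .stp y ≠ s.r .t → s'.a .stp y = s.r .t → s'.a .ds y = s.r .m)) := by
  have hmem := hX.mem_dn u hu1 hun
  have hloop := Run.forDn (L := X.L) (n := X.n) (nb := X.nb) (T := 40) (u := u)
    (s := s)
    (body := .ite (.eq (.ld .stp (.v .x)) (.v .t)) .skip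
      (.seq (.store .stp (.v .x) (.v .t)) (.store .ds (.v .x) (.v .m))))
    (by simpa [hs.inp] using hX.input) hu
    (by simpa [hs.ord] using hX.ord_lt u hu1 hun)
    (fun l s' => (s'.r .t = s.r .t ∧ s'.r .m = s.r .m) ∧
      (∀ y, s'.a .stp y = s.a .stp y ∨ (s'.a .stp y = s.r .t ∧ y ∈ X.H.dn u)) ∧
      (∀ y ∈ X.H.dn u, s'.a .stp y = s.r .t ∨ y ∈ l) ∧
      (∀ y, s.a .stp y = s.r .t → s'.a .stp y = s.r .t ∧ s'.a .ds y = s.a .ds y) ∧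
      (∀ y, s.a .stp y ≠ s.r .t → s'.a .stp y = s.r .t → s'.a .ds y = s.r .m))
    (fun l s m h => ⟨by simpa using h, by simpa using h, by simpa using h, by simpa using h,
      by simpa using h⟩) (by decide) (by decide) (by decide) (by decide) (by decide)
    ?_ (by decide) ?_
  · refine Run.mono hloop ?_ fun s' hs' => ?_
    · rw [hs.ord]; simp only [Inst.deg]; omega
    · simpa using hs'.2
  · rintro x l s1 hx ⟨⟨g0, g0'⟩, g1, g2, g3, g4⟩ hx1 hu1
    have hx' : x ∈ X.H.dn u := by
      rw [← hmem]; simpa [hs.ord, hs.pos] using hx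
    refine Run.straight (by simp) (by decide) ?_
    by_cases hlt : s1.a .stp (s1.r .x) = s1.r .t
    · simp only [Pg.den, Ts.Holds, Ex.val, hlt, if_true]
      refine ⟨⟨g0, g0'⟩, g1, fun y hy => ?_, g3, g4⟩
      rcases g2 y hy with h | h
      · exact .inl h
      · rcases List.mem_cons.1 h with rfl | h
        · left; rw [← hx1, hlt, g0]
        · exact .inr h
    · simp only [Pg.den, Ts.Holds, Ex.val, hlt, if_false]
      rw [hx1, g0] at hlt
      refine ⟨by simp [g0, g0'], fun y => ?_, fun y hy => ?_, fun y hy => ?_, fun y hy hy' => ?_⟩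
      · by_cases hyx : y = x
        · subst hyx; right; simp [hx1, g0, hx']
        · simpa [hx1, hyx] using g1 y
      · by_cases hyx : y = x
        · subst hyx; left; simp [hx1, g0]
        · simpa [hx1, hyx] using g2 y hy
      · by_cases hyx : y = x
        · subst hyx; exact (hlt (g3 y hy).1).elim
        · simpa [hx1, hyx] using g3 y hy
      · by_cases hyx : y = x
        · subst hyx; simp [hx1, g0']
        · simpa [hx1, hyx] using g4 y hy (by simpa [hx1, hyx] using hy')
  · refine ⟨⟨rfl, rfl⟩, fun y => .inl rfl, fun y hy => .inr ?_, fun y hy => ⟨hy, rfl⟩,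
      fun y hy hy' => (hy hy').elim⟩
    simpa [hs.ord, hs.pos] using (hmem y).2 hy

end RowMachine

namespace RowMachine

/-! ### Sizes, roots, centroids and node lists of the components -/

/-- Reset the sizes and the lists. -/
def resetTables : Pg :=
  forUp (.seq (.store .sz (.v .i) (.c 1)) (.store .lh (.v .i) (.c 0)))

theorem run_resetTables {X : Inst} (hX : X.Good) {s : St} (hs : X.Tab s) :
    Run X.L resetTables s (X.n * 50 + 20) (fun s' => ∀ j, 1 ≤ j → j ≤ X.n →
      s'.a .sz j = 1 ∧ s'.a .lh j = 0) := by
  have hnL := hX.input.n_lt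
  have := Run.forUp (L := X.L) (n := X.n) (s := s)
    (body := .seq (.store .sz (.v .i) (.c 1)) (.store .lh (.v .i) (.c 0))) (fun _ => 30)
    (fun i s => ∀ j, 1 ≤ j → j < i → s.a .sz j = 1 ∧ s.a .lh j = 0) (by omega) hs.n
    (fun i s m h => by simpa using h) (by decide) (by decide) ?_ (by intro j; omega)
  · refine Run.mono this ?_ fun s' hs' j h1 h2 => hs' j h1 (by omega)
    simp
  · intro i s1 hi hi' _ h2 h3
    refine Run.straight (by simp) (by decide) fun j hj hj' => ?_
    by_cases hji : j = i
    · subst hji; simp [h2]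
    · simpa [h2, hji] using h3 j hj (by omega)

/-- Compute the numbers of active nodes below all nodes. -/
def sumSizes : Pg :=
  forDown (.ite (.and (.eq (.ld .rem (.v .i)) (.c 0)) (.eq (.ld .rem (.ld .par (.v .i))) (.c 0)))
    (.store .sz (.ld .par (.v .i)) (.add (.ld .sz (.ld .par (.v .i))) (.ld .sz (.v .i)))) .skip)

/-- Children are greater than their parents, so in a downward scan the size of i is complete when it
is added to the parent. In the invariant, `sz j` counts j and the branches of its active children
beyond the current index. -/
theorem run_sumSizes {X : Inst} (hX : X.Good) {s : St} (hs : X.Tab s) {ρ : ℕ → ℕ}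
    (hρ : s.a .rem = ρ) (h0 : ρ 0 ≠ 0) (hsz : ∀ j, 1 ≤ j → j ≤ X.n → s.a .sz j = 1) :
    Run X.L sumSizes s (X.n * 80 + 20) (fun s' => ∀ j, 1 ≤ j → j ≤ X.n → ρ j = 0 →
      s'.a .sz j = branchSize X.n X.par (fun x => ρ x ≠ 0) j) := by
  classical
  have hnL := hX.input.n_lt
  have hpar := hX.elim.par_lt
  set B := branchSize X.n X.par (fun x => ρ x ≠ 0) with hB
  set F : ℕ → ℕ → Finset ℕ := fun k j => (Finset.Icc 1 X.n).filter
    fun c => ρ c = 0 ∧ X.par c = j ∧ k < c with hF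
  have hBeq : ∀ j, 1 ≤ j → j ≤ X.n → ρ j = 0 → ∀ k ≤ j, B j = 1 + ∑ c ∈ F k j, B c := by
    intro j h1 h2 h3 k hk
    rw [hB, branchSize_eq (R := fun x => ρ x ≠ 0) h0 hpar h1 h2 (by simpa using h3)]
    congr 1
    refine Finset.sum_congr ?_ fun _ _ => rfl
    ext c
    simp only [hF, Finset.mem_filter, Finset.mem_Icc, not_not]
    refine and_congr_right fun hc => and_congr_right fun _ => ⟨fun h => ⟨h, ?_⟩, fun h => h.1⟩
    have := hpar c hc.1
    omega
  have := Run.forDown (L := X.L) (n := X.n) (s := s) (T := 60)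
    (body := .ite (.and (.eq (.ld .rem (.v .i)) (.c 0))
      (.eq (.ld .rem (.ld .par (.v .i))) (.c 0)))
      (.store .sz (.ld .par (.v .i)) (.add (.ld .sz (.ld .par (.v .i))) (.ld .sz (.v .i)))) .skip)
    (fun k s => s.a .rem = ρ ∧ s.a .par = X.par ∧ ∀ j, 1 ≤ j → j ≤ X.n → ρ j = 0 →
      s.a .sz j = 1 + ∑ c ∈ F k j, B c) hs.n
    (fun i s m h => by simpa using h) (by decide) ?_ ?_
  · refine Run.mono this le_rfl fun s' hs' j h1 h2 h3 => ?_
    rw [hs'.2.2 j h1 h2 h3, ← hBeq j h1 h2 h3 0 (by omega)]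
  · rintro i s1 hi hin hsi ⟨g1, g2, g3⟩
    have hpi := hpar i hi
    by_cases hact : ρ i = 0 ∧ ρ (X.par i) = 0
    · have hpi1 : 1 ≤ X.par i := Nat.one_le_iff_ne_zero.2 fun h => h0 (h ▸ hact.2)
      have hins : F (i - 1) (X.par i) = insert i (F i (X.par i)) := by
        ext c
        simp only [hF, Finset.mem_filter, Finset.mem_Icc, Finset.mem_insert]
        constructor
        · rintro ⟨h1, h2, h3, h4⟩
          by_cases hci : c = i
          · exact .inl hci
          · exact .inr ⟨h1, h2, h3, by omega⟩
        · rintro (rfl | ⟨h1, h2, h3, h4⟩)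
          · exact ⟨⟨hi, hin⟩, hact.1, rfl, by omega⟩
          · exact ⟨h1, h2, h3, by omega⟩
      have hsum : 1 + ∑ c ∈ F i (X.par i), B c + B i = 1 + ∑ c ∈ F (i - 1) (X.par i), B c := by
        rw [hins, Finset.sum_insert (by simp [hF])]
        ring
      -- Partial sums are bounded by a branch size, so the addition does not overflow.
      have hle : 1 + ∑ c ∈ F (i - 1) (X.par i), B c ≤ X.n := by
        refine le_trans ?_ (branchSize_le (n := X.n) (par := X.par) (R := fun x => ρ x ≠ 0)
          (i := X.par i))
        rw [← hB, hBeq (X.par i) hpi1 (by omega) hact.2 0 (by omega)]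
        refine Nat.add_le_add_left (Finset.sum_le_sum_of_subset fun c hc => ?_) _
        simp only [hF, Finset.mem_filter] at hc ⊢
        exact ⟨hc.1, hc.2.1, hc.2.2.1, by omega⟩
      have e1 := g3 i hi hin hact.1
      rw [← hBeq i hi hin hact.1 i le_rfl] at e1
      have e2 := g3 (X.par i) hpi1 (by omega) hact.2
      refine Run.straight ?_ (by decide) ?_
      · simp [g1, g2, hsi, hact.1, hact.2, e1, e2]
        omega
      · simp only [Pg.den, Ts.Holds, Ex.val, hsi, g1, g2, hact, and_self, if_true]
        refine ⟨by simp [g1], by simp [g2], fun j h1 h2 h3 => ?_⟩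
        by_cases hj : j = X.par i
        · subst hj
          simp [e1, e2, hsum]
        · have : F (i - 1) j = F i j := by
            ext c
            simp only [hF, Finset.mem_filter]
            refine and_congr_right fun _ => and_congr_right fun _ => and_congr_right fun hc => ?_
            constructor
            · intro h
              have : c ≠ i := fun h => hj (by rw [← hc, h])
              omega
            · omega
          simp [hj, g3 j h1 h2 h3, this]
    · refine Run.straight ?_ (by decide) ?_
      · simp only [Pg.Ok, Ts.Ok, Ex.Ok, Ts.Holds, Ex.val, hsi, g1, g2]
        refine ⟨by simp, fun h => (hact h).elim, fun _ => trivial⟩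
      · simp only [Pg.den, Ts.Holds, Ex.val, hsi, g1, g2]
        rw [if_neg hact]
        refine ⟨g1, g2, fun j h1 h2 h3 => ?_⟩
        have : F (i - 1) j = F i j := by
          ext c
          simp only [hF, Finset.mem_filter]
          refine and_congr_right fun _ => and_congr_right fun hc' => and_congr_right fun hc => ?_
          constructor
          · intro h
            have : c ≠ i := fun h => hact (by subst h; subst hc; exact ⟨hc', h3⟩)
            omega
          · omega
        rw [g3 j h1 h2 h3, this]
  · refine ⟨hρ, hs.par, fun j h1 h2 h3 => ?_⟩
    have : F X.n j = ∅ := by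
      ext c
      simp only [hF, Finset.mem_filter, Finset.mem_Icc, Finset.notMem_empty, iff_false]
      omega
    rw [hsz j h1 h2, this]
    rfl

/-- Compute the roots of the components and their centroids. -/
def findCentroids : Pg :=
  forUp (.ite (.eq (.ld .rem (.v .i)) (.c 0))
    (.seq
      (.ite (.eq (.ld .rem (.ld .par (.v .i))) (.c 0))
        (.store .rt (.v .i) (.ld .rt (.ld .par (.v .i))))
        (.store .rt (.v .i) (.v .i)))
      (.ite (.lt (.add (.ld .sz (.v .i)) (.ld .sz (.v .i))) (.ld .sz (.ld .rt (.v .i)))) .skip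
        (.store .cen (.ld .rt (.v .i)) (.v .i)))) .skip)

/-- `rt` contains the roots of the components, and `cen` contains for each root a centroid. -/
structure RootTable (n : ℕ) (par ρ rt cen : ℕ → ℕ) : Prop where
  up : ∀ j, 1 ≤ j → j ≤ n → ρ j = 0 → Up par (fun x => ρ x ≠ 0) j (rt j)
  root : ∀ j, 1 ≤ j → j ≤ n → ρ j = 0 → ρ (par (rt j)) ≠ 0
  cen : ∀ r, 1 ≤ r → r ≤ n → ρ r = 0 → ρ (par r) ≠ 0 →
    IsCentroid n par (fun x => ρ x ≠ 0) r (cen r)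

theorem root_unique {par ρ : ℕ → ℕ} {j r r' : ℕ} (h : Up par (fun x => ρ x ≠ 0) j r)
    (h' : Up par (fun x => ρ x ≠ 0) j r') (hr : ρ (par r) ≠ 0) (hr' : ρ (par r') ≠ 0) : r = r' := by
  rcases h.total h' with h | h
  · rcases h.eq_or_step with h | ⟨h, _⟩
    · exact h
    · exact (h hr).elim
  · rcases h.eq_or_step with h | ⟨h, _⟩
    · exact h.symm
    · exact (h hr').elim

/-- In an upward scan the root of the parent is known. Every node with at least half of its
component below it overwrites the entry of its root, so the greatest one survives; the root itself
qualifies, so the entry is always set. -/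
theorem run_findCentroids {X : Inst} (hX : X.Good) {s : St} (hs : X.Tab s) {ρ : ℕ → ℕ}
    (hρ : s.a .rem = ρ) (h0 : ρ 0 ≠ 0)
    (hsz : ∀ j, 1 ≤ j → j ≤ X.n → ρ j = 0 →
      s.a .sz j = branchSize X.n X.par (fun x => ρ x ≠ 0) j) :
    Run X.L findCentroids s (X.n * 120 + 20) (fun s' =>
      RootTable X.n X.par ρ (s'.a .rt) (s'.a .cen)) := by
  have hnL := hX.input.n_lt
  have hpar := hX.elim.par_lt
  set B := branchSize X.n X.par (fun x => ρ x ≠ 0) with hB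
  set R : ℕ → Prop := fun x => ρ x ≠ 0 with hR
  have := Run.forUp (L := X.L) (n := X.n) (s := s)
    (body := .ite (.eq (.ld .rem (.v .i)) (.c 0))
    (.seq
      (.ite (.eq (.ld .rem (.ld .par (.v .i))) (.c 0))
        (.store .rt (.v .i) (.ld .rt (.ld .par (.v .i))))
        (.store .rt (.v .i) (.v .i)))
      (.ite (.lt (.add (.ld .sz (.v .i)) (.ld .sz (.v .i))) (.ld .sz (.ld .rt (.v .i)))) .skip
        (.store .cen (.ld .rt (.v .i)) (.v .i)))) .skip) (fun _ => 100)
    (fun i s' => s'.a .rem = ρ ∧ s'.a .par = X.par ∧ s'.a .sz = s.a .sz ∧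
      (∀ j, 1 ≤ j → j < i → ρ j = 0 → Up X.par R j (s'.a .rt j) ∧ ρ (X.par (s'.a .rt j)) ≠ 0) ∧
      (∀ r, 1 ≤ r → r < i → ρ r = 0 → ρ (X.par r) ≠ 0 →
        1 ≤ s'.a .cen r ∧ s'.a .cen r < i ∧ ρ (s'.a .cen r) = 0 ∧ Up X.par R (s'.a .cen r) r ∧
        B r ≤ 2 * B (s'.a .cen r) ∧
        ∀ u, s'.a .cen r < u → u < i → ρ u = 0 → Up X.par R u r → 2 * B u < B r))
    (by omega) hs.n
    (fun i s m h => by simpa using h) (by decide) (by decide) ?_ ?_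
  · refine Run.mono this (by simp) fun s' hs' => ?_
    obtain ⟨-, -, -, g4, g5⟩ := hs'
    refine ⟨fun j h1 h2 h3 => (g4 j h1 (by omega) h3).1, fun j h1 h2 h3 => (g4 j h1 (by omega) h3).2,
      fun r h1 h2 h3 h4 => ?_⟩
    obtain ⟨k1, k2, k3, k4, k5, k6⟩ := g5 r h1 (by omega) h3 h4
    exact ⟨k1, by omega, by simpa [hR] using k3, k4, h4, k5,
      fun u h5 h6 h7 h8 => k6 u h5 (by omega) (by simpa [hR] using h7) h8⟩
  · rintro i s1 hi hin hn hsi ⟨g1, g2, g3, g4, g5⟩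
    refine Run.mono (Run.ite (T := 80) (by simp) (fun hb => ?_) fun hb => ?_) (by decide)
      fun _ h => h
    · have hact : ρ i = 0 := by simpa [hsi, g1] using hb
      obtain ⟨r, hr, hup, hrr, hri⟩ : ∃ r, (if ρ (X.par i) = 0 then s1.a .rt (X.par i) else i) = r ∧
          Up X.par R i r ∧ ρ (X.par r) ≠ 0 ∧ (r < i → ρ (X.par i) = 0) := by
        by_cases hp : ρ (X.par i) = 0
        · have hp1 : 1 ≤ X.par i := Nat.one_le_iff_ne_zero.2 fun h => h0 (h ▸ hp)
          have := g4 _ hp1 (hpar i hi) hp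
          exact ⟨_, rfl, by rw [if_pos hp]; exact (Up.step (by simpa [hR] using hp)).trans this.1,
            by rw [if_pos hp]; exact this.2, fun _ => hp⟩
        · exact ⟨_, rfl, by rw [if_neg hp]; exact .refl, by rw [if_neg hp]; exact hp,
            fun h => by rw [if_neg hp] at h; omega⟩
      have hb := hup.bounds (R := R) h0 hpar hi
      have hract : ρ r = 0 := by
        have := hup.not_of_not (by simpa [hR] using hact)
        simpa [hR] using this
      have hBle : B i ≤ X.n := branchSize_le
      refine Run.mono (T := 30 + 50) (Run.seq (Run.straight (Q := fun s' => s' = s1.setA .rt i r) ?_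
        (by decide) ?_) fun s2 hs2 _ => Run.straight ?_ (by decide) ?_) (by decide) fun _ h => h
      · simp
      · simp only [Pg.den, Ts.Holds, Ex.val, g1, g2, hsi, ← hr]
        split_ifs <;> rfl
      · subst hs2
        simp [g3, hsi, hsz i hi hin hact]
        omega
      · subst hs2
        have e1 := hsz i hi hin hact
        have e2 := hsz r hb.1 (by omega) hract
        have hrt : ∀ j, 1 ≤ j → j < i + 1 → ρ j = 0 →
            Up X.par R j (Function.update (s1.a .rt) i r j) ∧
              ρ (X.par (Function.update (s1.a .rt) i r j)) ≠ 0 := by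
          intro j h1 h2 h3
          by_cases hji : j = i
          · subst hji; simpa using ⟨hup, hrr⟩
          · simpa [hji] using g4 j h1 (by omega) h3
        by_cases hlt : 2 * B i < B r
        · have hlt' : s1.a .sz i + s1.a .sz i < s1.a .sz r := by rw [g3, e1, e2]; omega
          simp only [Pg.den, Ts.Holds, Ex.val, St.setA_r, hsi, St.setA_a, ne_eq, reduceCtorEq,
            not_false_eq_true, Function.update_of_ne, Function.update_self, hlt', if_true]
          refine ⟨by simp [g1], by simp [g2], by simp [g3], hrt, fun q h1 h2 h3 h4 => ?_⟩
          have hqi : q ≠ i := by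
            rintro rfl
            have := root_unique hup (.refl) hrr h4
            subst this
            omega
          obtain ⟨k1, k2, k3, k4, k5, k6⟩ := g5 q h1 (by omega) h3 h4
          refine ⟨k1, by simp; omega, k3, k4, k5, fun u h5 h6 h7 h8 => ?_⟩
          by_cases hui : u = i
          · subst hui
            rwa [← root_unique hup h8 hrr h4]
          · exact k6 u h5 (by omega) h7 h8
        · have hlt' : ¬ s1.a .sz i + s1.a .sz i < s1.a .sz r := by rw [g3, e1, e2]; omega
          simp only [Pg.den, Ts.Holds, Ex.val, St.setA_r, hsi, St.setA_a, ne_eq, reduceCtorEq,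
            not_false_eq_true, Function.update_of_ne, Function.update_self, hlt', if_false]
          refine ⟨by simp [g1], by simp [g2], by simp [g3], hrt, fun q h1 h2 h3 h4 => ?_⟩
          by_cases hqr : q = r
          · subst hqr
            simp only [Function.update_self]
            exact ⟨hi, by omega, hact, hup, by omega, fun u h5 h6 => by omega⟩
          · simp only [ne_eq, hqr, not_false_eq_true, Function.update_of_ne]
            have hqi : q ≠ i := by
              rintro rfl
              exact hqr (root_unique hup (.refl) hrr h4).symm
            obtain ⟨k1, k2, k3, k4, k5, k6⟩ := g5 q h1 (by omega) h3 h4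
            refine ⟨k1, by omega, k3, k4, k5, fun u h5 h6 h7 h8 => ?_⟩
            by_cases hui : u = i
            · subst hui
              exact (hqr (root_unique hup h8 hrr h4).symm).elim
            · exact k6 u h5 (by omega) h7 h8
    · have hact : ρ i ≠ 0 := by simpa [hsi, g1] using hb
      refine Run.straight trivial (by decide) ?_
      simp only [Pg.den]
      refine ⟨g1, g2, g3, fun j h1 h2 h3 => ?_, fun q h1 h2 h3 h4 => ?_⟩
      · have : j ≠ i := fun h => hact (h ▸ h3)
        exact g4 j h1 (by omega) h3
      · have : q ≠ i := fun h => hact (h ▸ h3)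
        obtain ⟨k1, k2, k3, k4, k5, k6⟩ := g5 q h1 (by omega) h3 h4
        refine ⟨k1, by omega, k3, k4, k5, fun u h5 h6 h7 h8 => ?_⟩
        have : u ≠ i := fun h => hact (h ▸ h7)
        exact k6 u h5 (by omega) h7 h8
  · exact ⟨hρ, hs.par, rfl, fun j h1 h2 => by omega, fun j h1 h2 => by omega⟩

/-- The active nodes with root `r`, in increasing order. -/
def members (n : ℕ) (ρ rt : ℕ → ℕ) (r : ℕ) : List ℕ :=
  (List.range' 1 n).filter fun i => ρ i = 0 ∧ rt i = r

/-- Build the lists of the nodes of the components. -/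
def buildLists : Pg :=
  forDown (.ite (.eq (.ld .rem (.v .i)) (.c 0))
    (.seq (.store .ln (.v .i) (.ld .lh (.ld .rt (.v .i)))) (.store .lh (.ld .rt (.v .i)) (.v .i)))
    .skip)

/-- Prepending in a downward scan gives increasing lists, the order in which distances and labels
can be propagated. -/
theorem run_buildLists {X : Inst} {s : St} (hs : X.Tab s) {ρ rt : ℕ → ℕ}
    (hρ : s.a .rem = ρ) (hrt : s.a .rt = rt) (hlh : ∀ j, 1 ≤ j → j ≤ X.n → s.a .lh j = 0) :
    Run X.L buildLists s (X.n * 80 + 20) (fun s' => ∀ r, 1 ≤ r → r ≤ X.n →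
      Lst (s'.a .ln) (s'.a .lh r) (members X.n ρ rt r)) := by
  have := Run.forDown (L := X.L) (n := X.n) (s := s) (T := 60)
    (body := .ite (.eq (.ld .rem (.v .i)) (.c 0))
    (.seq (.store .ln (.v .i) (.ld .lh (.ld .rt (.v .i)))) (.store .lh (.ld .rt (.v .i)) (.v .i)))
    .skip)
    (fun k s => s.a .rem = ρ ∧ s.a .rt = rt ∧ ∀ r, 1 ≤ r → r ≤ X.n → Lst (s.a .ln) (s.a .lh r)
      ((List.range' (k + 1) (X.n - k)).filter fun i => ρ i = 0 ∧ rt i = r)) hs.n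
    (fun i s m h => by simpa using h) (by decide) ?_ ?_
  · exact Run.mono this le_rfl fun s' hs' r h1 h2 => hs'.2.2 r h1 h2
  · rintro i s1 hi hin hsi ⟨g1, g2, g3⟩
    have hrange : List.range' (i - 1 + 1) (X.n - (i - 1)) = i :: List.range' (i + 1) (X.n - i) := by
      rw [show X.n - (i - 1) = (X.n - i) + 1 by omega, List.range'_succ, Nat.sub_add_cancel hi]
    refine Run.straight (by simp) (by decide) ?_
    by_cases hact : ρ i = 0
    · simp only [Pg.den, Ts.Holds, Ex.val, hsi, g1, hact, if_true]
      refine ⟨by simp [g1], by simp [g2], fun r h1 h2 => ?_⟩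
      have hcongr := (g3 r h1 h2).congr (nx' := Function.update (s1.a .ln) i (s1.a .lh (rt i)))
        fun j hj => by
          have := List.mem_range'.1 (List.mem_filter.1 hj).1
          rw [Function.update_of_ne (by omega)]
      rw [hrange, List.filter_cons]
      by_cases hr : rt i = r
      · subst hr
        simp only [hact, and_self, decide_true, if_true]
        refine ⟨?_, by omega, ?_⟩
        · simp [hsi, g2]
        · simpa [hsi, g2] using hcongr
      · simp only [hr, and_false, decide_false, Bool.false_eq_true, if_false]
        simpa [hsi, g2, Ne.symm hr] using hcongr
    · simp only [Pg.den, Ts.Holds, Ex.val, hsi, g1, hact, if_false]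
      refine ⟨trivial, g2, fun r h1 h2 => ?_⟩
      rw [hrange, List.filter_cons]
      simpa [hact] using g3 r h1 h2
  · refine ⟨hρ, hrt, fun r h1 h2 => ?_⟩
    simpa [Lst] using hlh r h1 h2

end RowMachine

namespace RowMachine

/-! ### Distances from a component to the bag of its centroid -/

theorem mem_members {n : ℕ} {ρ rt : ℕ → ℕ} {r x : ℕ} :
    x ∈ members n ρ rt r ↔ 1 ≤ x ∧ x ≤ n ∧ ρ x = 0 ∧ rt x = r := by
  simp only [members, List.mem_filter, List.mem_range', decide_eq_true_eq]
  constructor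
  · rintro ⟨⟨i, h1, rfl⟩, h2⟩
    exact ⟨by omega, by omega, h2⟩
  · rintro ⟨h1, h2, h3⟩
    exact ⟨⟨x - 1, by omega, by omega⟩, h3⟩

theorem members_pairwise (n : ℕ) (ρ rt : ℕ → ℕ) (r : ℕ) :
    (members n ρ rt r).Pairwise (· < ·) :=
  (List.pairwise_lt_range' (s := 1) (n := n)).filter _

theorem mem_of_lt_of_append {L D T : List ℕ} {x y : ℕ} (hL : L.Pairwise (· < ·))
    (h : L = D ++ x :: T) (hy : y ∈ L) (hyx : y < x) : y ∈ D := by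
  subst h
  rcases List.mem_append.1 hy with h | h
  · exact h
  · rcases List.mem_cons.1 h with rfl | h
    · omega
    · have := (List.pairwise_cons.1 (List.pairwise_append.1 hL).2.1).1 y h
      omega

/-- The total degree of the component with root `r`. -/
def Inst.work (X : Inst) (ρ rt : ℕ → ℕ) (r : ℕ) : ℕ :=
  ((members X.n ρ rt r).map fun x => X.deg x + 1).sum

/-- The total degree of the nodes of the component that are at most `u`. -/
def Inst.workLE (X : Inst) (ρ rt : ℕ → ℕ) (r u : ℕ) : ℕ :=
  (((members X.n ρ rt r).filter (· ≤ u)).map fun x => X.deg x + 1).sum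

theorem sum_filter_le (l : List ℕ) (p : ℕ → Bool) (f : ℕ → ℕ) :
    ((l.filter p).map f).sum ≤ (l.map f).sum :=
  (List.filter_sublist.map f).sum_le_sum fun _ _ => Nat.zero_le _

/-- A step of the climb from u to its smaller parent lowers the potential `workLE` by at least the
cost of u. -/
theorem sum_filter_add_le {l : List ℕ} {f : ℕ → ℕ} {u p : ℕ} (hu : u ∈ l) (hp : p < u) :
    ((l.filter (· ≤ p)).map f).sum + f u ≤ ((l.filter (· ≤ u)).map f).sum := by
  induction l with
  | nil => simp at hu
  | cons x l ih =>
    have hmono : ((l.filter (· ≤ p)).map f).sum ≤ ((l.filter (· ≤ u)).map f).sum := by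
      refine ((List.monotone_filter_right l (p := fun x => decide (x ≤ p))
        (q := fun x => decide (x ≤ u)) ?_).map f).sum_le_sum fun _ _ => Nat.zero_le _
      intro y hy
      simp only [decide_eq_true_eq] at hy ⊢
      omega
    simp only [List.filter_cons]
    by_cases hxu : x = u
    · subst hxu
      have : ¬ x ≤ p := by omega
      simp [this]; omega
    · have hul : u ∈ l := by
        rcases List.mem_cons.1 hu with h | h
        · exact (hxu h.symm).elim
        · exact h
      have := ih hul
      by_cases h1 : x ≤ p
      · have h2 : x ≤ u := by omega
        simp [h1, h2]; omega
      · by_cases h2 : x ≤ u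
        · simp [h1, h2]; omega
        · simp [h1, h2]; omega

variable {X : Inst} {ρ rt cen : ℕ → ℕ}

theorem RootTable.mem_iff (hT : RootTable X.n X.par ρ rt cen) {r x : ℕ} (hr : ρ (X.par r) ≠ 0) :
    x ∈ members X.n ρ rt r ↔
      1 ≤ x ∧ x ≤ X.n ∧ ρ x = 0 ∧ Up X.par (fun x => ρ x ≠ 0) x r := by
  rw [mem_members]
  constructor
  · rintro ⟨h1, h2, h3, rfl⟩
    exact ⟨h1, h2, h3, hT.up x h1 h2 h3⟩
  · rintro ⟨h1, h2, h3, h4⟩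
    exact ⟨h1, h2, h3, root_unique (hT.up x h1 h2 h3) h4 (hT.root x h1 h2 h3) hr⟩

theorem Inst.Good.distTo_le (hX : X.Good) {t y d : ℕ} (ht : 1 ≤ t) (htn : t ≤ X.n)
    (hy : 1 ≤ y) (hyn : y ≤ X.n) (h : X.H.DistTo (X.H.bag t) y d) : d ≤ X.n := by
  obtain ⟨⟨z, hz, rfl⟩, -⟩ := h
  obtain ⟨h1, h2, -⟩ := hX.elim.bag_mem ht htn hz
  exact hX.elim.dist_le hy hyn h1 h2

/-- Mark the bags of all nodes on the path from the centroid to the root. -/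
def markPath : Pg :=
  .seq (.seq (.set .r (.v .i)) (.seq (.set .t (.ld .cen (.v .i)))
    (.seq (.store .stp (.v .t) (.v .t)) (.seq (.store .ds (.v .t) (.c 0))
      (.seq (.set .u (.v .t)) (.set .m (.c 0)))))))
    (.seq (.loop (.not (.eq (.v .u) (.v .r)))
      (.seq markDn (.seq minDn (.set .u (.ld .par (.v .u))))))
      markDn)

/-- The marks and distances `ds` after the bags on the path from `t` to `r` have been marked. -/
structure PathMarks (X : Inst) (ρ : ℕ → ℕ) (r t : ℕ) (stp stp' ds : ℕ → ℕ) : Prop where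
  old : ∀ y, stp' y = stp y ∨ stp' y = t
  dist : ∀ y, stp' y = t → X.H.DistTo (X.H.bag t) y (ds y)
  path : ∀ y, Up X.par (fun x => ρ x ≠ 0) t y → stp' y = t
  top : ∀ y ∈ X.H.dn r, stp' y = t

/-- At each node u of the path from t to r the bag is completed with marks. One plus the minimum
over `dn u` is then the distance of every vertex that is new in the bag of `par u`, by
`distTo_of_up`; the last clause of `J` records this value in m. The final marking covers `dn r`,
which lies outside the component. By `hstp` the mark t is not in use, so nothing has to be cleared.
The factor 300 pays for one call each of `markDn` and `minDn` per node. -/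
theorem run_markPath (hX : X.Good) {s : St} (hs : X.Tab s) (h0 : ρ 0 ≠ 0)
    (hT : RootTable X.n X.par ρ rt cen) {r t : ℕ} (hc : IsCentroid X.n X.par (fun x => ρ x ≠ 0) r t)
    (hi : s.r .i = r) (ht : s.a .cen r = t) (hstp : ∀ x, s.a .stp x ≠ t) :
    Run X.L markPath s (420 * X.work ρ rt r + 40) (fun s' => s'.r .r = r ∧ s'.r .t = t ∧
      PathMarks X ρ r t (s.a .stp) (s'.a .stp) (s'.a .ds)) := by
  have hnL := hX.input.n_lt
  have hpar := hX.elim.par_lt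
  have hH := hX.elim
  set R : ℕ → Prop := fun x => ρ x ≠ 0 with hR
  have ht1 := hc.one_le
  have htn := hc.le
  have hr0 : ρ (X.par r) ≠ 0 := hc.root
  have hR0 : R 0 := h0
  have hmemU : ∀ u, Up X.par R t u → Up X.par R u r → u ∈ members X.n ρ rt r := by
    intro u h1 h2
    have hb := h1.bounds hR0 hpar ht1
    refine (hT.mem_iff hr0).2 ⟨hb.1, by omega, ?_, h2⟩
    have := h1.not_of_not hc.act
    simpa [hR] using this
  -- the invariant at the head of the loop
  let J : ℕ → St → Prop := fun u s' => X.Tab s' ∧ s'.r .u = u ∧ s'.r .r = r ∧ s'.r .t = t ∧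
    Up X.par R t u ∧ Up X.par R u r ∧
    (∀ y, s'.a .stp y = s.a .stp y ∨ s'.a .stp y = t) ∧
    (∀ y, s'.a .stp y = t → X.H.DistTo (X.H.bag t) y (s'.a .ds y)) ∧
    (∀ y, Up X.par R t y → u ≤ y → s'.a .stp y = t) ∧
    (∀ y ∈ X.H.dn u, s'.a .stp y ≠ t → X.H.DistTo (X.H.bag t) y (s'.r .m))
  have hmark : ∀ u s', J u s' → Run X.L markDn s' (120 * (X.deg u + 1)) (fun s'' =>
      X.Tab s'' ∧ s''.r .u = u ∧ s''.r .r = r ∧ s''.r .t = t ∧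
      (∀ y, s''.a .stp y = s.a .stp y ∨ s''.a .stp y = t) ∧
      (∀ y, s''.a .stp y = t → X.H.DistTo (X.H.bag t) y (s''.a .ds y)) ∧
      (∀ y, Up X.par R t y → u ≤ y → s''.a .stp y = t) ∧
      (∀ y ∈ X.H.dn u, s''.a .stp y = t)) := by
    rintro u s' ⟨g1, g2, g3, g4, g5, g6, g7, g8, g9, g10⟩
    have hub := g5.bounds hR0 hpar ht1
    refine Run.mono (Run.framed (run_markDn hX g1 g2 hub.1 (by omega))) le_rfl ?_
    rintro s'' ⟨⟨k1, k2, k3, k4⟩, hf⟩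
    rw [g4] at k1 k2 k3 k4
    refine ⟨g1.frame hf (by decide), by rw [hf.1 _ (by decide), g2],
      by rw [hf.1 _ (by decide), g3], by rw [hf.1 _ (by decide), g4],
      fun y => ?_, fun y hy => ?_, fun y h1 h2 => (k3 y (g9 y h1 h2)).1, k2⟩
    · rcases k1 y with h | h
      · rw [h]; exact g7 y
      · exact .inr h.1
    · by_cases h : s'.a .stp y = t
      · rw [(k3 y h).2]; exact g8 y h
      · rw [k4 y h hy]
        rcases k1 y with h' | h'
        · exact (h (h' ▸ hy)).elim
        · exact g10 y h'.2 h
  have hloop : ∀ s1, J t s1 → Run X.L (.loop (.not (.eq (.v .u) (.v .r)))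
      (.seq markDn (.seq minDn (.set .u (.ld .par (.v .u)))))) s1
      (300 * X.workLE ρ rt r t + 4 + 1)
      (fun s' => J r s') := by
    intro s1 hs1
    refine Run.mono (Run.loop (I := fun Φ s' => ∃ u, J u s' ∧ Φ = 300 * X.workLE ρ rt r u)
      (fun _ _ _ => by simp) ?_ ⟨t, hs1, rfl⟩) (by simp [Ts.cost, Ex.cost]) ?_
    · rintro Φ s' ⟨u, hJ, rfl⟩ hb
      obtain ⟨g1, g2, g3, g4, g5, g6, -⟩ := id hJ
      have hub := g5.bounds hR0 hpar ht1
      have hne : u ≠ r := by simpa [g2, g3] using hb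
      obtain ⟨h1, h2⟩ := g6.eq_or_step.resolve_left hne
      have hp1 : 1 ≤ X.par u := Nat.one_le_iff_ne_zero.2 fun h => h1 (h ▸ hR0)
      have hplt := hpar u hub.1
      have hw := sum_filter_add_le (f := fun x => X.deg x + 1) (hmemU u g5 g6) hplt
      refine ⟨120 * (X.deg u + 1) + (120 * (X.deg u + 1) + 5), 300 * X.workLE ρ rt r (X.par u),
        ?_, ?_, ?_⟩
      · simp only [Inst.workLE, Ts.cost, Ex.cost]; omega
      · simp only [Inst.workLE]; omega
      refine Run.seq (hmark u s' hJ) fun s2 ⟨k1, k2, k3, k4, k5, k6, k7, k8⟩ _ => ?_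
      refine Run.seq (run_minDn hX k1 k2 (by omega) (by omega) fun y hy => ?_)
        fun s3 ⟨μ, q1, q2, q3⟩ hf => Run.straight (by simp) (by decide) ?_
      · exact hX.distTo_le ht1 htn (hH.mem hy.1.symm).1 (hH.mem hy.1.symm).2 (k6 y (k8 y hy))
      · have f1 : s3.a .stp = s2.a .stp := hf.2 _ (by decide)
        have f2 : s3.a .ds = s2.a .ds := hf.2 _ (by decide)
        have f3 : s3.r .u = u := by rw [hf.1 _ (by decide), k2]
        have ht3 := k1.frame hf (by decide)
        refine ⟨_, le_rfl, X.par u, ⟨⟨?_, ?_, ?_, ?_, ?_⟩, ?_, ?_, ?_, ?_, ?_, ?_, ?_, ?_, ?_⟩, rfl⟩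
        · simp [ht3.n]
        · simp [ht3.inp]
        · simp [ht3.ord]
        · simp [ht3.pos]
        · simp [ht3.par]
        · simp [f3, ht3.par]
        · simp [hf.1 .r (by decide), k3]
        · simp [hf.1 .t (by decide), k4]
        · exact g5.trans (.step h1)
        · exact h2
        · simpa [f1] using k5
        · simpa [f1, f2] using k6
        · intro y hy1 hy2
          have : s2.a .stp y = t := by
            rcases hy1.total g5 with h | h
            · exact k7 y hy1 (h.bounds hR0 hpar (hy1.bounds hR0 hpar ht1).1).2
            · rcases h.eq_or_step with rfl | ⟨_, h⟩
              · exact k7 _ hy1 le_rfl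
              · have := (h.bounds hR0 hpar hp1).2
                have : y = X.par u := by omega
                subst this
                exact k8 _ ⟨hH.par_adj (by omega) (by omega), hplt⟩
          simpa [f1] using this
        · intro y hy hyt
          have hyt' : s2.a .stp y ≠ t := by simpa [f1] using hyt
          have hyu : y ∉ X.H.bag u := by
            rintro (rfl | hy')
            · exact hyt' (k7 _ g5 le_rfl)
            · exact hyt' (k8 _ hy')
          have := hH.distTo_of_up ht1 htn (g5.mono fun x hx => hx ▸ hR0) (.inr hy) hyu hp1
            (D := s2.a .ds) (m := μ) (fun z hz => k6 z (k8 z hz)) q2 q3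
          simpa [q1] using this
    · rintro s' ⟨hb, Φ, u, hJ, -⟩
      have : u = r := by
        have := hJ.2.1
        have := hJ.2.2.1
        simp only [Ts.Holds, Ex.val, not_not] at hb
        omega
      exact this ▸ hJ
  have hw1 : X.workLE ρ rt r t ≤ X.work ρ rt r := sum_filter_le _ _ _
  have hw2 : X.deg r + 1 ≤ X.work ρ rt r := by
    refine List.single_le_sum (fun _ _ => Nat.zero_le _) _ (List.mem_map.2 ⟨r, ?_, rfl⟩)
    exact hmemU r hc.up .refl
  refine Run.mono (T := 30 + (300 * X.workLE ρ rt r t + 4 + 1 + 120 * (X.deg r + 1)))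
    (Run.seq (Run.straight (Q := J t) (by simp) (by decide) ?_) fun s1 hs1 _ =>
      Run.seq (hloop s1 hs1) fun s2 hs2 _ => hmark r s2 hs2) (by omega) ?_
  · refine ⟨⟨?_, ?_, ?_, ?_, ?_⟩, ?_, ?_, ?_, .refl, hc.up, ?_, ?_, ?_, ?_⟩
    · simp [hs.n]
    · simp [hs.inp]
    · simp [hs.ord]
    · simp [hs.pos]
    · simp [hs.par]
    · simp [hi, ht]
    · simp [hi]
    · simp [hi, ht]
    · intro y
      by_cases hy : y = t
      · simp [hi, ht, hy]
      · simp [hi, ht, hy]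
    · intro y hy
      have : y = t := by
        by_contra hne
        simp [hi, ht, hne] at hy
        exact hstp y hy
      subst this
      simpa [hi, ht] using SimpleGraph.DistTo.of_mem (.inl rfl)
    · intro y h1 h2
      have : y = t := le_antisymm (h1.bounds hR0 hpar ht1).2 h2
      simp [hi, ht, this]
    · intro y hy _
      simpa using SimpleGraph.DistTo.of_mem (.inr hy)
  · rintro s' ⟨k1, k2, k3, k4, k5, k6, k7, k8⟩
    refine ⟨k3, k4, k5, k6, fun y hy => k7 y hy ?_, k8⟩
    rcases hy.total hc.up with h | h
    · exact (h.bounds hR0 hpar (hy.bounds hR0 hpar ht1).1).2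
    · rcases h.eq_or_step with h | ⟨h, _⟩
      · exact h.le
      · exact (h hr0).elim

end RowMachine

namespace RowMachine

/-! ### The contribution of one component -/

/-- Compute `ds` and the label of the node `u`, and update the maximum `b` of `ds` and the label
`c` of the node where it is attained. -/
def labelNode : Pg :=
  .seq (.ite (.eq (.ld .stp (.v .u)) (.v .t)) .skip
      (.seq minDn (.seq (.store .stp (.v .u) (.v .t)) (.store .ds (.v .u) (.v .m)))))
    (.seq (.ite (.eq (.v .u) (.v .t)) (.store .sd (.v .u) (.v .u))
        (.ite (.eq (.ld .par (.v .u)) (.v .t)) (.store .sd (.v .u) (.v .u))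
          (.ite (.eq (.v .u) (.v .r)) (.store .sd (.v .u) (.c 0))
            (.store .sd (.v .u) (.ld .sd (.ld .par (.v .u)))))))
      (.ite (.lt (.v .b) (.ld .ds (.v .u)))
        (.seq (.set .b (.ld .ds (.v .u))) (.set .c (.ld .sd (.v .u)))) .skip))

/-- Compute `ds` and the labels for all nodes of the component. -/
def labelNodes : Pg :=
  .seq (.seq (.set .u (.ld .lh (.v .r))) (.seq (.set .b (.c 0)) (.set .c (.v .t))))
    (forList labelNode)

variable {X : Inst} {ρ rt cen : ℕ → ℕ}

/-- The distances `ds` to the bag of `t`, the labels `sd`, and the maximum `b` of `ds` with the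
label `c` of the node where it is attained. -/
structure Labelled (X : Inst) (ρ : ℕ → ℕ) (r t : ℕ) (l : List ℕ) (ds sd : ℕ → ℕ) (b c : ℕ) :
    Prop where
  dist : ∀ x ∈ l, X.H.DistTo (X.H.bag t) x (ds x)
  side : IsSide X.n X.par (fun x => ρ x ≠ 0) r t sd
  le : ∀ x ∈ l, ds x ≤ b
  max : (b = 0 ∧ c = t) ∨ ∃ x ∈ l, ds x = b ∧ sd x = c

/-- An unmarked node is not above t, so `distTo_of_not_up` gives its distance once all its smaller
neighbours are known. Increasing order guarantees this, and also that the label of the parent is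
available. -/
theorem run_labelNodes (hX : X.Good) {s : St} (hs : X.Tab s) (h0 : ρ 0 ≠ 0)
    (hT : RootTable X.n X.par ρ rt cen) {r t : ℕ} (hc : IsCentroid X.n X.par (fun x => ρ x ≠ 0) r t)
    (hr : s.r .r = r) (ht : s.r .t = t) {stp : ℕ → ℕ}
    (hm : PathMarks X ρ r t stp (s.a .stp) (s.a .ds))
    (hl : Lst (s.a .ln) (s.a .lh r) (members X.n ρ rt r)) :
    Run X.L labelNodes s (300 * X.work ρ rt r + 40) (fun s' =>
      (∀ y, s'.a .stp y = stp y ∨ s'.a .stp y = t) ∧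
      Labelled X ρ r t (members X.n ρ rt r) (s'.a .ds) (s'.a .sd) (s'.r .b) (s'.r .c)) := by
  have hnL := hX.input.n_lt
  have hpar := hX.elim.par_lt
  have hH := hX.elim
  set R : ℕ → Prop := fun x => ρ x ≠ 0 with hR
  have ht1 := hc.one_le
  have htn := hc.le
  have hr0 : ρ (X.par r) ≠ 0 := hc.root
  have hR0 : R 0 := h0
  set M := members X.n ρ rt r with hM
  have hpw : M.Pairwise (· < ·) := members_pairwise _ _ _ _
  have hmem : ∀ {x}, x ∈ M ↔ 1 ≤ x ∧ x ≤ X.n ∧ ρ x = 0 ∧ Up X.par R x r := hT.mem_iff hr0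
  let J : List ℕ → St → Prop := fun d s' => X.Tab s' ∧ s'.r .r = r ∧ s'.r .t = t ∧
    (∀ y, s'.a .stp y = s.a .stp y ∨ s'.a .stp y = t) ∧
    (∀ y, s.a .stp y = t → s'.a .stp y = t) ∧
    (∀ y, s'.a .stp y = t → X.H.DistTo (X.H.bag t) y (s'.a .ds y)) ∧
    (∀ x ∈ d, s'.a .stp x = t) ∧
    (∀ x ∈ d, (x = t ∨ X.par x = t → s'.a .sd x = x) ∧ (x ≠ t → X.par x ≠ t →
      (x = r → s'.a .sd x = 0) ∧ (x ≠ r → s'.a .sd x = s'.a .sd (X.par x)))) ∧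
    (∀ x ∈ d, s'.a .ds x ≤ s'.r .b) ∧
    ((s'.r .b = 0 ∧ s'.r .c = t) ∨ ∃ x ∈ d, s'.a .ds x = s'.r .b ∧ s'.a .sd x = s'.r .c)
  have hbody : ∀ d x tl s', M = d ++ x :: tl → J d s' → s'.r .u = x →
      Run X.L labelNode s' (220 * (X.deg x + 1)) (J (d ++ [x])) := by
    rintro d x tl s' hM' ⟨g1, g2, g3, g4, g5, g6, g7, g8, g9, g10⟩ hu
    obtain ⟨hx1, hxn, hρx, hxr⟩ := hmem.1 (hM' ▸ (by simp : x ∈ d ++ x :: tl))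
    have hdx : ∀ y ∈ d, y ≠ x ∧ X.par y ≠ x := by
      intro y hy
      have h1 : y < x := by
        rw [hM'] at hpw
        exact (List.pairwise_append.1 hpw).2.2 y hy x (by simp)
      have h2 := hpar y (hmem.1 (hM' ▸ List.mem_append_left _ hy)).1
      omega
    have hrb := hxr.bounds hR0 hpar hx1
    -- the distance of `x`
    have step1 : Run X.L (.ite (.eq (.ld .stp (.v .u)) (.v .t)) .skip
        (.seq minDn (.seq (.store .stp (.v .u) (.v .t)) (.store .ds (.v .u) (.v .m))))) s'
        (120 * (X.deg x + 1) + 20) (fun s2 => (∀ y, s2.a .stp y = s.a .stp y ∨ s2.a .stp y = t) ∧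
          (∀ y, s.a .stp y = t → s2.a .stp y = t) ∧
          (∀ y, s2.a .stp y = t → X.H.DistTo (X.H.bag t) y (s2.a .ds y)) ∧
          (∀ y ∈ d ++ [x], s2.a .stp y = t) ∧ ∀ y ∈ d, s2.a .ds y = s'.a .ds y) := by
      refine Run.mono (Run.ite (T := 120 * (X.deg x + 1) + 10) (by simp) (fun hb => ?_)
        fun hb => ?_) (by simp [Ts.cost, Ex.cost]; omega) fun _ h => h
      · simp only [Ts.Holds, Ex.val, hu, g3] at hb
        refine Run.straight trivial (by simp only [Pg.tm]; omega) ⟨g4, g5, g6, fun y hy => ?_,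
          fun _ _ => rfl⟩
        rcases List.mem_append.1 hy with h | h
        · exact g7 y h
        · rw [List.mem_singleton.1 h]; exact hb
      · simp only [Ts.Holds, Ex.val, hu, g3] at hb
        have hnt : ¬ Up X.par R t x := fun h => hb (g5 x (hm.path x h))
        have hx2 : 2 ≤ x := by
          by_contra hlt
          have hrx : r = x := by omega
          exact hnt (hrx ▸ hc.up)
        have hdn : ∀ y ∈ X.H.dn x, s'.a .stp y = t := by
          intro y hy
          have hup := hH.up_of_adj hy.1 hy.2
          have hyb := hup.bounds hpar hx1
          -- A smaller neighbour of x is an ancestor of x. From r on downwards it belongs to the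
          -- component and has been processed; above r it is in `dn r` and was marked by `markPath`.
          by_cases hry : r ≤ y
          · have hxy : Up X.par R x y := Up.between (R := fun x => x = 0) rfl hpar hxr hup hx1 hry
            have hy0 : ρ y = 0 := by
              have := hxy.not_of_not (by simpa [hR] using hρx)
              simpa [hR] using this
            refine g7 y (mem_of_lt_of_append hpw hM' (hmem.2 ⟨hyb.1, by omega, hy0, ?_⟩) hy.2)
            rcases hxy.total hxr with h | h
            · exact h
            · rcases h.eq_or_step with h | ⟨h, _⟩
              · exact h ▸ .refl
              · exact (h hr0).elim
          · refine g5 y (hm.top y (hH.boundary (hxr.mono fun x hx => hx ▸ hR0) hx1 hy.1 fun h => ?_))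
            have := (Anc.bounds hpar h hyb.1).2
            omega
        refine Run.mono (T := 120 * (X.deg x + 1) + 10)
          (Run.seq (run_minDn hX g1 hu hx2 hxn fun y hy => ?_)
          fun s2 ⟨μ, q1, q2, q3⟩ hf => Run.straight (by simp) (by decide) ?_) le_rfl fun _ h => h
        · exact hX.distTo_le ht1 htn (hH.mem hy.1.symm).1 (hH.mem hy.1.symm).2 (g6 y (hdn y hy))
        · have f1 : s2.a .stp = s'.a .stp := hf.2 _ (by decide)
          have f2 : s2.a .ds = s'.a .ds := hf.2 _ (by decide)
          have f3 : s2.r .u = x := by rw [hf.1 _ (by decide), hu]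
          have f4 : s2.r .t = t := by rw [hf.1 _ (by decide), g3]
          have hdist := hH.distTo_of_not_up ht1 htn hx1 hxn (m := μ) (fun h => hnt
            (Up.between (R := fun x => x = 0) rfl hpar hc.up h ht1 hrb.2))
            (fun y hy => g6 y (hdn y hy)) q2 q3
          simp only [Pg.den, Ex.val, St.setA_a, St.setA_r, f3, f4, q1]
          refine ⟨fun y => ?_, fun y hy => ?_, fun y hy => ?_, fun y hy => ?_, fun y hy => ?_⟩
          · by_cases hyx : y = x
            · simp [hyx]
            · simpa [hyx, f1] using g4 y
          · by_cases hyx : y = x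
            · simp [hyx]
            · simpa [hyx, f1] using g5 y hy
          · by_cases hyx : y = x
            · subst hyx; simpa using hdist
            · simpa [hyx, f1, f2] using g6 y (by simpa [hyx, f1] using hy)
          · by_cases hyx : y = x
            · simp [hyx]
            · simpa [hyx, f1] using g7 y (by simpa [hyx] using hy)
          · simp [(hdx y hy).1, f2]
    refine Run.mono (T := 120 * (X.deg x + 1) + 20 + (50 + 26)) (Run.seq step1
      fun s2 ⟨k1, k2, k3, k4, k5⟩ hf => Run.seq (Q := fun s3 => s3 = s2.setA .sd x
        (if x = t ∨ X.par x = t then x else if x = r then 0 else s2.a .sd (X.par x)))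
        (Run.straight (by simp) (by decide) ?_) fun s3 hs3 _ => Run.straight (by simp)
          (by decide) ?_) (by omega) fun _ h => h
    · have e1 : s2.r .u = x := by rw [hf.1 _ (by decide), hu]
      have e2 : s2.r .t = t := by rw [hf.1 _ (by decide), g3]
      have e3 : s2.r .r = r := by rw [hf.1 _ (by decide), g2]
      have e4 : s2.a .par = X.par := by rw [hf.2 _ (by decide), g1.par]
      simp only [Pg.den, Ts.Holds, Ex.val, e1, e2, e3, e4]
      by_cases h1 : x = t
      · simp [h1]
      · by_cases h2 : X.par x = t
        · simp [h1, h2]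
        · by_cases h3 : x = r
          · rw [if_neg h1, if_neg h2, if_pos h3, if_neg (not_or.2 ⟨h1, h2⟩), if_pos h3]
          · rw [if_neg h1, if_neg h2, if_neg h3, if_neg (not_or.2 ⟨h1, h2⟩), if_neg h3]
    · have e0 := g1.frame hf (by decide)
      have e1 : s2.r .u = x := by rw [hf.1 _ (by decide), hu]
      have e2 : s2.r .t = t := by rw [hf.1 _ (by decide), g3]
      have e3 : s2.r .r = r := by rw [hf.1 _ (by decide), g2]
      have e5 : s2.r .b = s'.r .b := hf.1 _ (by decide)
      have e6 : s2.r .c = s'.r .c := hf.1 _ (by decide)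
      have e7 : s2.a .sd = s'.a .sd := hf.2 _ (by decide)
      subst hs3
      have hsd : ∀ y ∈ d ++ [x], ∀ σ, σ = Function.update (s2.a .sd) x (if x = t ∨ X.par x = t then x
          else if x = r then 0 else s2.a .sd (X.par x)) →
          (y = t ∨ X.par y = t → σ y = y) ∧ (y ≠ t → X.par y ≠ t →
          (y = r → σ y = 0) ∧ (y ≠ r → σ y = σ (X.par y))) := by
        rintro y hy σ rfl
        rcases List.mem_append.1 hy with h | h
        · simpa [(hdx y h).1, (hdx y h).2, e7] using g8 y h
        · rw [List.mem_singleton.1 h]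
          have hne := (hpar x hx1).ne
          refine ⟨fun h => by simp [h], fun h1 h2 => ⟨fun h => ?_, fun h => ?_⟩⟩
          · simp only [Function.update_self]
            rw [if_neg (not_or.2 ⟨h1, h2⟩), if_pos h]
          · simp only [Function.update_self, ne_eq, hne, not_false_eq_true, Function.update_of_ne]
            rw [if_neg (not_or.2 ⟨h1, h2⟩), if_neg h]
      by_cases hlt : s'.r .b < s2.a .ds x
      · simp only [Pg.den, Ts.Holds, Ex.val, St.setA_a, St.setA_r, e1, e5, ne_eq, reduceCtorEq,
          not_false_eq_true, Function.update_of_ne, hlt, if_true]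
        refine ⟨⟨?_, ?_, ?_, ?_, ?_⟩, ?_, ?_, ?_, ?_, ?_, ?_, ?_, ?_, ?_⟩
        · simp [e0.n]
        · simp [e0.inp]
        · simp [e0.ord]
        · simp [e0.pos]
        · simp [e0.par]
        · simp [e3]
        · simp [e2]
        · simpa using k1
        · simpa using k2
        · simpa using k3
        · simpa using k4
        · intro y hy
          exact hsd y hy _ (by simp)
        · intro y hy
          rcases List.mem_append.1 hy with h | h
          · have := g9 y h
            simp [k5 y h]; omega
          · simp [List.mem_singleton.1 h]
        · exact .inr ⟨x, by simp, by simp, by simp [e1]⟩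
      · simp only [Pg.den, Ts.Holds, Ex.val, St.setA_a, St.setA_r, e1, e5, ne_eq, reduceCtorEq,
          not_false_eq_true, Function.update_of_ne, hlt, if_false]
        refine ⟨⟨?_, ?_, ?_, ?_, ?_⟩, ?_, ?_, ?_, ?_, ?_, ?_, ?_, ?_, ?_⟩
        · simp [e0.n]
        · simp [e0.inp]
        · simp [e0.ord]
        · simp [e0.pos]
        · simp [e0.par]
        · simp [e3]
        · simp [e2]
        · simpa using k1
        · simpa using k2
        · simpa using k3
        · simpa using k4
        · intro y hy
          exact hsd y hy _ (by simp)
        · intro y hy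
          rcases List.mem_append.1 hy with h | h
          · simpa [e5, k5 y h] using g9 y h
          · simp [List.mem_singleton.1 h, e5]; omega
        · rcases g10 with ⟨h1, h2⟩ | ⟨y, hy, h1, h2⟩
          · left; simp [e5, e6, h1, h2]
          · refine .inr ⟨y, by simp [hy], ?_, ?_⟩
            · simp [e5, k5 y hy, h1]
            · simp [e6, e7, (hdx y hy).1, h2]
  have hst : ∀ d s' m, J d s' → J d (s'.setR .u m) := by
    rintro d s' m ⟨g1, g⟩
    exact ⟨⟨by simp [g1.n], g1.inp, g1.ord, g1.pos, g1.par⟩, by simpa using g⟩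
  refine Run.mono (T := 15 + ((M.map fun x => 220 * (X.deg x + 1) + 20).sum + 20))
    (Run.seq (Run.straight (Q := fun s' => s' = ((s.setR .u (s.a .lh r)).setR .b 0).setR .c t)
      (by simp) (by decide) ?_) fun s1 hs1 _ => Run.forList (nx := s.a .ln) M J hst (by decide)
        (by decide) hbody ?_ ?_ ?_) ?_ ?_
  · simp [hr, ht]
  · subst hs1; simpa using hl
  · subst hs1; simp
  · subst hs1
    refine ⟨⟨?_, ?_, ?_, ?_, ?_⟩, ?_, ?_, ?_, ?_, ?_, ?_, ?_, ?_, ?_⟩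
    · simp [hs.n]
    · simp [hs.inp]
    · simp [hs.ord]
    · simp [hs.pos]
    · simp [hs.par]
    · simp [hr]
    · simp [ht]
    · simp
    · simp
    · simpa using hm.dist
    · simp
    · simp
    · simp
    · left; simp
  · have : (M.map fun x => 220 * (X.deg x + 1) + 20).sum ≤
        (M.map fun x => 300 * (X.deg x + 1)).sum := List.sum_le_sum fun x _ => by omega
    rw [List.sum_map_mul_left] at this
    simp only [Inst.work, ← hM]
    omega
  · rintro s' ⟨g1, g2, g3, g4, g5, g6, g7, g8, g9, g10⟩
    refine ⟨fun y => ?_, fun x hx => g6 x (g7 x hx), ⟨?_, ?_, ?_, ?_⟩, g9, g10⟩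
    · rcases g4 y with h | h
      · rw [h]; exact hm.old y
      · exact .inr h
    · exact (g8 t (hmem.2 ⟨ht1, htn, by simpa [hR] using hc.act, hc.up⟩)).1 (.inl rfl)
    · intro u h1 h2 h3 h4 h5 h6
      exact (g8 u (hmem.2 ⟨h1, h2, by simpa using h3, h4⟩)).1 (.inr h6)
    · intro h1 h2
      have hb := hc.up.bounds hR0 hpar ht1
      refine ((g8 r (hmem.2 ⟨hb.1, by omega, ?_, .refl⟩)).2 h1 h2).1 rfl
      have := hc.up.not_of_not hc.act
      simpa [hR] using this
    · intro u h1 h2 h3 h4 h5 h6 h7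
      exact ((g8 u (hmem.2 ⟨h1, h2, by simpa using h3, h4⟩)).2 h5 h7).2 h6

end RowMachine

/-! ### Maximum over the other sides, and the estimates of one component -/

namespace RowMachine

/-- The maximum `g` of `ds` over the nodes with a label different from `c`. -/
def secondMax : Pg :=
  .seq (.seq (.set .u (.ld .lh (.v .r))) (.set .g (.c 0)))
    (forList (.ite (.and (.not (.eq (.ld .sd (.v .u)) (.v .c))) (.lt (.v .g) (.ld .ds (.v .u))))
      (.set .g (.ld .ds (.v .u))) .skip))

theorem sum_map_const_add_le (X : Inst) (l : List ℕ) (c : ℕ) :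
    (l.map fun _ => c + 20).sum ≤ (c + 20) * (l.map fun x => X.deg x + 1).sum := by
  rw [← List.sum_map_mul_left]
  exact List.sum_le_sum fun x _ => Nat.le_mul_of_pos_right _ (by omega)

/-- For a node with a label different from c the maximum over the other labels is b itself; the
value g serves the nodes with label c. -/
theorem run_secondMax (X : Inst) {s : St} {r : ℕ} {l : List ℕ} (hr : s.r .r = r)
    (hl : Lst (s.a .ln) (s.a .lh r) l) :
    Run X.L secondMax s (60 * (l.map fun x => X.deg x + 1).sum + 40) (fun s' =>
      (∀ x ∈ l, s.a .sd x ≠ s.r .c → s.a .ds x ≤ s'.r .g) ∧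
      (s'.r .g = 0 ∨ ∃ x ∈ l, s.a .sd x ≠ s.r .c ∧ s.a .ds x = s'.r .g)) := by
  have h := sum_map_const_add_le X l 40
  refine Run.mono (T := 15 + ((l.map fun _ => 40 + 20).sum + 20))
    (Run.seq (Run.straight (Q := fun s' => s' = (s.setR .u (s.a .lh r)).setR .g 0)
      (by simp) (by decide) ?_) fun s1 hs1 _ => Run.forList (L := X.L) (nx := s.a .ln) (s := s1) l
        (fun d s' => s'.a .sd = s.a .sd ∧ s'.a .ds = s.a .ds ∧ s'.r .c = s.r .c ∧
          (∀ x ∈ d, s.a .sd x ≠ s.r .c → s.a .ds x ≤ s'.r .g) ∧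
          (s'.r .g = 0 ∨ ∃ x ∈ d, s.a .sd x ≠ s.r .c ∧ s.a .ds x = s'.r .g))
        (fun d s m h => by simpa using h) (by decide) (by decide) ?_ ?_ ?_ ?_) (by omega) ?_
  · simp [hr]
  · rintro d x tl s' - ⟨g1, g2, g3, g4, g5⟩ hu
    refine Run.straight (by simp) (by decide) ?_
    by_cases hb : s.a .sd x ≠ s.r .c ∧ s'.r .g < s.a .ds x
    · simp only [Pg.den, Ts.Holds, Ex.val, hu, g1, g2, g3]
      rw [if_pos hb]
      refine ⟨by simp [g1], by simp [g2], by simp [g3], fun y hy hyc => ?_,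
        .inr ⟨x, by simp, hb.1, by simp⟩⟩
      rcases List.mem_append.1 hy with h | h
      · have := g4 y h hyc
        simp; omega
      · simp [List.mem_singleton.1 h]
    · simp only [Pg.den, Ts.Holds, Ex.val, hu, g1, g2, g3]
      rw [if_neg hb]
      refine ⟨g1, g2, g3, fun y hy hyc => ?_, ?_⟩
      · rcases List.mem_append.1 hy with h | h
        · exact g4 y h hyc
        · rw [List.mem_singleton.1 h] at hyc ⊢
          exact not_lt.1 fun h' => hb ⟨hyc, h'⟩
      · rcases g5 with h | ⟨y, h1, h2⟩
        · exact .inl h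
        · exact .inr ⟨y, by simp [h1], h2⟩
  · subst hs1; simpa using hl
  · subst hs1; simp
  · subst hs1
    refine ⟨by simp, by simp, by simp, by simp, .inl (by simp)⟩
  · rintro s' ⟨-, -, -, g4, g5⟩
    exact ⟨g4, g5⟩

/-- Update the estimates of the eccentricities. -/
def updateEst : Pg :=
  .seq (.set .u (.ld .lh (.v .r)))
    (forList (.seq (.ite (.eq (.ld .sd (.v .u)) (.v .c))
        (.set .z (.add (.ld .ds (.v .u)) (.v .g))) (.set .z (.add (.ld .ds (.v .u)) (.v .b))))
      (.ite (.lt (.ld .est (.v .u)) (.v .z)) (.store .est (.v .u) (.v .z)) .skip)))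

theorem run_updateEst (X : Inst) {s : St} {r : ℕ} {l : List ℕ} (hr : s.r .r = r)
    (hl : Lst (s.a .ln) (s.a .lh r) l) (hd : ∀ x ∈ l, s.a .ds x + s.r .b < X.L)
    (hd' : ∀ x ∈ l, s.a .ds x + s.r .g < X.L) :
    Run X.L updateEst s (100 * (l.map fun x => X.deg x + 1).sum + 40) (fun s' =>
      (∀ x ∈ l, s'.a .est x = max (s.a .est x)
        (if s.a .sd x = s.r .c then s.a .ds x + s.r .g else s.a .ds x + s.r .b)) ∧
      ∀ x, x ∉ l → s'.a .est x = s.a .est x) := by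
  have h := sum_map_const_add_le X l 80
  set F : ℕ → ℕ := fun x => if s.a .sd x = s.r .c then s.a .ds x + s.r .g else s.a .ds x + s.r .b
    with hF
  refine Run.mono (T := 15 + ((l.map fun _ => 80 + 20).sum + 20))
    (Run.seq (Run.straight (Q := fun s' => s' = s.setR .u (s.a .lh r))
      (by simp) (by decide) ?_) fun s1 hs1 _ => Run.forList (L := X.L) (nx := s.a .ln) (s := s1) l
        (fun d s' => s'.a .sd = s.a .sd ∧ s'.a .ds = s.a .ds ∧ (s'.r .c = s.r .c ∧
          s'.r .b = s.r .b ∧ s'.r .g = s.r .g) ∧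
          (∀ x ∈ d, s'.a .est x = max (s.a .est x) (F x)) ∧ ∀ x, x ∉ d → s'.a .est x = s.a .est x)
        (fun d s m h => by simpa using h) (by decide) (by decide) ?_ ?_ ?_ ?_) (by omega) ?_
  · simp [hr]
  · rintro d x tl s' hdx ⟨g1, g2, ⟨g3, g3', g3''⟩, g4, g5⟩ hu
    have hxl : x ∈ l := hdx ▸ (by simp)
    have hest : max (s'.a .est x) (F x) = max (s.a .est x) (F x) := by
      by_cases hx : x ∈ d
      · rw [g4 x hx]; simp
      · rw [g5 x hx]
    have := hd x hxl
    have := hd' x hxl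
    refine Run.mono (T := 40 + 40) (Run.seq (Run.straight (Q := fun s2 => s2 = s'.setR .z (F x)) ?_
      (by decide) ?_) fun s2 hs2 _ => Run.straight (by simp) (by decide) ?_) (by decide)
      fun _ h => h
    · simp only [Pg.Ok, Ts.Ok, Ex.Ok, Ts.Holds, Ex.val, hu, g1, g2, g3, g3', g3'']
      refine ⟨by simp, fun _ => by simpa, fun _ => by simpa⟩
    · simp only [Pg.den, Ts.Holds, Ex.val, hu, g1, g2, g3, g3', g3'', hF]
      split_ifs <;> rfl
    · subst hs2
      have hnew : (Pg.ite (.lt (.ld .est (.v .u)) (.v .z)) (.store .est (.v .u) (.v .z)) .skip).den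
          (s'.setR .z (F x)) =
          (s'.setR .z (F x)).setA .est x (max (s'.a .est x) (F x)) ∨
          (Pg.ite (.lt (.ld .est (.v .u)) (.v .z)) (.store .est (.v .u) (.v .z)) .skip).den
          (s'.setR .z (F x)) = s'.setR .z (F x) ∧ s'.a .est x = max (s'.a .est x) (F x) := by
        by_cases hlt : s'.a .est x < F x
        · left
          simp [hu, hlt, max_eq_right hlt.le]
        · right
          simp [hu, hlt, not_lt.1 hlt]
      rcases hnew with h | ⟨h, h'⟩
      · rw [h]
        refine ⟨by simp [g1], by simp [g2], ⟨by simp [g3], by simp [g3'], by simp [g3'']⟩,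
          fun y hy => ?_, fun y hy => ?_⟩
        · by_cases hyx : y = x
          · subst hyx; simpa using hest
          · simpa [hyx] using g4 y (by simpa [hyx] using hy)
        · have hyx : y ≠ x := fun h => hy (by simp [h])
          simpa [hyx] using g5 y fun h => hy (by simp [h])
      · rw [h]
        refine ⟨by simp [g1], by simp [g2], ⟨by simp [g3], by simp [g3'], by simp [g3'']⟩,
          fun y hy => ?_, fun y hy => ?_⟩
        · by_cases hyx : y = x
          · subst hyx; simpa [← hest] using h'
          · simpa [hyx] using g4 y (by simpa [hyx] using hy)
        · simpa using g5 y fun h => hy (by simp [h])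
  · subst hs1; simpa using hl
  · subst hs1; simp
  · subst hs1
    exact ⟨by simp, by simp, ⟨by simp, by simp, by simp⟩, by simp, by simp⟩
  · rintro s' ⟨-, -, -, g4, g5⟩
    exact ⟨g4, g5⟩

/-- Update the estimates for the component with root `i`. -/
def component : Pg :=
  .seq markPath (.seq labelNodes (.seq secondMax updateEst))

variable {X : Inst} {ρ rt cen : ℕ → ℕ}

/-- The two halves of the approximation. New estimates are bounded by actual distances, because the
maximum is taken over other sides of t. Conversely, two nodes no longer in a common component lie on
different sides, and the upper bound `dist_le_add` applies to them. -/
theorem run_component (hX : X.Good) {s : St} (hs : X.Tab s) (h0 : ρ 0 ≠ 0)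
    (hT : RootTable X.n X.par ρ rt cen) {r t : ℕ} (hc : IsCentroid X.n X.par (fun x => ρ x ≠ 0) r t)
    (hi : s.r .i = r) (ht : s.a .cen r = t) (hstp : ∀ x, s.a .stp x ≠ t)
    (hl : Lst (s.a .ln) (s.a .lh r) (members X.n ρ rt r)) :
    Run X.L component s (900 * X.work ρ rt r + 200) (fun s' =>
      (∀ y, s'.a .stp y = s.a .stp y ∨ s'.a .stp y = t) ∧
      (∀ v, s.a .est v ≤ s'.a .est v) ∧
      (∀ v, (∃ u, 1 ≤ u ∧ u ≤ X.n ∧ s.a .est v ≤ X.H.dist v u) →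
        ∃ u, 1 ≤ u ∧ u ≤ X.n ∧ s'.a .est v ≤ X.H.dist v u) ∧
      ∀ u ∈ members X.n ρ rt r, ∀ v ∈ members X.n ρ rt r,
        ¬ Same X.par (fun x => ρ x ≠ 0 ∨ x = t) u v → X.H.dist v u ≤ s'.a .est v + 1) := by
  have hnL := hX.input.n_lt
  have hpar := hX.elim.par_lt
  have hH := hX.elim
  have ht1 := hc.one_le
  have htn := hc.le
  have hr0 : ρ (X.par r) ≠ 0 := hc.root
  have hmem : ∀ {x}, x ∈ members X.n ρ rt r ↔
    1 ≤ x ∧ x ≤ X.n ∧ ρ x = 0 ∧ Up X.par (fun x => ρ x ≠ 0) x r := hT.mem_iff hr0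
  set M := members X.n ρ rt r with hM
  have hW : X.work ρ rt r = (M.map fun x => X.deg x + 1).sum := rfl
  refine Run.mono (T := (420 * X.work ρ rt r + 40) + ((300 * X.work ρ rt r + 40) +
    ((60 * (M.map fun x => X.deg x + 1).sum + 40) + (100 * (M.map fun x => X.deg x + 1).sum + 40))))
    ?_ (by rw [← hW]; omega) fun _ h => h
  refine Run.seq (run_markPath hX hs h0 hT hc hi ht hstp) fun s1 ⟨a1, a2, a3⟩ f1 => ?_
  refine Run.seq (run_labelNodes hX (hs.frame f1 (by decide)) h0 hT hc a1 a2 a3 ?_)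
    fun s2 ⟨b1, b2⟩ f2 => ?_
  · rw [f1.2 .ln (by decide), f1.2 .lh (by decide)]; exact hl
  have hl2 : Lst (s2.a .ln) (s2.a .lh r) M := by
    rw [f2.2 .ln (by decide), f2.2 .lh (by decide), f1.2 .ln (by decide), f1.2 .lh (by decide)]
    exact hl
  have hdle : ∀ x ∈ M, s2.a .ds x ≤ X.n := fun x hx =>
    hX.distTo_le ht1 htn (hmem.1 hx).1 (hmem.1 hx).2.1 (b2.dist x hx)
  have hble : s2.r .b ≤ X.n := by
    rcases b2.max with ⟨h, _⟩ | ⟨x, hx, h, _⟩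
    · omega
    · exact h ▸ hdle x hx
  refine Run.seq (run_secondMax X (r := r) (l := M) (by rw [f2.1 .r (by decide), a1]) hl2)
    fun s3 ⟨c1, c2⟩ f3 => ?_
  have d1 : s3.a .ds = s2.a .ds := f3.2 _ (by decide)
  have d2 : s3.a .sd = s2.a .sd := f3.2 _ (by decide)
  have d3 : s3.r .b = s2.r .b := f3.1 _ (by decide)
  have d4 : s3.r .c = s2.r .c := f3.1 _ (by decide)
  have hgle : s3.r .g ≤ X.n := by
    rcases c2 with h | ⟨x, hx, _, h⟩
    · omega
    · exact h ▸ hdle x hx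
  have d5 : s3.a .est = s.a .est := by
    rw [f3.2 _ (by decide), f2.2 _ (by decide), f1.2 _ (by decide)]
  refine Run.mono (Run.framed (run_updateEst X (r := r) (l := M) ?_ ?_ (fun x hx => ?_)
    fun x hx => ?_)) le_rfl ?_
  · rw [f3.1 .r (by decide), f2.1 .r (by decide), a1]
  · rw [f3.2 .ln (by decide), f3.2 .lh (by decide)]; exact hl2
  · rw [d1, d3]; have := hdle x hx; omega
  · rw [d1]; have := hdle x hx; omega
  rintro s4 ⟨⟨e1, e2⟩, f4⟩
  rw [d1, d2, d3, d4, d5] at e1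
  rw [d5] at e2
  set ds := s2.a .ds with hds
  set sd := s2.a .sd with hsd
  have hlow : ∀ x ∈ M, ∀ y ∈ M, sd x ≠ sd y → ds x + ds y ≤ X.H.dist x y := by
    intro x hx y hy hxy
    obtain ⟨h1, h2, h3, h4⟩ := hmem.1 hx
    obtain ⟨g1, g2, g3, g4⟩ := hmem.1 hy
    exact b2.side.add_le_dist (R := fun x => ρ x ≠ 0) h0 hpar hr0 hc.up ht1 hH h1 h2 (by simpa using h3) h4
      g1 g2 (by simpa using g3) g4 hxy (b2.dist x hx) (b2.dist y hy)
  refine ⟨fun y => ?_, fun v => ?_, fun v hv => ?_, fun u hu v hv huv => ?_⟩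
  · rw [f4.2 _ (by decide), f3.2 _ (by decide)]
    exact b1 y
  · by_cases hv : v ∈ M
    · rw [e1 v hv]; exact le_max_left _ _
    · rw [e2 v hv]
  · by_cases hvM : v ∈ M
    · rw [e1 v hvM]
      rcases le_total (if sd v = s2.r .c then ds v + s3.r .g else ds v + s2.r .b) (s.a .est v)
        with h | h
      · rw [max_eq_left h]; exact hv
      · rw [max_eq_right h]
        -- If the maximum over the other sides is 0, possibly as a default value, t itself is a
        -- witness, as it belongs to its bag.
        have hself : ∃ u, 1 ≤ u ∧ u ≤ X.n ∧ ds v ≤ X.H.dist v u :=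
          ⟨t, ht1, htn, (b2.dist v hvM).2 t (.inl rfl)⟩
        by_cases hsv : sd v = s2.r .c
        · rw [if_pos hsv]
          rcases c2 with hg | ⟨u, hu, h1, h2⟩
          · rw [hg]; exact hself
          · rw [← h2]
            exact ⟨u, (hmem.1 hu).1, (hmem.1 hu).2.1, hlow v hvM u hu fun h => h1 (h ▸ hsv)⟩
        · rw [if_neg hsv]
          rcases b2.max with ⟨hb, _⟩ | ⟨u, hu, h1, h2⟩
          · rw [hb]; exact hself
          · rw [← h1]
            exact ⟨u, (hmem.1 hu).1, (hmem.1 hu).2.1, hlow v hvM u hu fun h => hsv (h ▸ h2)⟩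
    · rw [e2 v hvM]; exact hv
  · obtain ⟨h1, h2, h3, h4⟩ := hmem.1 hu
    obtain ⟨g1, g2, g3, g4⟩ := hmem.1 hv
    have hup : X.H.dist v u ≤ ds v + ds u + 1 :=
      hH.dist_le_add ht1 htn g1 g2 (b2.dist v hv) (b2.dist u hu)
    rw [e1 v hv]
    have hmax := le_max_right (s.a .est v)
      (if sd v = s2.r .c then ds v + s3.r .g else ds v + s2.r .b)
    by_cases huv' : u = v
    · subst huv'; simp
    -- Only t has the label t, and equal labels of two other nodes mean that t does not separate
    -- them.
    have hne : sd u ≠ sd v := by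
      intro heq
      have hut : u ≠ t := by
        rintro rfl
        refine b2.side.ne_self (R := fun x => ρ x ≠ 0) h0 hpar hr0 hc.up ht1 g1 g2 (by simpa using g3) g4 (Ne.symm huv') ?_
        rw [← heq]; exact b2.side.self
      have hvt : v ≠ t := by
        rintro rfl
        refine b2.side.ne_self (R := fun x => ρ x ≠ 0) h0 hpar hr0 hc.up ht1 h1 h2 (by simpa using h3) h4 huv' ?_
        rw [heq]; exact b2.side.self
      exact huv (b2.side.same_of_eq (R := fun x => ρ x ≠ 0) h0 hpar hr0 hc.up h1 h2 (by simpa using h3) h4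
        g1 g2 (by simpa using g3) g4 hut hvt heq)
    by_cases hsv : sd v = s2.r .c
    · rw [if_pos hsv] at hmax
      rw [if_pos hsv]
      have := c1 u hu fun h => hne (h.trans hsv.symm)
      omega
    · rw [if_neg hsv] at hmax
      rw [if_neg hsv]
      have := b2.le u hu
      omega

end RowMachine

namespace RowMachine

variable {X : Inst} {ρ rt cen : ℕ → ℕ}

/-! ### One level of the decomposition -/

/-- `r` is the root of a component. -/
def IsRoot (X : Inst) (ρ : ℕ → ℕ) (r : ℕ) : Prop :=
  1 ≤ r ∧ r ≤ X.n ∧ ρ r = 0 ∧ ρ (X.par r) ≠ 0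

theorem RootTable.isRoot (hT : RootTable X.n X.par ρ rt cen) (hX : X.Good) (h0 : ρ 0 ≠ 0) {v : ℕ}
    (h1 : 1 ≤ v) (h2 : v ≤ X.n) (h3 : ρ v = 0) : IsRoot X ρ (rt v) := by
  have hup := hT.up v h1 h2 h3
  have hb := hup.bounds (R := fun x => ρ x ≠ 0) h0 hX.elim.par_lt h1
  have := hup.not_of_not (by simpa using h3)
  exact ⟨hb.1, by omega, by simpa using this, hT.root v h1 h2 h3⟩

/-- This is how the program recognises roots: their lists are the nonempty ones. -/
theorem RootTable.head_eq_zero_iff (hT : RootTable X.n X.par ρ rt cen) (hX : X.Good)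
    (h0 : ρ 0 ≠ 0) {r p : ℕ} {nx : ℕ → ℕ} (h1 : 1 ≤ r) (h2 : r ≤ X.n)
    (hl : Lst nx p (members X.n ρ rt r)) : p ≠ 0 ↔ IsRoot X ρ r := by
  constructor
  · intro h
    cases hm : members X.n ρ rt r with
    | nil => rw [hm] at hl; exact (h hl).elim
    | cons v l =>
      have hv : v ∈ members X.n ρ rt r := hm ▸ (by simp)
      obtain ⟨h1, h2, h3, h4⟩ := mem_members.1 hv
      exact h4 ▸ hT.isRoot hX h0 h1 h2 h3
  · intro h hp
    have hr : r ∈ members X.n ρ rt r := (hT.mem_iff h.2.2.2).2 ⟨h1, h2, h.2.2.1, .refl⟩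
    cases hm : members X.n ρ rt r with
    | nil => rw [hm] at hr; simp at hr
    | cons v l =>
      rw [hm] at hl
      exact hl.2.1 (hl.1 ▸ hp)

/-- The total degree. -/
def Inst.total (X : Inst) : ℕ := ∑ x ∈ Finset.Icc 1 X.n, (X.deg x + 1)

/-- The components are disjoint, so a whole level costs no more than the total degree. -/
theorem Inst.sum_work_le (X : Inst) (ρ rt : ℕ → ℕ) :
    ∑ r ∈ Finset.Icc 1 X.n, X.work ρ rt r ≤ X.total := by
  have h : ∀ r, X.work ρ rt r =
      ∑ x ∈ (Finset.Icc 1 X.n).filter (fun x => ρ x = 0 ∧ rt x = r), (X.deg x + 1) := by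
    intro r
    have hnd : (members X.n ρ rt r).Nodup := (members_pairwise _ _ _ _).imp fun h => h.ne
    rw [Inst.work, ← List.sum_toFinset _ hnd]
    congr 1
    ext x
    simp [mem_members, and_assoc]
  simp only [h, Inst.total]
  rw [← Finset.sum_biUnion]
  · refine Finset.sum_le_sum_of_subset fun x hx => ?_
    simp only [Finset.mem_biUnion, Finset.mem_filter] at hx
    exact hx.choose_spec.2.1
  · intro a _ b _ hab
    refine Finset.disjoint_left.2 fun x hx hx' => hab ?_
    simp only [Finset.mem_filter] at hx hx'
    rw [← hx.2.2, hx'.2.2]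

theorem Inst.n_le_total (X : Inst) : X.n ≤ X.total := by
  have : ∑ x ∈ Finset.Icc 1 X.n, 1 ≤ X.total := Finset.sum_le_sum fun x _ => by omega
  simpa using this

/-- Update the estimates for all components. -/
def components : Pg :=
  forUp (.ite (.eq (.ld .lh (.v .i)) (.c 0)) .skip component)

/-- Marks are never erased. Old ones point to removed nodes, and those made at this level are
centroids of components treated before; different components have different centroids, so each
centroid is a fresh mark. -/
theorem run_components (hX : X.Good) {s : St} (hs : X.Tab s) (h0 : ρ 0 ≠ 0)
    (hT : RootTable X.n X.par ρ rt cen) (hcen : s.a .cen = cen)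
    (hl : ∀ r, 1 ≤ r → r ≤ X.n → Lst (s.a .ln) (s.a .lh r) (members X.n ρ rt r))
    (hstp : ∀ x, ρ (s.a .stp x) ≠ 0)
    (hlow : ∀ v, 1 ≤ v → v ≤ X.n → ∃ u, 1 ≤ u ∧ u ≤ X.n ∧ s.a .est v ≤ X.H.dist v u) :
    Run X.L components s (1200 * X.total + 20) (fun s' =>
      (∀ x, ρ (s'.a .stp x) ≠ 0 ∨ ∃ r, IsRoot X ρ r ∧ s'.a .stp x = cen r) ∧
      (∀ v, s.a .est v ≤ s'.a .est v) ∧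
      (∀ v, 1 ≤ v → v ≤ X.n → ∃ u, 1 ≤ u ∧ u ≤ X.n ∧ s'.a .est v ≤ X.H.dist v u) ∧
      ∀ r, IsRoot X ρ r → ∀ u ∈ members X.n ρ rt r, ∀ v ∈ members X.n ρ rt r,
        ¬ Same X.par (fun x => ρ x ≠ 0 ∨ x = cen r) u v → X.H.dist v u ≤ s'.a .est v + 1) := by
  have hnL := hX.input.n_lt
  have := Run.forUp (L := X.L) (n := X.n) (s := s)
    (body := .ite (.eq (.ld .lh (.v .i)) (.c 0)) .skip component)
    (fun i => 900 * X.work ρ rt i + 220)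
    (fun i s' => X.Tab s' ∧ s'.a .cen = cen ∧ s'.a .ln = s.a .ln ∧ s'.a .lh = s.a .lh ∧
      (∀ x, ρ (s'.a .stp x) ≠ 0 ∨ ∃ r, r < i ∧ IsRoot X ρ r ∧ s'.a .stp x = cen r) ∧
      (∀ v, s.a .est v ≤ s'.a .est v) ∧
      (∀ v, 1 ≤ v → v ≤ X.n → ∃ u, 1 ≤ u ∧ u ≤ X.n ∧ s'.a .est v ≤ X.H.dist v u) ∧
      ∀ r, r < i → IsRoot X ρ r → ∀ u ∈ members X.n ρ rt r, ∀ v ∈ members X.n ρ rt r,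
        ¬ Same X.par (fun x => ρ x ≠ 0 ∨ x = cen r) u v → X.H.dist v u ≤ s'.a .est v + 1)
    (by omega) hs.n ?_ (by decide) (by decide) ?_ ?_
  · refine Run.mono this ?_ ?_
    · have h1 := X.sum_work_le ρ rt
      have h2 := X.n_le_total
      have : ∑ i ∈ Finset.Icc 1 X.n, (900 * X.work ρ rt i + 220 + 20) =
          900 * ∑ i ∈ Finset.Icc 1 X.n, X.work ρ rt i + 240 * X.n := by
        rw [Finset.mul_sum, Finset.sum_congr rfl fun i _ => show 900 * X.work ρ rt i + 220 + 20 =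
          900 * X.work ρ rt i + 240 from rfl, Finset.sum_add_distrib]
        simp [mul_comm]
      omega
    · rintro s' ⟨-, -, -, -, g1, g2, g3, g4⟩
      refine ⟨fun x => (g1 x).imp_right fun ⟨r, h⟩ => ⟨r, h.2⟩, g2, g3, fun r hr => ?_⟩
      exact g4 r (by have := hr.2.1; omega) hr
  · rintro i s' m ⟨⟨h1, h2, h3, h4, h5⟩, h⟩
    exact ⟨⟨by simpa using h1, h2, h3, h4, h5⟩, by simpa using h⟩
  · rintro i s1 hi hin hn hsi ⟨g1, g2, g3, g4, g5, g6, g7, g8⟩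
    have hiff := hT.head_eq_zero_iff hX h0 hi hin (hl i hi hin)
    refine Run.mono (Run.ite (T := 900 * X.work ρ rt i + 200) (by simp) (fun hb => ?_)
      fun hb => ?_) (by simp [Ts.cost, Ex.cost]; omega) fun _ h => h
    · have hnr : ¬ IsRoot X ρ i := by
        rw [← hiff, not_not]
        simpa [hsi, g4] using hb
      refine Run.straight trivial (by simp only [Pg.tm]; omega) ?_
      simp only [Pg.den]
      refine ⟨g1, g2, g3, g4, fun x => (g5 x).imp_right fun ⟨r, h1, h2⟩ => ⟨r, by omega, h2⟩,
        g6, g7, fun r hr hr' => ?_⟩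
      have : r ≠ i := fun h => hnr (h ▸ hr')
      exact g8 r (by omega) hr'
    · have hir : IsRoot X ρ i := by
        rw [← hiff]
        simpa [hsi, g4] using hb
      have hc := hT.cen i hi hin hir.2.2.1 hir.2.2.2
      have hact : ρ (cen i) = 0 := by simpa using hc.act
      refine Run.mono (Run.framed (run_component hX g1 h0 hT hc hsi (by rw [g2]) (fun x hx => ?_)
        ?_)) le_rfl ?_
      · rcases g5 x with h | ⟨r, h1, h2, h3⟩
        · exact h (hx ▸ hact)
        · have hcr := hT.cen r h2.1 h2.2.1 h2.2.2.1 h2.2.2.2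
          have hup := hcr.up
          rw [← h3, hx] at hup
          have := root_unique hup hc.up h2.2.2.2 hir.2.2.2
          omega
      · rw [g3, g4]; exact hl i hi hin
      · rintro s2 ⟨⟨k1, k2, k3, k4⟩, hf⟩
        refine ⟨g1.frame hf (by decide), by rw [hf.2 _ (by decide), g2],
          by rw [hf.2 _ (by decide), g3], by rw [hf.2 _ (by decide), g4], fun x => ?_,
          fun v => (g6 v).trans (k2 v), fun v h1 h2 => k3 v (g7 v h1 h2), fun r hr hr' => ?_⟩
        · rcases k1 x with h | h
          · rw [h]
            exact (g5 x).imp_right fun ⟨r, h1, h2⟩ => ⟨r, by omega, h2⟩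
          · exact .inr ⟨i, by omega, hir, h⟩
        · rcases Nat.lt_succ_iff_lt_or_eq.1 hr with h | rfl
          · intro u hu v hv huv
            have := g8 r h hr' u hu v hv huv
            have := k2 v
            omega
          · exact k4
  · exact ⟨hs, hcen, rfl, rfl, fun x => .inl (hstp x), fun v => le_rfl, hlow,
      fun r hr hr' => by have := hr'.1; omega⟩

/-- Remove the centroids of all components. -/
def removeCentroids : Pg :=
  forUp (.ite (.eq (.ld .lh (.v .i)) (.c 0)) .skip
    (.seq (.store .rem (.ld .cen (.v .i)) (.c 1)) (.set .k (.c 1))))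

/-- Register k records whether the level found any component, which decides if another level is
needed. -/
theorem run_removeCentroids (hX : X.Good) {s : St} (hs : X.Tab s) (h0 : ρ 0 ≠ 0)
    (hρ : s.a .rem = ρ) (hk : s.r .k = 0)
    (hT : RootTable X.n X.par ρ rt cen) (hcen : s.a .cen = cen)
    (hl : ∀ r, 1 ≤ r → r ≤ X.n → Lst (s.a .ln) (s.a .lh r) (members X.n ρ rt r)) :
    Run X.L removeCentroids s (X.n * 80 + 20) (fun s' =>
      (∀ x, s'.a .rem x ≠ 0 ↔ ρ x ≠ 0 ∨ ∃ r, IsRoot X ρ r ∧ x = cen r) ∧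
      (s'.r .k ≠ 0 ↔ ∃ r, IsRoot X ρ r)) := by
  have hnL := hX.input.n_lt
  have := Run.forUp (L := X.L) (n := X.n) (s := s)
    (body := .ite (.eq (.ld .lh (.v .i)) (.c 0)) .skip
      (.seq (.store .rem (.ld .cen (.v .i)) (.c 1)) (.set .k (.c 1)))) (fun i => 60)
    (fun i s' => s'.a .cen = cen ∧ s'.a .lh = s.a .lh ∧
      (∀ x, s'.a .rem x ≠ 0 ↔ ρ x ≠ 0 ∨ ∃ r, r < i ∧ IsRoot X ρ r ∧ x = cen r) ∧
      (s'.r .k ≠ 0 ↔ ∃ r, r < i ∧ IsRoot X ρ r))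
    (by omega) hs.n (fun i s m h => by simpa using h) (by decide) (by decide) ?_ ?_
  · refine Run.mono this (by simp) ?_
    rintro s' ⟨-, -, g1, g2⟩
    refine ⟨fun x => ?_, ?_⟩
    · rw [g1]
      refine or_congr_right (exists_congr fun r => ⟨fun h => h.2, fun h => ⟨?_, h⟩⟩)
      have := h.1.2.1; omega
    · rw [g2]
      refine exists_congr fun r => ⟨fun h => h.2, fun h => ⟨?_, h⟩⟩
      have := h.2.1; omega
  · rintro i s1 hi hin hn hsi ⟨g1, g2, g3, g4⟩
    have hiff := hT.head_eq_zero_iff hX h0 hi hin (hl i hi hin)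
    refine Run.straight (by simp) (by decide) ?_
    by_cases hb : s.a .lh i = 0
    · have hnr : ¬ IsRoot X ρ i := by rw [← hiff, not_not]; exact hb
      simp only [Pg.den, Ts.Holds, Ex.val, hsi, g2, hb, if_true]
      refine ⟨g1, trivial, fun x => ?_, ?_⟩
      · rw [g3]
        refine or_congr_right (exists_congr fun r => and_congr_left fun h => ?_)
        have : r ≠ i := fun h' => hnr (h' ▸ h.1)
        omega
      · rw [g4]
        refine exists_congr fun r => and_congr_left fun h => ?_
        have : r ≠ i := fun h' => hnr (h' ▸ h)
        omega
    · have hir : IsRoot X ρ i := by rw [← hiff]; exact hb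
      simp only [Pg.den, Ts.Holds, Ex.val, hsi, g2, hb, if_false]
      refine ⟨by simp [g1], by simp [g2], fun x => ?_, ?_⟩
      · by_cases hx : x = cen i
        · subst hx
          simp only [St.setR_a, St.setA_a, g1, Function.update_self, ne_eq, one_ne_zero,
            not_false_eq_true, true_iff]
          exact .inr ⟨i, by omega, hir, rfl⟩
        · simp only [St.setR_a, St.setA_a, g1, Function.update_self, ne_eq, hx,
            not_false_eq_true, Function.update_of_ne]
          rw [← ne_eq, g3]
          refine or_congr_right (exists_congr fun r => and_congr_left fun h => ?_)
          have : r ≠ i := fun h' => hx (h' ▸ h.2)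
          omega
      · simp only [St.setR_r, Function.update_self, ne_eq, one_ne_zero, not_false_eq_true,
          true_iff]
        exact ⟨i, by omega, hir⟩
  · refine ⟨hcen, rfl, fun x => ?_, ?_⟩
    · rw [hρ]
      refine ⟨.inl, fun h => h.resolve_right ?_⟩
      rintro ⟨r, h1, h2, -⟩
      have := h2.1; omega
    · simp only [hk, ne_eq, not_true, false_iff]
      rintro ⟨r, h1, h2⟩
      have := h2.1; omega

/-- One level of the decomposition. -/
def level : Pg :=
  .seq (.set .k (.c 0)) (.seq resetTables (.seq sumSizes (.seq findCentroids (.seq buildLists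
    (.seq components removeCentroids)))))

/-- The invariant of the decomposition after `ℓ` levels. -/
structure LevelInv (X : Inst) (ℓ : ℕ) (s : St) : Prop where
  tab : X.Tab s
  rem_zero : s.a .rem 0 ≠ 0
  stp : ∀ x, s.a .rem (s.a .stp x) ≠ 0
  low : ∀ v, 1 ≤ v → v ≤ X.n → ∃ u, 1 ≤ u ∧ u ≤ X.n ∧ s.a .est v ≤ X.H.dist v u
  cover : ∀ u v, 1 ≤ u → u ≤ X.n → 1 ≤ v → v ≤ X.n →
    ¬ Same X.par (fun x => s.a .rem x ≠ 0) u v → X.H.dist v u ≤ s.a .est v + 1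
  size : ∀ v, 1 ≤ v → v ≤ X.n → s.a .rem v = 0 →
    2 ^ ℓ * compSize X.n X.par (fun x => s.a .rem x ≠ 0) v ≤ X.n
  -- If the last level found a component, then `size` gave 2 ^ (ℓ - 1) ≤ n before it; the factor 2
  -- accounts for the one level of delay. This bounds the number of levels.
  count : s.r .k ≠ 0 → 2 ^ ℓ ≤ 2 * X.n
  done : s.r .k = 0 → ∀ v, 1 ≤ v → v ≤ X.n → s.a .rem v ≠ 0

theorem one_le_compSize {n : ℕ} {par : ℕ → ℕ} {R : ℕ → Prop} {v : ℕ} (h1 : 1 ≤ v) (h2 : v ≤ n)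
    (h3 : ¬ R v) : 1 ≤ compSize n par R v := by
  classical
  refine Finset.card_pos.2 ⟨v, ?_⟩
  simp only [Finset.mem_filter, Finset.mem_Icc]
  exact ⟨⟨h1, h2⟩, h3, h3, v, .refl, .refl⟩

/-- A pair that was in a common component and no longer is must have been separated by the centroid
of that component, since the other removed centroids lie elsewhere; so `run_components` has covered
it. Pairs separated earlier stay covered because estimates only grow. -/
theorem run_level (hX : X.Good) {s : St} {ℓ : ℕ} (hs : LevelInv X ℓ s) :
    Run X.L level s (1700 * X.total + 130) (LevelInv X (ℓ + 1)) := by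
  have hpar := hX.elim.par_lt
  have hn := X.n_le_total
  obtain ⟨tab, h0, hstp, hlow, hcover, hsize, -, -⟩ := hs
  set ρ := s.a .rem with hρ
  refine Run.mono (T := 10 + ((X.n * 50 + 20) + ((X.n * 80 + 20) + ((X.n * 120 + 20) +
    ((X.n * 80 + 20) + ((1200 * X.total + 20) + (X.n * 80 + 20))))))) ?_ (by omega) fun _ h => h
  refine Run.seq (Run.straight (Q := fun s' => s' = s.setR .k 0) (by simp) (by decide) (by simp))
    fun s1 hs1 f1 => ?_
  have t1 := tab.frame f1 (by decide)
  refine Run.seq (run_resetTables hX t1) fun s2 q2 f2 => ?_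
  have t2 := t1.frame f2 (by decide)
  have r2 : s2.a .rem = ρ := by rw [f2.2 _ (by decide), f1.2 _ (by decide)]
  refine Run.seq (run_sumSizes hX t2 r2 h0 fun j h1 h2 => (q2 j h1 h2).1) fun s3 q3 f3 => ?_
  have t3 := t2.frame f3 (by decide)
  have r3 : s3.a .rem = ρ := by rw [f3.2 _ (by decide), r2]
  refine Run.seq (run_findCentroids hX t3 r3 h0 q3) fun s4 q4 f4 => ?_
  have t4 := t3.frame f4 (by decide)
  have r4 : s4.a .rem = ρ := by rw [f4.2 _ (by decide), r3]
  refine Run.seq (run_buildLists t4 r4 rfl fun j h1 h2 => ?_) fun s5 q5 f5 => ?_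
  · rw [f4.2 _ (by decide), f3.2 _ (by decide)]; exact (q2 j h1 h2).2
  have t5 := t4.frame f5 (by decide)
  have e5 : s5.a .est = s.a .est := by
    rw [f5.2 _ (by decide), f4.2 _ (by decide), f3.2 _ (by decide), f2.2 _ (by decide),
      f1.2 _ (by decide)]
  have p5 : s5.a .stp = s.a .stp := by
    rw [f5.2 _ (by decide), f4.2 _ (by decide), f3.2 _ (by decide), f2.2 _ (by decide),
      f1.2 _ (by decide)]
  have c5 : s5.a .cen = s4.a .cen := f5.2 _ (by decide)
  refine Run.seq (run_components hX t5 h0 q4 c5 q5 (by rwa [p5]) (by rwa [e5]))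
    fun s6 ⟨q6, q6', q6'', q6'''⟩ f6 => ?_
  have t6 := t5.frame f6 (by decide)
  refine Run.mono (Run.framed (run_removeCentroids hX t6 h0 (rt := s4.a .rt) (cen := s4.a .cen)
    ?_ ?_ q4 ?_ ?_)) le_rfl ?_
  · rw [f6.2 _ (by decide), f5.2 _ (by decide), r4]
  · rw [f6.1 _ (by decide), f5.1 _ (by decide), f4.1 _ (by decide), f3.1 _ (by decide),
      f2.1 _ (by decide), hs1]
    simp
  · rw [f6.2 _ (by decide), c5]
  · rw [f6.2 .ln (by decide), f6.2 .lh (by decide)]; exact q5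
  rintro s7 ⟨⟨q7, q7'⟩, f7⟩
  have e7 : s7.a .est = s6.a .est := f7.2 _ (by decide)
  have p7 : s7.a .stp = s6.a .stp := f7.2 _ (by decide)
  have hmono : ∀ x, ρ x ≠ 0 → s7.a .rem x ≠ 0 := fun x hx => (q7 x).2 (.inl hx)
  have hcent : ∀ r, IsRoot X ρ r → IsCentroid X.n X.par (fun x => ρ x ≠ 0) r (s4.a .cen r) :=
    fun r hr => q4.cen r hr.1 hr.2.1 hr.2.2.1 hr.2.2.2
  refine ⟨t6.frame f7 (by decide), hmono 0 h0, fun x => ?_, ?_, fun u v h1 h2 h3 h4 h5 => ?_,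
    fun v h1 h2 h3 => ?_, fun hk => ?_, fun hk v h1 h2 h3 => ?_⟩
  · rw [p7, q7]
    exact q6 x
  · rw [e7]; exact q6''
  · rw [e7]
    by_cases hS : Same X.par (fun x => ρ x ≠ 0) u v
    · have hu0 : ρ u = 0 := by simpa using hS.1
      have hv0 : ρ v = 0 := by simpa using hS.2.1
      have hroot := q4.isRoot hX h0 h3 h4 hv0
      have hup := (same_iff_up_root (R := fun x => ρ x ≠ 0) hS.2.1 (q4.up v h3 h4 hv0)
        (q4.root v h3 h4 hv0)).1 hS
      refine q6''' _ hroot u ((q4.mem_iff hroot.2.2.2).2 ⟨h1, h2, hu0, hup.2⟩) v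
        (mem_members.2 ⟨h3, h4, hv0, rfl⟩) fun hS' => h5 ?_
      -- a path in the component that avoids its centroid avoids all centroids
      obtain ⟨g1, g2, a, g3, g4⟩ := hS'
      have hother : ∀ x, 1 ≤ x → x ≤ X.n → Up X.par (fun x => ρ x ≠ 0) x (s4.a .rt v) →
          ¬ (ρ x ≠ 0 ∨ x = s4.a .cen (s4.a .rt v)) → ¬ s7.a .rem x ≠ 0 := by
        intro x hx1 hxn hx hx' hx7
        rcases (q7 x).1 hx7 with h | ⟨r, hr, rfl⟩
        · exact hx' (.inl h)
        · have := root_unique (hcent r hr).up hx hr.2.2.2 hroot.2.2.2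
          exact hx' (.inr (by rw [this]))
      have hpath : ∀ w, 1 ≤ w → w ≤ X.n → Up X.par (fun x => ρ x ≠ 0) w (s4.a .rt v) →
          Up X.par (fun x => ρ x ≠ 0 ∨ x = s4.a .cen (s4.a .rt v)) w a →
          Up X.par (fun x => s7.a .rem x ≠ 0) w a := by
        intro w hw hwn hwr hwa
        induction w using Nat.strong_induction_on with
        | _ w ih =>
          rcases hwa.eq_or_step with rfl | ⟨h6, h7⟩
          · exact .refl
          · have hpw := hpar w hw
            have hp1 : 1 ≤ X.par w := Nat.one_le_iff_ne_zero.2 fun h => h6 (.inl (h ▸ h0))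
            have hpr : Up X.par (fun x => ρ x ≠ 0) (X.par w) (s4.a .rt v) := by
              rcases hwr.eq_or_step with h | ⟨_, h⟩
              · exact (h6 (.inl (h ▸ hroot.2.2.2))).elim
              · exact h
            exact (Up.step (hother _ hp1 (by omega) hpr h6)).trans
              (ih _ hpw hp1 (by omega) hpr h7)
      exact ⟨hother u h1 h2 hup.2 g1, hother v h3 h4 (q4.up v h3 h4 hv0) g2, a,
        hpath u h1 h2 hup.2 g3, hpath v h3 h4 (q4.up v h3 h4 hv0) g4⟩
    · have := hcover u v h1 h2 h3 h4 hS
      have := q6' v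
      rw [e5] at this
      omega
  · have hv0 : ρ v = 0 := by
      by_contra h
      exact hmono v h h3
    have hroot := q4.isRoot hX h0 h1 h2 hv0
    have := (hcent _ hroot).two_mul_compSize_le (R := fun x => ρ x ≠ 0) (R' := fun x => s7.a .rem x ≠ 0) h0 hpar hmono
      ((q7 _).2 (.inr ⟨_, hroot, rfl⟩)) h1 h2 (by simpa using h3) (q4.up v h1 h2 hv0)
    have h6 := hsize v h1 h2 hv0
    calc 2 ^ (ℓ + 1) * compSize X.n X.par (fun x => s7.a .rem x ≠ 0) v
        = 2 ^ ℓ * (2 * compSize X.n X.par (fun x => s7.a .rem x ≠ 0) v) := by ring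
      _ ≤ 2 ^ ℓ * compSize X.n X.par (fun x => ρ x ≠ 0) v := Nat.mul_le_mul_left _ this
      _ ≤ X.n := h6
  · obtain ⟨r, hr⟩ := q7'.1 hk
    have h6 := hsize r hr.1 hr.2.1 hr.2.2.1
    have h7 := one_le_compSize (par := X.par) (R := fun x => ρ x ≠ 0) hr.1 hr.2.1
      (by simpa using hr.2.2.1)
    have : 2 ^ ℓ ≤ X.n := (Nat.le_mul_of_pos_right _ h7).trans h6
    rw [pow_succ]; omega
  · have hv0 : ρ v = 0 := by
      by_contra h
      exact hmono v h h3
    exact (q7'.2 ⟨_, q4.isRoot hX h0 h1 h2 hv0⟩) hk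

end RowMachine

/-! ### The iteration of the levels -/

namespace RowMachine

/-- Compute the estimates of the eccentricities by repeated removal of centroids. -/
def decompose : Pg :=
  .seq (.seq (.store .rem (.c 0) (.c 1)) (.set .k (.c 1)))
    (.loop (.not (.eq (.v .k) (.c 0))) level)

/-- Initially all nodes form one component with root 1, so no pair needs to be covered. -/
theorem up_one {H : SimpleGraph ℕ} {n : ℕ} {par : ℕ → ℕ} (hH : H.IsElim n par)
    {R : ℕ → Prop} (hR : ∀ x, 1 ≤ x → ¬ R x) {v : ℕ} (h1 : 1 ≤ v) (h2 : v ≤ n) :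
    Up par R v 1 := by
  induction v using Nat.strong_induction_on with
  | _ v ih =>
    by_cases hv : v = 1
    · exact hv ▸ .refl
    · have h3 := hH.par_adj (i := v) (by omega) h2
      have h4 := hH.par_lt v h1
      have h5 := (hH.mem h3.symm).1
      exact (Up.step (hR _ h5)).trans (ih _ h4 h5 (by omega))

/-- The potential is the cost of one level times the number of levels still possible, bounded
through `LevelInv.count`. At the end no node is active, so `LevelInv.cover` applies to all pairs. -/
theorem run_decompose {X : Inst} (hX : X.Good) {s : St} (hs : X.Tab s) (hn : 1 ≤ X.n)
    (h1 : s.a .rem = fun _ => 0) (h2 : s.a .stp = fun _ => 0) (h3 : s.a .est = fun _ => 0) :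
    Run X.L decompose s ((Nat.log 2 (2 * X.n) + 2) * (1700 * X.total + 140)) (fun s' =>
      ∀ v, 1 ≤ v → v ≤ X.n → (∃ u, 1 ≤ u ∧ u ≤ X.n ∧ s'.a .est v ≤ X.H.dist v u) ∧
        ∀ u, 1 ≤ u → u ≤ X.n → X.H.dist v u ≤ s'.a .est v + 1) := by
  classical
  set T := 1700 * X.total + 140 with hT
  have hloop : ∀ s1, LevelInv X 0 s1 → Run X.L (.loop (.not (.eq (.v .k) (.c 0))) level) s1
      ((Nat.log 2 (2 * X.n) + 1 - 0) * T + 4 + 1) (fun s' =>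
      ∀ v, 1 ≤ v → v ≤ X.n → (∃ u, 1 ≤ u ∧ u ≤ X.n ∧ s'.a .est v ≤ X.H.dist v u) ∧
        ∀ u, 1 ≤ u → u ≤ X.n → X.H.dist v u ≤ s'.a .est v + 1) := by
    intro s1 hs1
    refine Run.mono (Run.loop (I := fun Φ s' => ∃ ℓ, LevelInv X ℓ s' ∧
      Φ = (Nat.log 2 (2 * X.n) + 1 - ℓ) * T) (fun _ _ _ => by simp) ?_ ⟨0, hs1, rfl⟩)
      (by simp [Ts.cost, Ex.cost]) ?_
    · rintro Φ s' ⟨ℓ, hJ, rfl⟩ hb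
      have hle : ℓ ≤ Nat.log 2 (2 * X.n) :=
        Nat.le_log_of_pow_le (by omega) (hJ.count (by simpa using hb))
      have hΦ : (Nat.log 2 (2 * X.n) + 1 - ℓ) * T = (Nat.log 2 (2 * X.n) + 1 - (ℓ + 1)) * T + T := by
        rw [show Nat.log 2 (2 * X.n) + 1 - ℓ = (Nat.log 2 (2 * X.n) + 1 - (ℓ + 1)) + 1 by omega]
        ring
      refine ⟨1700 * X.total + 130, (Nat.log 2 (2 * X.n) + 1 - (ℓ + 1)) * T, ?_, ?_,
        Run.mono (run_level hX hJ) le_rfl fun s2 hs2 => ⟨_, le_rfl, ℓ + 1, hs2, rfl⟩⟩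
      · rw [hΦ]; simp only [Ts.cost, Ex.cost]; omega
      · rw [hΦ]; omega
    · rintro s' ⟨hb, Φ, ℓ, hJ, -⟩ v g1 g2
      have hk : s'.r .k = 0 := by simpa using hb
      exact ⟨hJ.low v g1 g2, fun u g3 g4 => hJ.cover u v g3 g4 g1 g2 fun hS =>
        hS.1 (hJ.done hk u g3 g4)⟩
  refine Run.mono (T := 10 + ((Nat.log 2 (2 * X.n) + 1 - 0) * T + 4 + 1))
    (Run.seq (Run.straight (Q := LevelInv X 0) (by simp) (by decide) ?_)
    fun s1 hs1 _ => hloop s1 hs1) ?_ fun _ h => h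
  · have hrem : ∀ x, Function.update (fun _ => 0) 0 1 x ≠ 0 ↔ x = 0 := by
      intro x
      by_cases hx : x = 0 <;> simp [hx]
    refine ⟨⟨?_, ?_, ?_, ?_, ?_⟩, ?_, ?_, ?_, ?_, ?_, ?_, ?_⟩
    · simp [hs.n]
    · simp [hs.inp]
    · simp [hs.ord]
    · simp [hs.pos]
    · simp [hs.par]
    · simp
    · simp [h2]
    · intro v g1 g2
      exact ⟨v, g1, g2, by simp [h3]⟩
    · intro u v g1 g2 g3 g4 hS
      refine (hS ?_).elim
      have hact : ∀ x, 1 ≤ x → ¬ (fun x => Function.update (fun _ => 0) 0 1 x ≠ 0) x := by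
        intro x hx
        simp only [hrem]
        omega
      simp only [Pg.den, Ex.val, St.setR_a, St.setA_a, Function.update_self, h1]
      exact ⟨hact u g1, hact v g3, 1, up_one hX.elim hact g1 g2,
        up_one hX.elim hact g3 g4⟩
    · intro v g1 g2 g3
      simp only [pow_zero, one_mul, compSize]
      exact (Finset.card_filter_le _ _).trans (by simp)
    · intro _
      simp; omega
    · intro h
      simp at h
  · rw [show (Nat.log 2 (2 * X.n) + 2) * T = (Nat.log 2 (2 * X.n) + 1 - 0) * T + T by
      simp only [Nat.sub_zero]; ring]
    omega

end RowMachine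

namespace RowMachine

/-! ### Maximum cardinality search -/

/-- The number of neighbours of `u` with a number between `1` and `k - 1`. -/
def cnt (nb : ℕ → List ℕ) (P : ℕ → ℕ) (u k : ℕ) : ℕ :=
  ((nb u).filter fun x => P x ≠ 0 ∧ P x < k).length

/-- The lists `nb v` are the adjacency lists of a graph with vertices `0, …, n - 1`. -/
structure IsGraph (n : ℕ) (nb : ℕ → List ℕ) : Prop where
  lt : ∀ v < n, ∀ w ∈ nb v, w < n
  nodup : ∀ v < n, (nb v).Nodup
  symm : ∀ v < n, ∀ w < n, w ∈ nb v → v ∈ nb w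
  irrefl : ∀ v < n, v ∉ nb v

theorem IsGraph.length_le {n : ℕ} {nb : ℕ → List ℕ} (h : IsGraph n nb) {v : ℕ} (hv : v < n) :
    (nb v).length ≤ n := by
  have h1 : (nb v).toFinset ⊆ Finset.range n := fun w hw => by
    simpa using h.lt v hv w (by simpa using hw)
  have := Finset.card_le_card h1
  rwa [List.toFinset_card_of_nodup (h.nodup v hv), Finset.card_range] at this

/-- The vertices `O 1, …, O k` are numbered by `P` in the order of a maximum cardinality search. -/
structure IsSearch (n : ℕ) (nb : ℕ → List ℕ) (O P : ℕ → ℕ) (k : ℕ) : Prop where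
  le : ∀ w < n, P w ≤ k
  ord : ∀ i, 1 ≤ i → i ≤ k → O i < n ∧ P (O i) = i
  inv : ∀ w < n, P w ≠ 0 → O (P w) = w
  max : ∀ u < n, ∀ v < n, P u ≠ 0 → (P v = 0 ∨ P u < P v) → cnt nb P v (P u) ≤ cnt nb P u (P u)

/-- Counts below k + 1 do not see the new number, so comparisons made at earlier choices remain
valid. -/
theorem cnt_update {nb : ℕ → List ℕ} {P : ℕ → ℕ} {k v w j : ℕ} (hv : P v = 0)
    (hj : j ≤ k + 1) :
    cnt nb (Function.update P v (k + 1)) w j = cnt nb P w j := by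
  unfold cnt
  congr 1
  refine List.filter_congr fun x hx => ?_
  by_cases h : x = v
  · subst h; simp [hv]; omega
  · simp [h]

theorem cnt_update_succ {n : ℕ} {nb : ℕ → List ℕ} (hg : IsGraph n nb) {P : ℕ → ℕ} {k v w : ℕ}
    (hP : ∀ w < n, P w ≤ k) (hv : P v = 0) (hvn : v < n) (hw : w < n) :
    cnt nb (Function.update P v (k + 1)) w (k + 2) =
      cnt nb P w (k + 1) + if w ∈ nb v then 1 else 0 := by
  have h1 : w ∈ nb v ↔ v ∈ nb w := ⟨hg.symm v hvn w hw, hg.symm w hw v hvn⟩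
  simp only [h1]
  have hle : ∀ x ∈ nb w, P x ≤ k := fun x hx => hP x (hg.lt w hw x hx)
  unfold cnt
  have hnd := hg.nodup w hw
  revert hle hnd
  generalize nb w = l
  intro hle hnd
  induction l with
  | nil => simp
  | cons x l ih =>
    have ih := ih (fun y hy => hle y (by simp [hy])) (List.nodup_cons.1 hnd).2
    have hx := hle x (by simp)
    by_cases hxv : x = v
    · subst hxv
      simp only [(List.nodup_cons.1 hnd).1, if_false] at ih
      simp [hv]
      simpa using ih
    · have hvx : v ≠ x := fun h => hxv h.symm
      by_cases hx0 : P x = 0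
      · simpa [List.filter_cons, hxv, hx0, hvx] using ih
      · have e1 : P x < k + 2 := by omega
        have e2 : P x < k + 1 := by omega
        simp only [List.filter_cons, Function.update_of_ne hxv, List.mem_cons, hvx, false_or, ne_eq,
          hx0, not_false_eq_true, e1, e2, and_self, decide_true, if_true, List.length_cons]
        simp only [ne_eq] at ih
        omega

/-- By `cnt_update` the old comparisons are unaffected; only those of the new vertex have to be
checked, and these are the hypothesis `hm`. -/
theorem IsSearch.step {n : ℕ} {nb : ℕ → List ℕ} {O P : ℕ → ℕ} {k v : ℕ}
    (h : IsSearch n nb O P k) (hvn : v < n) (hv : P v = 0)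
    (hm : ∀ w < n, P w = 0 → cnt nb P w (k + 1) ≤ cnt nb P v (k + 1)) :
    IsSearch n nb (Function.update O (k + 1) v) (Function.update P v (k + 1)) (k + 1) := by
  refine ⟨fun w hw => ?_, fun i h1 h2 => ?_, fun w hw h0 => ?_, fun u hu w hw h1 h2 => ?_⟩
  · by_cases hwv : w = v
    · simp [hwv]
    · have := h.le w hw
      simp [hwv]; omega
  · by_cases hik : i = k + 1
    · subst hik; simp [hvn]
    · obtain ⟨h3, h4⟩ := h.ord i h1 (by omega)
      have : O i ≠ v := by rintro rfl; omega
      simp [hik, h3, h4, this]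
  · by_cases hwv : w = v
    · simp [hwv]
    · have := h.le w hw
      simp only [Function.update_of_ne hwv] at h0 ⊢
      rw [Function.update_of_ne (by omega), h.inv w hw h0]
  · by_cases huv : u = v
    · subst huv
      simp only [Function.update_self]
      rw [cnt_update hv le_rfl, cnt_update hv le_rfl]
      by_cases hwu : w = u
      · simp [hwu]
      · have := h.le w hw
        simp only [Function.update_of_ne hwu, Function.update_self] at h2
        exact hm w hw (by omega)
    · have h3 := h.le u hu
      simp only [Function.update_of_ne huv] at h1 h2 ⊢
      rw [cnt_update hv (by omega), cnt_update hv (by omega)]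
      refine h.max u hu w hw h1 ?_
      by_cases hwv : w = v
      · exact .inl (hwv ▸ hv)
      · simpa [hwv] using h2

theorem IsSearch.exists_zero {n : ℕ} {nb : ℕ → List ℕ} {O P : ℕ → ℕ} {k : ℕ}
    (h : IsSearch n nb O P k) (hk : k < n) : ∃ w < n, P w = 0 := by
  by_contra! hc
  have := Finset.card_le_card_of_injOn (s := Finset.range n) (t := Finset.Icc 1 k) P
    (fun w hw => by
      have hw : w < n := by simpa using hw
      have h1 := hc w hw
      have h2 := h.le w hw
      simp; omega)
    (fun x hx y hy hxy => by
      have hx : x < n := by simpa using hx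
      have hy : y < n := by simpa using hy
      rw [← h.inv x hx (hc x hx), ← h.inv y hy (hc y hy), hxy])
  simp at this
  omega

theorem IsSearch.ne_zero {n : ℕ} {nb : ℕ → List ℕ} {O P : ℕ → ℕ}
    (h : IsSearch n nb O P n) {w : ℕ} (hw : w < n) : P w ≠ 0 := by
  intro h0
  have := Finset.card_le_card_of_injOn (s := Finset.Icc 1 n) (t := (Finset.range n).erase w) O
    (fun i hi => by
      have hi : 1 ≤ i ∧ i ≤ n := by simpa using hi
      obtain ⟨h1, h2⟩ := h.ord i hi.1 hi.2
      have : O i ≠ w := by rintro rfl; omega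
      simp [this, h1])
    (fun x hx y hy hxy => by
      have hx : 1 ≤ x ∧ x ≤ n := by simpa using hx
      have hy : 1 ≤ y ∧ y ≤ n := by simpa using hy
      rw [← (h.ord x hx.1 hx.2).2, ← (h.ord y hy.1 hy.2).2, hxy])
  rw [Finset.card_erase_of_mem (by simpa using hw)] at this
  simp at this
  omega

/-- Linked lists `B i`, `i ≤ n`, of nodes at most `q`; the node `p` refers to the vertex `vl p`.
Every vertex `w` without a number occurs in the list `B (lab w)`. -/
structure Stacks (n q : ℕ) (hd vl nx lab P : ℕ → ℕ) (B : ℕ → List ℕ) : Prop where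
  lst : ∀ i ≤ n, Lst nx (hd i) (B i)
  node : ∀ i ≤ n, ∀ p ∈ B i, p ≤ q ∧ vl p < n ∧ (P (vl p) = 0 → i ≤ lab (vl p))
  mem : ∀ w < n, P w = 0 → ∃ p ∈ B (lab w), vl p = w

/-- Deletion is lazy: old nodes of w stay in lower lists. This is why `Stacks.node` asks only that
the list number be at most the label. -/
theorem Stacks.push {n q : ℕ} {hd vl nx lab P : ℕ → ℕ} {B : ℕ → List ℕ}
    (h : Stacks n q hd vl nx lab P B) {w : ℕ} (hw : w < n)
    (hlab : ∀ x < n, lab x ≤ n) :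
    Stacks n (q + 1) (Function.update hd (lab w + 1) (q + 1)) (Function.update vl (q + 1) w)
      (Function.update nx (q + 1) (hd (lab w + 1))) (Function.update lab w (lab w + 1)) P
      (Function.update B (lab w + 1) ((q + 1) :: B (lab w + 1))) := by
  have hq : ∀ i ≤ n, ∀ p ∈ B i, p ≠ q + 1 := fun i hi p hp => by
    have := (h.node i hi p hp).1
    omega
  have hlst : ∀ i ≤ n, Lst (Function.update nx (q + 1) (hd (lab w + 1))) (hd i) (B i) :=
    fun i hi => (h.lst i hi).congr fun p hp => by simp [hq i hi p hp]
  have hnode : ∀ i ≤ n, ∀ p ∈ B i, p ≤ q + 1 ∧ Function.update vl (q + 1) w p < n ∧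
      (P (Function.update vl (q + 1) w p) = 0 →
        i ≤ Function.update lab w (lab w + 1) (Function.update vl (q + 1) w p)) := by
    intro i hi p hp
    obtain ⟨h1, h2, h3⟩ := h.node i hi p hp
    rw [Function.update_of_ne (hq i hi p hp)]
    refine ⟨by omega, h2, fun h0 => ?_⟩
    by_cases hpw : vl p = w
    · have := h3 h0
      rw [hpw] at this ⊢
      simp; omega
    · simpa [hpw] using h3 h0
  refine ⟨fun i hi => ?_, fun i hi p hp => ?_, fun x hx h0 => ?_⟩
  · by_cases hil : i = lab w + 1
    · subst hil
      simp only [Function.update_self]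
      exact ⟨rfl, by omega, by simpa using hlst _ hi⟩
    · simpa [hil] using hlst i hi
  · by_cases hil : i = lab w + 1
    · subst hil
      simp only [Function.update_self, List.mem_cons] at hp
      rcases hp with rfl | hp
      · simp [hw]
      · exact hnode _ hi p hp
    · rw [Function.update_of_ne hil] at hp
      exact hnode i hi p hp
  · by_cases hxw : x = w
    · exact ⟨q + 1, by simp [hxw], by simp [hxw]⟩
    · obtain ⟨p, hp, hpx⟩ := h.mem x hx h0
      refine ⟨p, ?_, ?_⟩
      · rw [Function.update_of_ne hxw]
        by_cases hlx : lab x = lab w + 1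
        · rw [hlx, Function.update_self, ← hlx]
          exact List.mem_cons_of_mem _ hp
        · rwa [Function.update_of_ne hlx]
      · rw [Function.update_of_ne (hq _ (hlab x hx) p hp), hpx]

/-- Covers both uses: a stale node whose vertex already has a number, and a vertex that receives its
number now, which accounts for the change from P to P'. -/
theorem Stacks.pop {n q j p : ℕ} {hd vl nx lab P P' : ℕ → ℕ} {B : ℕ → List ℕ} {l : List ℕ}
    (h : Stacks n q hd vl nx lab P B) (hj : j ≤ n) (hB : B j = p :: l) (h0 : P' (vl p) ≠ 0)
    (h1 : ∀ w, P' w = 0 → P w = 0) :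
    Stacks n q (Function.update hd j (nx p)) vl nx lab P' (Function.update B j l) := by
  refine ⟨fun i hi => ?_, fun i hi x hx => ?_, fun w hw hw0 => ?_⟩
  · by_cases hij : i = j
    · subst hij
      have := h.lst i hi
      rw [hB] at this
      simpa using this.2.2
    · simpa [hij] using h.lst i hi
  · have hx' : x ∈ B i := by
      by_cases hij : i = j
      · subst hij
        rw [Function.update_self] at hx
        rw [hB]
        exact List.mem_cons_of_mem _ hx
      · rwa [Function.update_of_ne hij] at hx
    obtain ⟨g1, g2, g3⟩ := h.node i hi x hx'
    exact ⟨g1, g2, fun g => g3 (h1 _ g)⟩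
  · obtain ⟨x, hx, hxw⟩ := h.mem w hw (h1 w hw0)
    refine ⟨x, ?_, hxw⟩
    have hxp : x ≠ p := by rintro rfl; exact h0 (hxw ▸ hw0)
    by_cases hij : lab w = j
    · rw [hij, hB, List.mem_cons] at hx
      rw [hij, Function.update_self]
      exact hx.resolve_left hxp
    · rwa [Function.update_of_ne hij]

/-- The number of nodes in the lists. -/
def live (n : ℕ) (B : ℕ → List ℕ) : ℕ := ∑ i ∈ Finset.range (n + 1), (B i).length

theorem live_update {n : ℕ} {B : ℕ → List ℕ} {j : ℕ} (hj : j ≤ n) (l : List ℕ) :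
    live n (Function.update B j l) + (B j).length = live n B + l.length := by
  have hm : j ∈ Finset.range (n + 1) := by simp; omega
  unfold live
  rw [← Finset.add_sum_erase _ _ hm, ← Finset.add_sum_erase _ (fun i => (B i).length) hm,
    Function.update_self]
  have : ∑ i ∈ (Finset.range (n + 1)).erase j, (Function.update B j l i).length =
      ∑ i ∈ (Finset.range (n + 1)).erase j, (B i).length :=
    Finset.sum_congr rfl fun i hi => by rw [Function.update_of_ne (Finset.ne_of_mem_erase hi)]
  omega

/-- The sum of the degrees plus one over the vertices without a number. -/
def todo (n : ℕ) (nb : ℕ → List ℕ) (P : ℕ → ℕ) : ℕ :=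
  ∑ w ∈ Finset.range n, if P w = 0 then (nb w).length + 1 else 0

theorem todo_update {n : ℕ} {nb : ℕ → List ℕ} {P : ℕ → ℕ} {v k : ℕ} (hv : v < n) (h0 : P v = 0) :
    todo n nb (Function.update P v (k + 1)) + ((nb v).length + 1) = todo n nb P := by
  have hm : v ∈ Finset.range n := by simpa using hv
  unfold todo
  rw [← Finset.add_sum_erase _ _ hm, ← Finset.add_sum_erase _ (fun w => if P w = 0 then _ else 0) hm]
  have : ∑ i ∈ (Finset.range n).erase v,
        (if Function.update P v (k + 1) i = 0 then (nb i).length + 1 else 0) =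
      ∑ i ∈ (Finset.range n).erase v, if P i = 0 then (nb i).length + 1 else 0 :=
    Finset.sum_congr rfl fun i hi => by rw [Function.update_of_ne (Finset.ne_of_mem_erase hi)]
  simp [h0]
  omega

end RowMachine

/-! ### The search program and its amortised running time -/

namespace RowMachine

/-- Put all vertices on the stack number `0`. -/
def initStacks : Pg :=
  .seq (forUp (.seq (.store .vl (.v .i) (.sub (.v .i) (.c 1)))
    (.seq (.store .nx (.v .i) (.ld .hd (.c 0))) (.store .hd (.c 0) (.v .i)))))
    (.set .q (.v .n))

theorem run_initStacks {L n : ℕ} (hL : n + 1 < L) {s : St} (hn : s.r .n = n)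
    (hd : s.a .hd = fun _ => 0) (P : ℕ → ℕ) :
    Run L initStacks s (50 * n + 30) (fun s' => s'.r .q = n ∧ ∃ B,
      Stacks n n (s'.a .hd) (s'.a .vl) (s'.a .nx) (fun _ => 0) P B ∧ live n B = n) := by
  have hloop := Run.forUp (L := L) (n := n) (s := s)
    (body := .seq (.store .vl (.v .i) (.sub (.v .i) (.c 1)))
      (.seq (.store .nx (.v .i) (.ld .hd (.c 0))) (.store .hd (.c 0) (.v .i))))
    (fun _ => 20)
    (fun i s' => (∀ p, 1 ≤ p → p < i → s'.a .vl p = p - 1) ∧ (∀ k, k ≠ 0 → s'.a .hd k = 0) ∧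
      ∃ l, Lst (s'.a .nx) (s'.a .hd 0) l ∧ (∀ p, p ∈ l ↔ 1 ≤ p ∧ p < i) ∧ l.length = i - 1)
    hL hn (fun i s m h => h) (by decide) (by decide) ?_ ?_
  · refine Run.mono (Run.seq hloop fun s1 hs1 f1 => Run.straight (T := 5) (by simp) (by decide) ?_)
      ?_ fun s' hs' => hs'
    · obtain ⟨g1, g2, l, g3, g4, g5⟩ := hs1
      have hn1 : s1.r .n = n := by rw [f1.1 _ (by decide), hn]
      refine ⟨by simp [hn1], fun i => if i = 0 then l else [], ⟨fun i hi => ?_, fun i hi p hp => ?_,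
        fun w hw h0 => ?_⟩, ?_⟩
      · by_cases hi0 : i = 0
        · subst hi0; simpa using g3
        · simpa [hi0, Lst] using g2 i hi0
      · by_cases hi0 : i = 0
        · subst hi0
          simp only [if_true] at hp
          have := (g4 p).1 hp
          simp [g1 p this.1 this.2]
          omega
        · simp [hi0] at hp
      · refine ⟨w + 1, ?_, ?_⟩
        · simp only [if_true]
          exact (g4 _).2 (by omega)
        · simp [g1 (w + 1) (by omega) (by omega)]
      · unfold live
        rw [Finset.sum_eq_single 0 (fun i _ hi => by simp [hi]) (by simp)]
        simpa using g5
    · simp; omega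
  · rintro i s h1 h2 h3 h4 ⟨g1, g2, l, g3, g4, g5⟩
    refine Run.straight (by simp) (by decide) ?_
    have hl : ∀ p ∈ l, p ≠ i := fun p hp => by have := (g4 p).1 hp; omega
    refine ⟨fun p hp hpi => ?_, fun k hk => ?_, i :: l, ⟨?_, by omega, ?_⟩, fun p => ?_, ?_⟩
    · by_cases hpi' : p = i
      · subst hpi'; simp [h4]
      · simp [h4, hpi', g1 p hp (by omega)]
    · simp [hk, g2 k hk]
    · simp [h4]
    · simp only [Pg.den, St.setA_a, St.setA_r, Ex.val, h4, ne_eq, reduceCtorEq, not_false_eq_true,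
        Function.update_of_ne, Function.update_self]
      exact g3.congr fun p hp => by simp [hl p hp]
    · rw [List.mem_cons, g4]
      omega
    · simp [g5]; omega
  · exact ⟨fun p h1 h2 => by omega, fun k _ => by simp [hd], [], by simp [Lst, hd],
      fun p => by simp; omega, by simp⟩

/-- Move the vertex `w` to the next stack. -/
def bump : Pg :=
  .seq (.store .lab (.v .w) (.add (.ld .lab (.v .w)) (.c 1)))
    (.seq (.set .q (.add (.v .q) (.c 1)))
      (.seq (.store .vl (.v .q) (.v .w))
        (.seq (.store .nx (.v .q) (.ld .hd (.ld .lab (.v .w))))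
          (.store .hd (.ld .lab (.v .w)) (.v .q)))))

/-- Give the next number to the vertex in register `v` and move its neighbours to the next
stacks. -/
def visit : Pg :=
  .seq (.set .k (.add (.v .k) (.c 1)))
    (.seq (.store .ord (.v .k) (.v .v))
      (.seq (.store .pos (.v .v) (.v .k))
        (.seq (forNb bump) (.set .j (.add (.v .j) (.c 1))))))

/-- One step of the search. -/
def searchStep : Pg :=
  .seq (.set .p (.ld .hd (.v .j)))
    (.ite (.eq (.v .p) (.c 0)) (.set .j (.sub (.v .j) (.c 1)))
      (.seq (.store .hd (.v .j) (.ld .nx (.v .p)))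
        (.seq (.set .v (.ld .vl (.v .p)))
          (.ite (.eq (.ld .pos (.v .v)) (.c 0)) visit .skip))))

/-- Number the vertices in the order of a maximum cardinality search. -/
def search : Pg := .seq initStacks (.loop (.lt (.v .k) (.v .n)) searchStep)

/-- Numbered neighbours are moved as well; their new nodes are stale from the start, and the labels
remain exact counts for all vertices. -/
theorem run_bumps {L n v q : ℕ} {nb : ℕ → List ℕ} {A P lab : ℕ → ℕ} {B : ℕ → List ℕ}
    (hin : IsInput L n nb A) (hg : IsGraph n nb) {s : St} (hA : s.a .inp = A) (hv : s.r .v = v)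
    (hvn : v < n) (hq : s.r .q = q) (hql : q + (nb v).length + 1 < L) (hlab : s.a .lab = lab)
    (hl : ∀ w < n, lab w < n)
    (hs : Stacks n q (s.a .hd) (s.a .vl) (s.a .nx) lab P B) :
    Run L (forNb bump) s ((nb v).length * 90 + 30) (fun s' => ∃ B',
      s'.r .q = q + (nb v).length ∧ live n B' = live n B + (nb v).length ∧
      (∀ w < n, s'.a .lab w = lab w + if w ∈ nb v then 1 else 0) ∧
      Stacks n (q + (nb v).length) (s'.a .hd) (s'.a .vl) (s'.a .nx) (s'.a .lab) P B') := by
  have hnL := hin.n_lt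
  refine Run.mono (Run.forNb (T := 60) (hA ▸ hin) hv hvn
    (fun l s' => l.Nodup ∧ ∃ q' B', s'.r .q = q' ∧ q' + l.length = q + (nb v).length ∧
      live n B' + l.length = live n B + (nb v).length ∧
      (∀ w < n, s'.a .lab w = lab w + if w ∈ nb v ∧ w ∉ l then 1 else 0) ∧
      Stacks n q' (s'.a .hd) (s'.a .vl) (s'.a .nx) (s'.a .lab) P B')
    (fun l s m h => ⟨by simpa using h, by simpa using h, by simpa using h⟩)
    (by decide) (by decide) (by decide) ?_ ?_) le_rfl ?_
  · rintro w l s' hw ⟨h1, q', B', h2, h3, h4, h5, h6⟩ h7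
    have hwn := hg.lt v hvn w hw
    obtain ⟨h1w, h1l⟩ := List.nodup_cons.1 h1
    have hlw : s'.a .lab w = lab w := by
      rw [h5 w hwn]; simp
    have hlw' := hl w hwn
    simp only [List.length_cons] at h3 h4
    refine Run.straight ?_ (by decide) ⟨h1l, q' + 1,
      Function.update B' (lab w + 1) ((q' + 1) :: B' (lab w + 1)), ?_, by omega, ?_, ?_, ?_⟩
    · simp [bump, h7, h2, hlw]; omega
    · simp [bump, h2]
    · have := live_update (n := n) (B := B') (j := lab w + 1) (by omega)
        ((q' + 1) :: B' (lab w + 1))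
      simp only [List.length_cons] at this
      omega
    · intro x hx
      by_cases hxw : x = w
      · subst hxw
        simp [bump, h7, hlw, hw, h1w]
      · simp [bump, h7, hxw, h5 x hx]
    · have hlab' : ∀ x < n, s'.a .lab x ≤ n := fun x hx => by
        have := hl x hx
        rw [h5 x hx]
        split_ifs <;> omega
      have := h6.push hwn hlab'
      simpa [bump, h7, h2, hlw] using this
  · exact ⟨hg.nodup v hvn, q, B, hq, rfl, rfl, fun w hw => by simp [hlab], hlab ▸ hs⟩
  · rintro s' ⟨h1, q', B', h2, h3, h4, h5, h6⟩
    simp only [List.length_nil, add_zero] at h3 h4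
    subst h3
    exact ⟨B', h2, h4, by simpa using h5, h6⟩

theorem run_visit {L n v q k j : ℕ} {nb : ℕ → List ℕ} {A lab : ℕ → ℕ} {B : ℕ → List ℕ}
    (hin : IsInput L n nb A) (hg : IsGraph n nb) {s : St} (hA : s.a .inp = A) (hv : s.r .v = v)
    (hvn : v < n) (hq : s.r .q = q) (hql : q + (nb v).length + 1 < L) (hlab : s.a .lab = lab)
    (hl : ∀ w < n, lab w < n) (hk : s.r .k = k) (hkn : k < n) (hj : s.r .j = j) (hjk : j ≤ k)
    (hs : Stacks n q (s.a .hd) (s.a .vl) (s.a .nx) lab (Function.update (s.a .pos) v (k + 1)) B) :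
    Run L visit s ((nb v).length * 90 + 60) (fun s' => s'.r .k = k + 1 ∧ s'.r .j = j + 1 ∧
      s'.a .ord = Function.update (s.a .ord) (k + 1) v ∧
      s'.a .pos = Function.update (s.a .pos) v (k + 1) ∧ ∃ B',
      s'.r .q = q + (nb v).length ∧ live n B' = live n B + (nb v).length ∧
      (∀ w < n, s'.a .lab w = lab w + if w ∈ nb v then 1 else 0) ∧
      Stacks n (q + (nb v).length) (s'.a .hd) (s'.a .vl) (s'.a .nx) (s'.a .lab) (s'.a .pos) B') := by
  have hnL := hin.n_lt
  refine Run.mono (T := 5 + (8 + (8 + (((nb v).length * 90 + 30) + 5)))) ?_ (by omega)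
    fun _ h => h
  refine Run.seq (Run.straight (Q := fun s' => s' = s.setR .k (k + 1)) ?_ (by decide) ?_)
    fun s1 h1 _ => ?_
  · simp [hk]; omega
  · simp [hk]
  subst h1
  refine Run.seq (Run.straight (Q := fun s' => s' = (s.setR .k (k + 1)).setA .ord (k + 1) v) ?_
    (by decide) ?_) fun s1 h1 _ => ?_
  · simp
  · simp [hv]
  subst h1
  refine Run.seq (Run.straight (Q := fun s' => s' =
    ((s.setR .k (k + 1)).setA .ord (k + 1) v).setA .pos v (k + 1)) ?_
    (by decide) ?_) fun s1 h1 _ => ?_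
  · simp
  · simp [hv]
  subst h1
  refine Run.seq (run_bumps (q := q) (lab := lab) (B := B)
    (P := Function.update (s.a .pos) v (k + 1)) hin hg (by simpa using hA) (by simpa using hv) hvn
    (by simpa using hq) hql (by simpa using hlab) hl (by simpa using hs)) fun s1 h1 f1 => ?_
  obtain ⟨B', g1, g2, g3, g4⟩ := h1
  have k1 : s1.r .k = k + 1 := by rw [f1.1 _ (by decide)]; simp
  have k2 : s1.r .j = j := by rw [f1.1 _ (by decide)]; simp [hj]
  have k3 : s1.a .ord = Function.update (s.a .ord) (k + 1) v := by
    rw [f1.2 _ (by decide)]; simp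
  have k4 : s1.a .pos = Function.update (s.a .pos) v (k + 1) := by
    rw [f1.2 _ (by decide)]; simp
  refine Run.straight ?_ (by decide) ⟨?_, ?_, ?_, ?_, B', ?_, g2, ?_, ?_⟩
  · simp [k2]; omega
  · simp [k1]
  · simp [k2]
  · simp [k3]
  · simp [k4]
  · simp [g1]
  · simpa using g3
  · simpa [k4] using g4

/-- A vertex is not its own neighbour, so labels are less than n and the list with number one
greater than a label exists. -/
theorem cnt_lt {n k : ℕ} {nb : ℕ → List ℕ} (hg : IsGraph n nb) {P : ℕ → ℕ} {w : ℕ} (hw : w < n) :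
    cnt nb P w k < n := by
  have h1 : (nb w).toFinset ⊆ (Finset.range n).erase w := fun x hx => by
    have hx : x ∈ nb w := by simpa using hx
    have := hg.lt w hw x hx
    simp [this]
    rintro rfl
    exact hg.irrefl x hw hx
  have h2 := Finset.card_le_card h1
  rw [List.toFinset_card_of_nodup (hg.nodup w hw), Finset.card_erase_of_mem (by simpa using hw),
    Finset.card_range] at h2
  have := (nb w).length_filter_le fun x => P x ≠ 0 ∧ P x < k
  unfold cnt
  omega

/-- The invariant of the search; `Φ` is the time that is left. -/
structure SearchInv (n N : ℕ) (nb : ℕ → List ℕ) (A : ℕ → ℕ) (Φ : ℕ) (s : St)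
    (B : ℕ → List ℕ) : Prop where
  reg_n : s.r .n = n
  inp : s.a .inp = A
  srch : IsSearch n nb (s.a .ord) (s.a .pos) (s.r .k)
  k_le : s.r .k ≤ n
  j_le : s.r .j ≤ s.r .k
  lab : ∀ w < n, s.a .lab w = cnt nb (s.a .pos) w (s.r .k + 1)
  stk : Stacks n (s.r .q) (s.a .hd) (s.a .vl) (s.a .nx) (s.a .lab) (s.a .pos) B
  lab_le : ∀ w < n, s.a .pos w = 0 → s.a .lab w ≤ s.r .j
  q_le : s.r .q + todo n nb (s.a .pos) ≤ N
  -- Every list node pays for its removal, every unit of j for one decrement, and every vertex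
  -- without a number for its visit, including the nodes created and the increment of j.
  time : Φ = 60 * live n B + 30 * s.r .j + 200 * todo n nb (s.a .pos)

/-- If the list j is empty, no unnumbered vertex has label j and j can be lowered. If its first node
belongs to an unnumbered vertex v, then j ≤ `lab v` ≤ j, so v has the greatest label and may be
chosen; labels grow by at most one, so j + 1 is again an upper bound. Stale nodes are dropped. -/
theorem run_searchStep {L n N : ℕ} {nb : ℕ → List ℕ} {A : ℕ → ℕ} {B : ℕ → List ℕ} {Φ : ℕ}
    (hin : IsInput L n nb A) (hg : IsGraph n nb) (hN : N + 1 < L) {s : St}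
    (hs : SearchInv n N nb A Φ s B) (hk : s.r .k < n) :
    ∃ T Φ', T + 4 + Φ' ≤ Φ ∧ Run L searchStep s T (fun s' => ∃ B', SearchInv n N nb A Φ' s' B') := by
  have hnL := hin.n_lt
  have hjn : s.r .j ≤ n := by have := hs.j_le; have := hs.k_le; omega
  have hlst := hs.stk.lst _ hjn
  cases hB : B (s.r .j) with
  | nil =>
    rw [hB] at hlst
    have hp : s.a .hd (s.r .j) = 0 := hlst
    have hlab : ∀ w < n, s.a .pos w = 0 → s.a .lab w < s.r .j := fun w hw h0 => by
      refine lt_of_le_of_ne (hs.lab_le w hw h0) fun h => ?_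
      obtain ⟨p, hp, -⟩ := hs.stk.mem w hw h0
      rw [h, hB] at hp
      simp at hp
    have hj : 0 < s.r .j := by
      obtain ⟨w, hw, h0⟩ := hs.srch.exists_zero hk
      have := hlab w hw h0
      omega
    refine ⟨5 + ((Ts.eq (.v .p) (.c 0)).cost + 1 + 4), Φ - 30, ?_, ?_⟩
    · have := hs.time
      have h4 : (Ts.eq (.v .p) (.c 0)).cost = 3 := rfl
      omega
    refine Run.seq (Run.straight (Q := fun s' => s' = s.setR .p 0) (by simp) (by decide)
      (by simp [hp])) fun s1 h1 _ => ?_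
    subst h1
    refine Run.ite (by simp) (fun _ => ?_) fun hb => absurd (by simp) hb
    refine Run.straight (by simp) (by decide) ⟨B, ?_⟩
    simp only [Pg.den]
    refine ⟨by simpa using hs.reg_n, by simpa using hs.inp, by simpa using hs.srch,
      by simpa using hs.k_le, ?_, by simpa using hs.lab, by simpa using hs.stk,
      fun w hw h0 => ?_, by simpa using hs.q_le, ?_⟩
    · have := hs.j_le
      simp; omega
    · have := hlab w hw (by simpa using h0)
      simp; omega
    · have := hs.time
      simp; omega
  | cons p l =>
    rw [hB] at hlst
    obtain ⟨hp, hp0, -⟩ := hlst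
    obtain ⟨-, hvn, hjl⟩ := hs.stk.node _ hjn p (by simp [hB])
    generalize hv : s.a .vl p = v at hvn hjl
    have hlive := live_update (n := n) (B := B) hjn l
    rw [hB, List.length_cons] at hlive
    have hlabn : ∀ w < n, s.a .lab w < n := fun w hw => by
      rw [hs.lab w hw]; exact cnt_lt hg hw
    have h4 : (Ts.eq (.v .p) (.c 0)).cost = 3 := rfl
    have h5 : (Ts.eq (.ld .pos (.v .v)) (.c 0)).cost = 6 := rfl
    have htime := hs.time
    have hpre : ∀ {T : ℕ} {Q : St → Prop},
        Run L (.ite (.eq (.ld .pos (.v .v)) (.c 0)) visit .skip)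
          (((s.setR .p p).setA .hd (s.r .j) (s.a .nx p)).setR .v v) T Q →
        Run L searchStep s (22 + T) Q := by
      intro T Q h
      refine Run.mono (T := 5 + ((Ts.eq (.v .p) (.c 0)).cost + 1 + (8 + (5 + T)))) ?_ (by omega)
        fun _ h => h
      refine Run.seq (Run.straight (Q := fun s' => s' = s.setR .p p) (by simp) (by decide)
        (by simp [hp])) fun s1 h1 _ => ?_
      subst h1
      refine Run.ite (by simp) (fun hb => ?_) fun hb => ?_
      · simp at hb; omega
      refine Run.seq (Run.straight (Q := fun s' => s' =
        (s.setR .p p).setA .hd (s.r .j) (s.a .nx p)) (by simp) (by decide) (by simp))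
        fun s1 h1 _ => ?_
      subst h1
      refine Run.seq (Run.straight (Q := fun s' => s' =
        ((s.setR .p p).setA .hd (s.r .j) (s.a .nx p)).setR .v v) (by simp) (by decide)
        (by simp [hv])) fun s1 h1 _ => ?_
      subst h1
      exact h
    by_cases h0 : s.a .pos v = 0
    · have htodo := todo_update (nb := nb) (k := s.r .k) hvn h0
      have hqle := hs.q_le
      have hstk := hs.stk.pop (P' := Function.update (s.a .pos) v (s.r .k + 1)) hjn hB
        (by simp [hv]) (fun w hw => by
          by_cases hwv : w = v
          · subst hwv; simp at hw
          · simpa [hwv] using hw)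
      refine ⟨22 + (6 + 1 + ((nb v).length * 90 + 60)),
        60 * (live n (Function.update B (s.r .j) l) + (nb v).length) + 30 * (s.r .j + 1) +
          200 * todo n nb (Function.update (s.a .pos) v (s.r .k + 1)), by omega, hpre ?_⟩
      rw [← h5]
      refine Run.ite (by simp) (fun _ => ?_) fun hb => absurd (by simp [h0]) hb
      have hvis := run_visit (L := L) (q := s.r .q) (k := s.r .k) (j := s.r .j) (v := v)
        (s := ((s.setR .p p).setA .hd (s.r .j) (s.a .nx p)).setR .v v) (lab := s.a .lab)
        (B := Function.update B (s.r .j) l) (hs.inp ▸ hin) hg (by simp) (by simp) hvn (by simp)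
        (by omega) (by simp) hlabn (by simp) hk (by simp) hs.j_le (by simpa using hstk)
      refine Run.mono (Run.framed hvis) le_rfl ?_
      rintro s' ⟨⟨e1, e2, e3, e4, B', e5, e6, e7, e8⟩, f⟩
      have e3' : s'.a .ord = Function.update (s.a .ord) (s.r .k + 1) v := by simpa using e3
      have e4' : s'.a .pos = Function.update (s.a .pos) v (s.r .k + 1) := by simpa using e4
      refine ⟨B', ⟨?_, ?_, ?_, by omega, ?_, fun w hw => ?_, e5 ▸ e8, fun w hw hw0 => ?_, ?_, ?_⟩⟩
      · rw [f.1 _ (by decide)]; simpa using hs.reg_n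
      · rw [f.2 _ (by decide)]; simpa using hs.inp
      · rw [e1, e3', e4']
        refine hs.srch.step hvn h0 fun w hw hw0 => ?_
        rw [← hs.lab w hw, ← hs.lab v hvn]
        exact (hs.lab_le w hw hw0).trans (hjl h0)
      · have := hs.j_le
        omega
      · rw [e7 w hw, e1, e4', hs.lab w hw]
        exact (cnt_update_succ hg hs.srch.le h0 hvn hw).symm
      · rw [e4'] at hw0
        have : s.a .pos w = 0 := by
          by_cases hwv : w = v
          · subst hwv; simp at hw0
          · simpa [hwv] using hw0
        have := hs.lab_le w hw this
        rw [e7 w hw, e2]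
        split_ifs <;> omega
      · rw [e5, e4']; omega
      · rw [e6, e2, e4']
    · have hstk := hs.stk.pop (P' := s.a .pos) hjn hB (by simpa [hv] using h0) (fun w hw => hw)
      refine ⟨22 + (6 + 1 + 1), Φ - 60, by omega, hpre ?_⟩
      rw [← h5]
      refine Run.ite (by simp) (fun hb => absurd hb (by simp [h0])) fun _ => ?_
      refine Run.straight trivial (by decide) ?_
      simp only [Pg.den]
      refine ⟨Function.update B (s.r .j) l, by simpa using hs.reg_n, by simpa using hs.inp,
        by simpa using hs.srch, by simpa using hs.k_le, by simpa using hs.j_le,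
        by simpa using hs.lab, by simpa using hstk, by simpa using hs.lab_le,
        by simpa using hs.q_le, ?_⟩
      simp; omega

theorem run_search {L n : ℕ} {nb : ℕ → List ℕ} {A : ℕ → ℕ} (hin : IsInput L n nb A)
    (hg : IsGraph n nb) (hN : 2 * n + (∑ v ∈ Finset.range n, (nb v).length) + 1 < L) {s : St}
    (hn : s.r .n = n) (hA : s.a .inp = A) (hj : s.r .j = 0) (hk : s.r .k = 0)
    (hhd : s.a .hd = fun _ => 0) (hlab : s.a .lab = fun _ => 0) (hpos : s.a .pos = fun _ => 0) :
    Run L search s (310 * n + 200 * (∑ v ∈ Finset.range n, (nb v).length) + 40)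
      (fun s' => IsSearch n nb (s'.a .ord) (s'.a .pos) n) := by
  have hnL := hin.n_lt
  have htodo : todo n nb (fun _ => 0) = (∑ v ∈ Finset.range n, (nb v).length) + n := by
    simp [todo, Finset.sum_add_distrib]
  set M := ∑ v ∈ Finset.range n, (nb v).length with hM
  refine Run.mono (T := (50 * n + 30) + ((60 * n + 200 * (M + n)) + 3 + 1)) ?_ (by omega)
    fun _ h => h
  refine Run.seq (run_initStacks (by omega) hn hhd fun _ => 0) fun s1 h1 f1 => ?_
  obtain ⟨g1, B, g2, g3⟩ := h1
  have e1 : s1.r .n = n := by rw [f1.1 _ (by decide), hn]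
  have e2 : s1.r .j = 0 := by rw [f1.1 _ (by decide), hj]
  have e3 : s1.r .k = 0 := by rw [f1.1 _ (by decide), hk]
  have e4 : s1.a .inp = A := by rw [f1.2 _ (by decide), hA]
  have e5 : s1.a .lab = fun _ => 0 := by rw [f1.2 _ (by decide), hlab]
  have e6 : s1.a .pos = fun _ => 0 := by rw [f1.2 _ (by decide), hpos]
  refine Run.mono (Run.loop (b := .lt (.v .k) (.v .n))
    (fun Φ s' => ∃ B, SearchInv n (2 * n + M) nb A Φ s' B) (Φ := 60 * n + 200 * (M + n))
    (fun Φ s' _ => by simp) (fun Φ s' hs' hb => ?_) ⟨B, e1, e4, ?_, ?_, ?_, ?_, ?_, ?_, ?_, ?_⟩)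
    le_rfl ?_
  · obtain ⟨B', hB'⟩ := hs'
    have hb' : s'.r .k < n := by simpa [hB'.reg_n] using hb
    obtain ⟨T, Φ', h1, h2⟩ := run_searchStep hin hg hN hB' hb'
    have h4 : (Ts.lt (.v .k) (.v .n)).cost = 3 := rfl
    exact ⟨T, Φ', by omega, by omega, h2.mono le_rfl fun s'' h => ⟨Φ', le_rfl, h⟩⟩
  · rw [e3, e6]
    exact ⟨fun _ _ => le_rfl, fun i h1 h2 => by omega, fun w _ h => absurd rfl h,
      fun u _ v _ h => absurd rfl h⟩
  · omega
  · omega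
  · intro w hw
    simp [e5, e6, cnt]
  · rw [g1, e5, e6]; exact g2
  · simp [e5]
  · rw [g1, e6, htodo]; omega
  · rw [g3, e2, e6, htodo]; omega
  · rintro s' ⟨hb, Φ', B', h⟩
    have h1 := h.k_le
    have h2 : s'.r .k = n := by
      simp [h.reg_n] at hb; omega
    exact h2 ▸ h.srch

end RowMachine

/-! ### The elimination order of a chordal graph -/

theorem SimpleGraph.dist_hom_le {V W : Type*} {G : SimpleGraph V} {H : SimpleGraph W} (f : G →g H)
    {u v : V} (h : G.Reachable u v) : H.dist (f u) (f v) ≤ G.dist u v := by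
  obtain ⟨p, hp⟩ := h.exists_walk_length_eq_dist
  rw [← hp, ← p.length_map f]
  exact dist_le _

namespace RowMachine

/-- The adjacency lists with natural numbers as vertices. -/
def nbOf {n : ℕ} (adj : Fin n → List (Fin n)) (v : ℕ) : List ℕ :=
  if h : v < n then (adj ⟨v, h⟩).map Fin.val else []

theorem nbOf_val {n : ℕ} (adj : Fin n → List (Fin n)) (v : Fin n) :
    nbOf adj v = (adj v).map Fin.val := by
  simp [nbOf]

theorem nbOf_mk {n : ℕ} (adj : Fin n → List (Fin n)) {v : ℕ} (hv : v < n) :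
    nbOf adj v = (adj ⟨v, hv⟩).map Fin.val := by
  simp [nbOf, hv]

variable {n : ℕ} {G : SimpleGraph (Fin n)} {adj : Fin n → List (Fin n)}

theorem mem_nbOf (hadj : WordRAM.IsAdjList G adj) {v w : Fin n} :
    (w : ℕ) ∈ nbOf adj v ↔ G.Adj v w := by
  rw [nbOf_val, ← (hadj v).2 w]
  simp [Fin.val_inj]

theorem isGraph_nbOf (hadj : WordRAM.IsAdjList G adj) : IsGraph n (nbOf adj) := by
  have key : ∀ v, v < n → ∀ w ∈ nbOf adj v, w < n := fun v hv w hw => by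
    rw [nbOf_mk adj hv] at hw
    obtain ⟨x, -, rfl⟩ := List.mem_map.1 hw
    exact x.2
  refine ⟨key, fun v hv => ?_, fun v hv w hw h => ?_, fun v hv h => ?_⟩
  · rw [nbOf_mk adj hv]
    exact (hadj _).1.map Fin.val_injective
  · exact (mem_nbOf hadj (v := ⟨w, hw⟩) (w := ⟨v, hv⟩)).2
      ((mem_nbOf hadj (v := ⟨v, hv⟩) (w := ⟨w, hw⟩)).1 h).symm
  · exact G.loopless.irrefl _ ((mem_nbOf hadj (v := ⟨v, hv⟩) (w := ⟨v, hv⟩)).1 h)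

/-- The graph with the vertices renamed by `P`. -/
def renamed (G : SimpleGraph (Fin n)) (P : ℕ → ℕ) : SimpleGraph ℕ := G.map fun v : Fin n => P v

variable {O P : ℕ → ℕ}

theorem IsSearch.adj_iff (hs : IsSearch n (nbOf adj) O P n) {i j : ℕ} :
    (renamed G P).Adj i j ↔ ∃ u v : Fin n, G.Adj u v ∧ P u = i ∧ P v = j := by
  rw [renamed, SimpleGraph.map_adj']
  refine ⟨fun h => h.2, fun h => ⟨?_, h⟩⟩
  obtain ⟨u, v, h1, rfl, rfl⟩ := h
  intro h
  have h2 := hs.inv u u.2 (hs.ne_zero u.2)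
  rw [h, hs.inv v v.2 (hs.ne_zero v.2)] at h2
  exact h1.ne (Fin.ext h2.symm)

/-- Numbering and its inverse are homomorphisms in both directions, and homomorphisms do not
increase distances between mutually reachable vertices. -/
theorem IsSearch.dist_eq (hs : IsSearch n (nbOf adj) O P n) (hG : G.Connected) (u v : Fin n) :
    (renamed G P).Reachable (P u) (P v) ∧ (renamed G P).dist (P u) (P v) = G.dist u v := by
  let f : G →g renamed G P := ⟨fun v => P v, fun {u v} h => hs.adj_iff.2 ⟨u, v, h, rfl, rfl⟩⟩
  -- The default u is immaterial: it can only occur at isolated vertices of the renamed graph.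
  let g : renamed G P →g G := ⟨fun i => if h : O i < n then ⟨O i, h⟩ else u, fun {i j} h => by
    obtain ⟨x, y, h1, rfl, rfl⟩ := hs.adj_iff.1 h
    simpa [hs.inv x x.2 (hs.ne_zero x.2), hs.inv y y.2 (hs.ne_zero y.2)] using h1⟩
  have hg : ∀ x : Fin n, g (P x) = x := fun x => by
    change (if h : O (P x) < n then (⟨O (P x), h⟩ : Fin n) else u) = x
    simp [hs.inv x x.2 (hs.ne_zero x.2)]
  have hr : (renamed G P).Reachable (P u) (P v) := (hG u v).map f
  refine ⟨hr, le_antisymm (SimpleGraph.dist_hom_le f (hG u v)) ?_⟩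
  have := SimpleGraph.dist_hom_le g hr
  rwa [hg, hg] at this

theorem IsSearch.mem_dnList (hadj : WordRAM.IsAdjList G adj) (hs : IsSearch n (nbOf adj) O P n)
    {i : ℕ} (h1 : 1 ≤ i) (h2 : i ≤ n) (x : ℕ) :
    x ∈ dnList (nbOf adj) O P i ↔ x ∈ (renamed G P).dn i := by
  obtain ⟨h3, h4⟩ := hs.ord i h1 h2
  rw [dnList, List.mem_filter, List.mem_map]
  simp only [decide_eq_true_eq, SimpleGraph.dn, Set.mem_ofPred_eq, hs.adj_iff]
  refine and_congr_left fun _ => ⟨?_, ?_⟩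
  · rintro ⟨w, hw, rfl⟩
    have hwn := (isGraph_nbOf hadj).lt _ h3 w hw
    exact ⟨⟨O i, h3⟩, ⟨w, hwn⟩, (mem_nbOf hadj (v := ⟨O i, h3⟩) (w := ⟨w, hwn⟩)).1 hw, h4, rfl⟩
  · rintro ⟨u, v, h5, rfl, rfl⟩
    refine ⟨v, ?_, rfl⟩
    rw [hs.inv u u.2 (hs.ne_zero u.2)]
    exact (mem_nbOf hadj).2 h5

theorem IsSearch.cnt_eq (hadj : WordRAM.IsAdjList G adj) (hs : IsSearch n (nbOf adj) O P n)
    (u : Fin n) (k : ℕ) :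
    cnt (nbOf adj) P u k = {x : Fin n | G.Adj u x ∧ P x < k}.ncard := by
  have h1 : {x : Fin n | G.Adj u x ∧ P x < k} =
      (((adj u).filter fun x : Fin n => P x ≠ 0 ∧ P x < k).toFinset : Finset (Fin n)) := by
    ext x
    simp [(hadj u).2 x, hs.ne_zero x.2]
  rw [h1, Set.ncard_coe_finset, List.toFinset_card_of_nodup ((hadj u).1.filter _), cnt, nbOf_val,
    List.filter_map, List.length_map]
  rfl

/-- By connectedness an edge joins the vertices numbered below i to the others. Its later end has a
neighbour below i, and hence so does the vertex `O i`, which was preferred to it. -/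
theorem IsSearch.exists_dn (hadj : WordRAM.IsAdjList G adj) (hs : IsSearch n (nbOf adj) O P n)
    (hG : G.Connected) {i : ℕ} (h1 : 2 ≤ i) (h2 : i ≤ n) : ∃ x, x ∈ dnList (nbOf adj) O P i := by
  obtain ⟨h3, h4⟩ := hs.ord i (by omega) h2
  obtain ⟨g3, g4⟩ := hs.ord 1 le_rfl (by omega)
  obtain ⟨p⟩ := hG ⟨O 1, g3⟩ ⟨O i, h3⟩
  obtain ⟨d, -, hd1, hd2⟩ := p.exists_boundary_dart {x | P x < i} (by simp [g4]; omega)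
    (by simp [h4])
  simp only [Set.mem_ofPred_eq, not_lt] at hd1 hd2
  have hpos : 0 < cnt (nbOf adj) P d.snd i := by
    rw [hs.cnt_eq hadj, Set.ncard_pos]
    exact ⟨d.fst, d.adj.symm, hd1⟩
  have hle : cnt (nbOf adj) P d.snd i ≤ cnt (nbOf adj) P (O i) i := by
    rcases hd2.eq_or_lt with h | h
    · rw [h, hs.inv _ d.snd.2 (by omega)]
    · have := hs.max (O i) h3 d.snd d.snd.2 (by omega) (by omega)
      rwa [h4] at this
  have h5 := hs.cnt_eq hadj ⟨O i, h3⟩ i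
  simp only at h5
  rw [h5] at hle
  obtain ⟨x, hx1, hx2⟩ := (Set.ncard_pos (Set.toFinite _)).1 (hpos.trans_le hle)
  exact ⟨P x, (hs.mem_dnList hadj (by omega) h2 _).2 ⟨hs.adj_iff.2 ⟨_, x, hx1, h4, rfl⟩, hx2⟩⟩

/-- The clique property is where chordality enters, through `adj_of_search`; connectedness makes the
parent of every i ≥ 2 a genuine neighbour. -/
theorem IsSearch.isElim (hadj : WordRAM.IsAdjList G adj) (hs : IsSearch n (nbOf adj) O P n)
    (hG : G.Connected) (hc : G.IsChordal) {par : ℕ → ℕ}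
    (hp1 : ∀ i, 1 ≤ i → i ≤ n → (∀ x ∈ dnList (nbOf adj) O P i, x ≤ par i) ∧
      (par i = 0 ∨ par i ∈ dnList (nbOf adj) O P i))
    (hp0 : ∀ i, n < i → par i = 0) : (renamed G P).IsElim n par := by
  have hinj : Function.Injective fun v : Fin n => P v := fun u v h => Fin.ext <| by
    rw [← hs.inv u u.2 (hs.ne_zero u.2), show P u = P v from h, hs.inv v v.2 (hs.ne_zero v.2)]
  have hmem : ∀ {i j}, (renamed G P).Adj i j → 1 ≤ i ∧ i ≤ n := fun h => by
    obtain ⟨u, v, -, rfl, -⟩ := hs.adj_iff.1 h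
    exact ⟨Nat.one_le_iff_ne_zero.2 (hs.ne_zero u.2), hs.le u u.2⟩
  have hpar : ∀ i, 1 ≤ i → i ≤ n → par i ∈ dnList (nbOf adj) O P i →
      par i ∈ (renamed G P).dn i := fun i h1 h2 => (hs.mem_dnList hadj h1 h2 _).1
  have hd : ∀ {i j}, 1 ≤ i → i ≤ n → 1 ≤ j → j ≤ n →
      (renamed G P).Reachable i j ∧ (renamed G P).dist i j ≤ n := by
    intro i j h1 h2 h3 h4
    obtain ⟨g1, g2⟩ := hs.ord i h1 h2
    obtain ⟨g3, g4⟩ := hs.ord j h3 h4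
    obtain ⟨e1, e2⟩ := hs.dist_eq hG ⟨O i, g1⟩ ⟨O j, g3⟩
    simp only [g2, g4] at e1 e2
    obtain ⟨p, hp, hl⟩ := hG.exists_path_of_dist ⟨O i, g1⟩ ⟨O j, g3⟩
    have := hp.length_lt
    rw [Fintype.card_fin] at this
    exact ⟨e1, by omega⟩
  refine ⟨hmem, ?_, ?_, ?_, ?_, fun h1 h2 h3 h4 => (hd h1 h2 h3 h4).1,
    fun h1 h2 h3 h4 => (hd h1 h2 h3 h4).2⟩
  · intro i j k h1 h2 h3 h4 h5
    obtain ⟨a, b, hab, rfl, rfl⟩ := hs.adj_iff.1 h1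
    obtain ⟨a', c, hac, ha, rfl⟩ := hs.adj_iff.1 h2
    obtain rfl : a' = a := hinj ha
    refine hs.adj_iff.2 ⟨b, c, hc.adj_of_search (fun v => P v) hinj (fun u v huv => ?_) hab hac h3 h4
      fun h => h5 (h ▸ rfl), rfl, rfl⟩
    have := hs.max u u.2 v v.2 (hs.ne_zero u.2) (.inr huv)
    rwa [hs.cnt_eq hadj, hs.cnt_eq hadj] at this
  · intro i j h1 h2
    have h3 := hmem h1
    exact (hp1 i h3.1 h3.2).1 j ((hs.mem_dnList hadj h3.1 h3.2 j).2 ⟨h1, h2⟩)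
  · intro i h1 h2
    obtain ⟨h3, h4⟩ := hp1 i (by omega) h2
    obtain ⟨x, hx⟩ := hs.exists_dn hadj hG h1 h2
    refine (hpar i (by omega) h2 (h4.resolve_left fun h0 => ?_)).1
    have h5 := h3 x hx
    have h6 := ((hs.mem_dnList hadj (by omega) h2 x).1 hx).1
    have := (hmem h6.symm).1
    omega
  · intro i h1
    by_cases h2 : i ≤ n
    · rcases (hp1 i h1 h2).2 with h | h
      · omega
      · exact (hpar i h1 h2 h).2
    · rw [hp0 i (by omega)]; omega

/-! ### The whole program -/

/-- Compute the greatest smaller neighbour of every number. -/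
def parents : Pg :=
  forUp (.seq (.set .u (.v .i)) (.seq (.set .m (.c 0))
    (.seq (forDn (.ite (.lt (.v .m) (.v .x)) (.set .m (.v .x)) .skip)) (.store .par (.v .u) (.v .m)))))

theorem run_parents {L n : ℕ} {nb : ℕ → List ℕ} {A O P : ℕ → ℕ} (hin : IsInput L n nb A) {s : St}
    (hn : s.r .n = n) (hA : s.a .inp = A) (hO : s.a .ord = O) (hP : s.a .pos = P)
    (hpar : s.a .par = fun _ => 0) (hOn : ∀ i, 1 ≤ i → i ≤ n → O i < n) :
    Run L parents s (110 * (∑ i ∈ Finset.Icc 1 n, ((nb (O i)).length + 1)) + 20) (fun s' =>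
      (∀ i, 1 ≤ i → i ≤ n → (∀ x ∈ dnList nb O P i, x ≤ s'.a .par i) ∧
        (s'.a .par i = 0 ∨ s'.a .par i ∈ dnList nb O P i)) ∧ ∀ i, n < i → s'.a .par i = 0) := by
  have hnL := hin.n_lt
  have hloop := Run.forUp (L := L) (n := n) (s := s)
    (body := .seq (.set .u (.v .i)) (.seq (.set .m (.c 0))
      (.seq (forDn (.ite (.lt (.v .m) (.v .x)) (.set .m (.v .x)) .skip))
        (.store .par (.v .u) (.v .m)))))
    (fun i => (nb (O i)).length * 80 + 80)
    (fun i s' => s'.a .inp = A ∧ s'.a .ord = O ∧ s'.a .pos = P ∧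
      (∀ j, 1 ≤ j → j < i → (∀ x ∈ dnList nb O P j, x ≤ s'.a .par j) ∧
        (s'.a .par j = 0 ∨ s'.a .par j ∈ dnList nb O P j)) ∧ ∀ j, i ≤ j → s'.a .par j = 0)
    (by omega) hn (fun i s m h => h) (by decide) (by decide) ?_ ?_
  · refine Run.mono hloop ?_ ?_
    · rw [Finset.mul_sum]
      refine Nat.add_le_add_right (Finset.sum_le_sum fun i _ => ?_) _
      ring_nf; omega
    · rintro s' ⟨-, -, -, h1, h2⟩
      exact ⟨fun i h3 h4 => h1 i h3 (by omega), fun i hi => h2 i hi⟩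
  · rintro i s h1 h2 h3 h4 ⟨g1, g2, g3, g4, g5⟩
    refine Run.mono (T := 2 + (2 + (((nb (O i)).length * (20 + 60) + 60) + 5))) ?_ (by ring_nf; omega)
      fun _ h => h
    refine Run.seq (Run.straight (Q := fun s' => s' = s.setR .u i) (by simp) (by decide)
      (by simp [h4])) fun s1 k1 _ => ?_
    subst k1
    refine Run.seq (Run.straight (Q := fun s' => s' = (s.setR .u i).setR .m 0) (by simp)
      (by decide) (by simp)) fun s1 k1 _ => ?_
    subst k1
    have hdn := Run.forDn (L := L) (n := n) (nb := nb) (T := 20) (u := i)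
      (s := (s.setR .u i).setR .m 0)
      (body := .ite (.lt (.v .m) (.v .x)) (.set .m (.v .x)) .skip)
      (by simpa [g1] using hin) (by simp) (by simpa [g2] using hOn i h1 h2)
      (fun l s' => (∀ x ∈ dnList nb O P i, x ≤ s'.r .m ∨ x ∈ l) ∧
        (s'.r .m = 0 ∨ s'.r .m ∈ dnList nb O P i))
      (fun l s m h => ⟨by simpa using h, by simpa using h, by simpa using h, by simpa using h,
        by simpa using h⟩) (by decide) (by decide) (by decide) (by decide) (by decide)
      ?_ (by decide) ?_
    · have e : ((s.setR .u i).setR .m 0).a .ord i = O i := by simp [g2]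
      rw [e] at hdn
      refine Run.seq hdn fun s1 k1 f1 => ?_
      obtain ⟨k2, k3⟩ := k1
      have e1 : s1.r .u = i := by rw [f1.1 _ (by decide)]; simp
      have e2 : s1.a .inp = A := by rw [f1.2 _ (by decide)]; simpa using g1
      have e3 : s1.a .ord = O := by rw [f1.2 _ (by decide)]; simpa using g2
      have e4 : s1.a .pos = P := by rw [f1.2 _ (by decide)]; simpa using g3
      have e5 : s1.a .par = s.a .par := by rw [f1.2 _ (by decide)]; simp
      refine Run.straight (by simp) (by decide) ⟨by simpa using e2, by simpa using e3,
        by simpa using e4, fun j hj1 hj2 => ?_, fun j hj => ?_⟩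
      · by_cases hji : j = i
        · subst hji
          simpa [e1] using And.intro k2 k3
        · simpa [e1, e5, hji] using g4 j hj1 (by omega)
      · have hji : j ≠ i := by omega
        simpa [e1, e5, hji] using g5 j (by omega)
    · rintro x l s' hx ⟨k1, k2⟩ hsx hsu
      have e : ((s.setR .u i).setR .m 0).a .ord = O ∧ ((s.setR .u i).setR .m 0).a .pos = P := by
        simp [g2, g3]
      rw [e.1, e.2] at hx
      by_cases hlt : s'.r .m < x
      · refine Run.straight (by simp) (by decide) ⟨fun y hy => ?_, ?_⟩
        · rcases k1 y hy with h | h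
          · left; simp [hsx, hlt]; omega
          · rcases List.mem_cons.1 h with rfl | h
            · left; simp [hsx, hlt]
            · exact .inr h
        · right; simpa [hsx, hlt] using hx
      · refine Run.straight (by simp) (by decide) ⟨fun y hy => ?_, ?_⟩
        · rcases k1 y hy with h | h
          · left; simpa [hsx, hlt] using h
          · rcases List.mem_cons.1 h with rfl | h
            · left; simp [hsx, hlt]; omega
            · exact .inr h
        · simpa [hsx, hlt] using k2
    · exact ⟨fun x hx => .inr (by simpa [g2, g3] using hx), by simp⟩
  · exact ⟨hA, hO, hP, fun j h1 h2 => by omega, fun j _ => by simp [hpar]⟩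

/-- Store the estimate for every vertex. -/
def output : Pg :=
  forUp (.store .inp (.sub (.v .i) (.c 1)) (.ld .est (.ld .pos (.sub (.v .i) (.c 1)))))

/-- The answers overwrite the input: its array has base address 0, so the answer for v ends up in
memory cell v. -/
theorem run_output {L n : ℕ} {E P : ℕ → ℕ} (hL : n + 1 < L) {s : St} (hn : s.r .n = n)
    (hE : s.a .est = E) (hP : s.a .pos = P) :
    Run L output s (40 * n + 20) (fun s' => ∀ v < n, s'.a .inp v = E (P v)) := by
  have hloop := Run.forUp (L := L) (n := n) (s := s)
    (body := .store .inp (.sub (.v .i) (.c 1)) (.ld .est (.ld .pos (.sub (.v .i) (.c 1)))))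
    (fun _ => 20) (fun i s' => s'.a .est = E ∧ s'.a .pos = P ∧
      ∀ v, v + 1 < i → s'.a .inp v = E (P v)) hL hn (fun i s m h => h) (by decide) (by decide)
    ?_ ⟨hE, hP, fun v hv => by omega⟩
  · refine Run.mono hloop (by simp; omega) ?_
    rintro s' ⟨-, -, h⟩ v hv
    exact h v (by omega)
  · rintro i s h1 h2 h3 h4 ⟨g1, g2, g3⟩
    refine Run.straight (by simp) (by decide) ⟨by simpa using g1, by simpa using g2, fun v hv => ?_⟩
    by_cases hvi : v = i - 1
    · subst hvi; simp [h4, g1, g2]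
    · simp [h4, hvi, g3 v (by omega)]

/-- Estimate the eccentricities of all vertices. -/
def eccentricities : Pg :=
  .seq (.set .n (.ld .inp (.c 0))) (.seq search (.seq parents (.seq decompose output)))

theorem run_eccentricities {L : ℕ} {A : ℕ → ℕ} (hin : IsInput L n (nbOf adj) A) (hA : A 0 = n)
    (hn : 1 ≤ n) (hadj : WordRAM.IsAdjList G adj) (hG : G.Connected) (hc : G.IsChordal)
    (hL : 2 * n + (∑ v ∈ Finset.range n, (nbOf adj v).length) + 1 < L) {s : St}
    (hr : s.r = fun _ => 0) (ha : s.a = Function.update (fun _ _ => 0) .inp A) :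
    Run L eccentricities s
      (3000 * ((Nat.log 2 (2 * n) + 2) * (n + ∑ v ∈ Finset.range n, (nbOf adj v).length)))
      (fun s' => ∀ v : Fin n, (∃ u, s'.a .inp v ≤ G.dist v u) ∧ ∀ u, G.dist v u ≤ s'.a .inp v + 1) := by
  have hnL := hin.n_lt
  set M := ∑ v ∈ Finset.range n, (nbOf adj v).length with hM
  set g := Nat.log 2 (2 * n) + 2 with hg
  have hg2 : 2 ≤ g := by omega
  have hgn : 2 * (n + M) ≤ g * (n + M) := Nat.mul_le_mul_right _ hg2
  refine Run.mono (T := 5 + ((310 * n + 200 * M + 40) + ((110 * (n + M) + 20) +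
    (g * (1700 * (n + M) + 140) + (40 * n + 20))))) ?_ ?_ fun _ h => h
  · refine Run.seq (Run.straight (Q := fun s' => s' = s.setR .n n) (by simp) (by decide)
      (by simp [ha, hA])) fun s1 h1 _ => ?_
    subst h1
    refine Run.seq (run_search (n := n) (nb := nbOf adj) (A := A) hin (isGraph_nbOf hadj)
      (by rw [← hM]; exact hL) (by simp) (by simp [ha]) (by simp [hr]) (by simp [hr])
      (by simp [ha]) (by simp [ha]) (by simp [ha])) fun s1 hs f1 => ?_
    have e1 : s1.r .n = n := by rw [f1.1 _ (by decide)]; simp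
    have e2 : s1.a .inp = A := by rw [f1.2 _ (by decide)]; simp [ha]
    have e3 : s1.a .par = fun _ => 0 := by rw [f1.2 _ (by decide)]; simp [ha]
    have e4 : s1.a .rem = fun _ => 0 := by rw [f1.2 _ (by decide)]; simp [ha]
    have e5 : s1.a .stp = fun _ => 0 := by rw [f1.2 _ (by decide)]; simp [ha]
    have e6 : s1.a .est = fun _ => 0 := by rw [f1.2 _ (by decide)]; simp [ha]
    -- The numbering is a bijection, so the total degree can be computed in either indexing.
    have hsum : ∑ i ∈ Finset.Icc 1 n, ((nbOf adj (s1.a .ord i)).length + 1) = n + M := by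
      have : n + M = ∑ v ∈ Finset.range n, ((nbOf adj v).length + 1) := by
        rw [Finset.sum_add_distrib, ← hM]
        simp [add_comm]
      rw [this]
      refine Finset.sum_bij' (fun i _ => s1.a .ord i) (fun v _ => s1.a .pos v) (fun i hi => ?_)
        (fun v hv => ?_) (fun i hi => ?_) (fun v hv => ?_) fun i hi => rfl
      · rw [Finset.mem_Icc] at hi
        simpa using (hs.ord i hi.1 hi.2).1
      · rw [Finset.mem_range] at hv
        have := hs.ne_zero hv
        have := hs.le v hv
        simp; omega
      · rw [Finset.mem_Icc] at hi
        exact (hs.ord i hi.1 hi.2).2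
      · rw [Finset.mem_range] at hv
        exact hs.inv v hv (hs.ne_zero hv)
    have hpar := run_parents hin e1 e2 rfl rfl e3 fun i h1 h2 => (hs.ord i h1 h2).1
    rw [hsum] at hpar
    refine Run.seq hpar fun s2 h2 f2 => ?_
    obtain ⟨h2, h3⟩ := h2
    have hel := hs.isElim hadj hG hc h2 h3
    let X : Inst := ⟨n, L, nbOf adj, A, s1.a .ord, s1.a .pos, s2.a .par, renamed G (s1.a .pos)⟩
    have hX : X.Good := ⟨hin, fun i h1 h2 => (hs.ord i h1 h2).1,
      fun i h1 h2 => hs.mem_dnList hadj h1 h2, hel⟩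
    have ht : X.Tab s2 := ⟨by rw [f2.1 _ (by decide), e1], by rw [f2.2 _ (by decide), e2],
      by rw [f2.2 _ (by decide)], by rw [f2.2 _ (by decide)], rfl⟩
    have hdec := run_decompose hX ht hn (by rw [f2.2 _ (by decide), e4])
      (by rw [f2.2 _ (by decide), e5]) (by rw [f2.2 _ (by decide), e6])
    have htot : X.total = n + M := hsum
    rw [htot] at hdec
    refine Run.seq hdec fun s3 h4 f3 => ?_
    refine Run.mono (run_output (by omega) (by rw [f3.1 _ (by decide), ht.n]) rfl
      (by rw [f3.2 _ (by decide), ht.pos])) le_rfl fun s4 h5 v => ?_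
    rw [h5 v v.2]
    have hP : ∀ v : Fin n, 1 ≤ s1.a .pos v ∧ s1.a .pos v ≤ n := fun v =>
      ⟨Nat.one_le_iff_ne_zero.2 (hs.ne_zero v.2), hs.le v v.2⟩
    obtain ⟨⟨i, g1, g2, g3⟩, g4⟩ := h4 (s1.a .pos v) (hP v).1 (hP v).2
    refine ⟨?_, fun u => ?_⟩
    · obtain ⟨k1, k2⟩ := hs.ord i g1 g2
      refine ⟨⟨s1.a .ord i, k1⟩, ?_⟩
      rw [← (hs.dist_eq hG _ _).2]
      simpa [k2] using g3
    · rw [← (hs.dist_eq hG v u).2]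
      exact g4 _ (hP u).1 (hP u).2
  · have : g * (1700 * (n + M) + 140) = 1700 * (g * (n + M)) + 140 * g := by ring
    have : g ≤ g * (n + M) := Nat.le_mul_of_pos_right _ (by omega)
    omega

end RowMachine

namespace RowMachine

/-! ### The input in memory -/

variable {n : ℕ} {adj : Fin n → List (Fin n)}

theorem ofFn_eq_map_range {α : Type*} (f : Fin n → α) (g : ℕ → α) (h : ∀ v : Fin n, f v = g v) :
    List.ofFn f = (List.range n).map g :=
  List.ext_getElem (by simp) fun i h1 h2 => by simp [h]

theorem offset_eq {i : ℕ} (hi : i ≤ n) :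
    WordRAM.offset adj i = n + 2 + ∑ v ∈ Finset.range i, (nbOf adj v).length := by
  rw [WordRAM.offset, ofFn_eq_map_range _ (fun v => (nbOf adj v).length) (by simp [nbOf_val]),
    ← List.map_take, List.take_range, min_eq_left hi]
  rfl

theorem neighbours_eq : WordRAM.neighbours adj = ((List.range n).map (nbOf adj)).flatten := by
  rw [WordRAM.neighbours, ofFn_eq_map_range _ (nbOf adj) fun v => (nbOf_val adj v).symm]

theorem length_flatten_range {α : Type*} (g : ℕ → List α) (i : ℕ) :
    ((List.range i).map g).flatten.length = ∑ v ∈ Finset.range i, (g v).length := by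
  induction i with
  | zero => simp
  | succ i ih => rw [List.range_succ, Finset.sum_range_succ, ← ih]; simp

theorem getD_flatten_range {g : ℕ → List ℕ} {v j : ℕ} (hv : v < n) (hj : j < (g v).length) :
    ((List.range n).map g).flatten.getD ((∑ u ∈ Finset.range v, (g u).length) + j) 0 =
      (g v)[j] := by
  induction n with
  | zero => omega
  | succ n ih =>
    rw [List.range_succ, List.map_append, List.flatten_append, List.map_singleton]
    simp only [List.flatten_cons, List.flatten_nil, List.append_nil]
    rcases Nat.lt_succ_iff_lt_or_eq.1 hv with h | rfl
    · rw [List.getD_append, ih h]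
      rw [length_flatten_range]
      have h1 : Finset.range (v + 1) ⊆ Finset.range n := by
        simpa using h
      have := Finset.sum_le_sum_of_subset (f := fun v => (g v).length) h1
      rw [Finset.sum_range_succ] at this
      omega
    · rw [List.getD_append_right _ _ _ _ (by rw [length_flatten_range]; omega),
        length_flatten_range]
      simp [hj]

/-- The number of cells of the input. -/
def inputSize (adj : Fin n → List (Fin n)) : ℕ :=
  n + 2 + ∑ v ∈ Finset.range n, (nbOf adj v).length

theorem mem_zero : (WordRAM.initial adj).mem 0 = n := rfl

theorem mem_succ {i : ℕ} (hi : i ≤ n) :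
    (WordRAM.initial adj).mem (i + 1) = WordRAM.offset adj i := by
  change (_ :: _ : List ℕ).getD (i + 1) 0 = _
  rw [List.getD_cons_succ, List.getD_append _ _ _ _ (by simp; omega)]
  simp [List.getD_eq_getElem?_getD, Nat.lt_succ_of_le hi]

theorem mem_add (j : ℕ) :
    (WordRAM.initial adj).mem (n + 2 + j) = (WordRAM.neighbours adj).getD j 0 := by
  change (_ :: _ : List ℕ).getD (n + 2 + j) 0 = _
  rw [show n + 2 + j = n + 1 + j + 1 by omega, List.getD_cons_succ,
    List.getD_append_right _ _ _ _ (by simp)]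
  simp

theorem mem_of_le {a : ℕ} (ha : inputSize adj ≤ a) : (WordRAM.initial adj).mem a = 0 := by
  unfold inputSize at ha
  obtain ⟨j, rfl⟩ : ∃ j, a = n + 2 + j := ⟨a - (n + 2), by omega⟩
  rw [mem_add, neighbours_eq]
  exact List.getD_eq_default _ _ (by rw [length_flatten_range]; omega)

theorem offset_le {i : ℕ} (hi : i ≤ n) : WordRAM.offset adj i ≤ inputSize adj := by
  rw [offset_eq hi, inputSize]
  have h1 : Finset.range i ⊆ Finset.range n := by simpa using hi
  have := Finset.sum_le_sum_of_subset (f := fun v => (nbOf adj v).length) h1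
  omega

theorem mem_le (a : ℕ) : (WordRAM.initial adj).mem a ≤ inputSize adj := by
  rcases Nat.eq_zero_or_pos a with rfl | h
  · rw [mem_zero, inputSize]; omega
  · obtain ⟨i, rfl⟩ : ∃ i, a = i + 1 := ⟨a - 1, by omega⟩
    by_cases hi : i ≤ n
    · rw [mem_succ hi]
      exact offset_le hi
    · obtain ⟨j, hj⟩ : ∃ j, i + 1 = n + 2 + j := ⟨i - (n + 1), by omega⟩
      rw [hj, mem_add]
      by_cases hl : j < (WordRAM.neighbours adj).length
      · rw [List.getD_eq_getElem _ _ hl]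
        have hm := List.getElem_mem hl
        generalize (WordRAM.neighbours adj)[j] = x at hm
        rw [neighbours_eq, List.mem_flatten] at hm
        obtain ⟨l, h1, h2⟩ := hm
        obtain ⟨v, h3, rfl⟩ := List.mem_map.1 h1
        rw [nbOf_mk adj (List.mem_range.1 h3)] at h2
        obtain ⟨y, -, rfl⟩ := List.mem_map.1 h2
        have := y.2
        rw [inputSize]; omega
      · rw [List.getD_eq_default _ _ (by omega)]; omega

theorem isInput_initial {L : ℕ} (hL : 2 * inputSize adj < L) :
    IsInput L n (nbOf adj) (WordRAM.initial adj).mem := by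
  have h0 : n + 2 ≤ inputSize adj := by rw [inputSize]; omega
  refine ⟨fun v hv => ?_, fun v hv j hj => ?_, fun v hv => ?_, by omega⟩
  · rw [mem_succ (i := v + 1) hv, mem_succ hv.le, offset_eq (i := v + 1) hv, offset_eq hv.le,
      Finset.sum_range_succ]
    omega
  · rw [mem_succ hv.le, offset_eq hv.le, add_assoc, mem_add, neighbours_eq,
      getD_flatten_range hv hj]
  · have := mem_le (adj := adj) (v + 2)
    omega

/-! ### The base addresses of the arrays -/

/-- Set the registers `1, …, k + 1` to multiples of four times the size of the input. -/
def bases : ℕ → WordRAM.Prog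
  | 0 =>
    -- Cell 0 contains n, and cell n + 1 the last offset, which is the size of the input; so the
    -- program itself does not depend on n.
    let z := .load (.add (.load (.const 0)) (.const 1))
    .set 1 (.add (.add z z) (.add z z))
  | k + 1 => .seq (bases k) (.set (k + 2) (.add (.reg (k + 1)) (.reg 1)))

theorem exec_bases {L W k : ℕ} (hL : L = 4 * inputSize adj) (hW : 18 * L ≤ W) (hk : k ≤ 16) :
    ∃ t σ, WordRAM.Exec W (bases k) (WordRAM.initial adj) t σ ∧ t ≤ 30 + 5 * k ∧
      σ.mem = (WordRAM.initial adj).mem ∧ (∀ i ≤ k + 1, σ.reg i = i * L) ∧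
      ∀ i, k + 1 < i → σ.reg i = 0 := by
  have h0 : n + 2 ≤ inputSize adj := by rw [inputSize]; omega
  induction k with
  | zero =>
    have h1 : (WordRAM.initial adj).mem (n + 1) = inputSize adj := by
      rw [mem_succ le_rfl, offset_eq le_rfl, inputSize]
    refine ⟨_, _, .set _ _ _ ?_, by simp [WordRAM.Expr.cost], rfl, fun i hi => ?_, fun i hi => ?_⟩
    · simp only [WordRAM.Expr.Fits, WordRAM.Expr.val, mem_zero, h1]
      omega
    · have : i = 0 ∨ i = 1 := by omega
      rcases this with rfl | rfl
      · simp [WordRAM.initial]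
      · simp only [WordRAM.Expr.val, mem_zero, h1, Function.update_self]
        omega
    · have : i ≠ 1 := by omega
      simp [this, WordRAM.initial]
  | succ k ih =>
    obtain ⟨t, σ, h1, h2, h3, h4, h5⟩ := ih (by omega)
    have e1 := h4 (k + 1) le_rfl
    have e2 := h4 1 (by omega)
    have e3 : (k + 1) * L ≤ 16 * L := Nat.mul_le_mul_right _ (by omega)
    refine ⟨_, _, .seq h1 (.set _ _ _ ?_), ?_, h3, fun i hi => ?_, fun i hi => ?_⟩
    · simp only [WordRAM.Expr.Fits, WordRAM.Expr.val, e1, e2]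
      omega
    · simp only [WordRAM.Expr.cost]; omega
    · by_cases hi' : i = k + 2
      · subst hi'
        simp only [WordRAM.Expr.val, e1, e2, Function.update_self]
        ring
      · simpa [hi'] using h4 i (by omega)
    · have : i ≠ k + 2 := by omega
      simpa [this] using h5 i (by omega)

/-- Register 0 is still 0, so the input already lies in the first block. It is shorter than L, so
the remaining 17 arrays start out as zero. -/
theorem exists_exec {L W T : ℕ} (hL : L = 4 * inputSize adj) (hW : 18 * L ≤ W) {c : Pg}
    {Q : St → Prop} (h : Run L c
      ⟨fun _ => 0, Function.update (fun _ _ => 0) .inp (WordRAM.initial adj).mem⟩ T Q) :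
    ∃ t σ s, WordRAM.Exec W (.seq (bases 16) c.comp) (WordRAM.initial adj) t σ ∧ t ≤ T + 110 ∧
      Q s ∧ ∀ i < L, σ.mem i = s.a .inp i := by
  have h0 : n + 2 ≤ inputSize adj := by rw [inputSize]; omega
  obtain ⟨t1, σ1, h1, h2, h3, h4, h5⟩ := exec_bases hL hW (le_refl 16)
  obtain ⟨t2, s, g1, g2, g3⟩ := h
  have hrel : Rel L ⟨fun _ => 0, Function.update (fun _ _ => 0) .inp (WordRAM.initial adj).mem⟩
      σ1 := by
    refine ⟨fun x => h5 _ (by omega), fun k => h4 _ (by have := k.idx_lt; omega), fun k i hi => ?_,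
      fun x => by simp; omega, fun k i hi => ?_⟩
    · rw [h3]
      by_cases hk : k = .inp
      · subst hk
        simp [Rw.idx]
      · have : 1 ≤ k.idx := by
          cases k <;> simp [Rw.idx] at hk ⊢
        have := Nat.mul_le_mul_right L this
        simp only [ne_eq, hk, not_false_eq_true, Function.update_of_ne]
        exact mem_of_le (by omega)
    · by_cases hk : k = .inp
      · subst hk
        have := mem_le (adj := adj) i
        simp only [Function.update_self]
        omega
      · simp only [ne_eq, hk, not_false_eq_true, Function.update_of_ne]
        omega
  obtain ⟨σ2, k1, k2⟩ := g1.sim (by omega) hW hrel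
  refine ⟨t1 + t2, σ2, s, .seq h1 k1, by omega, g3, fun i hi => ?_⟩
  simpa [Rw.idx] using k2.mem .inp i hi

/-! ### Number of edges and logarithms -/

theorem sum_length_nbOf {G : SimpleGraph (Fin n)} (hadj : WordRAM.IsAdjList G adj) :
    ∑ v ∈ Finset.range n, (nbOf adj v).length = 2 * G.edgeSet.ncard := by
  classical
  rw [Set.ncard_eq_toFinset_card', ← SimpleGraph.edgeFinset, ← G.sum_degrees_eq_twice_card_edges,
    Finset.sum_range]
  refine Finset.sum_congr rfl fun v _ => ?_
  rw [nbOf_val, List.length_map, ← List.toFinset_card_of_nodup (hadj v).1,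
    ← SimpleGraph.card_neighborFinset_eq_degree]
  congr 1
  ext w
  simp [(hadj v).2 w]

/-- As log 2 > 1/2, the binary logarithm is at most 2 log n, and the remaining 3 is at most 6 log 2
≤ 6 log n. -/
theorem natCast_log_le {n : ℕ} (hn : 2 ≤ n) :
    ((Nat.log 2 (2 * n) + 2 : ℕ) : ℝ) ≤ 8 * Real.log n := by
  have h2 : (1 : ℝ) / 2 < Real.log 2 := by have := Real.log_two_gt_d9; linarith
  have h1 : (Nat.log 2 n : ℝ) * Real.log 2 ≤ Real.log n := by
    rw [← Real.log_pow]
    refine Real.log_le_log (by positivity) ?_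
    exact_mod_cast Nat.pow_log_le_self 2 (by omega)
  have h3 : Real.log 2 ≤ Real.log n := Real.log_le_log (by norm_num) (by exact_mod_cast hn)
  have h4 : Nat.log 2 (2 * n) = Nat.log 2 n + 1 := by
    rw [mul_comm, Nat.log_mul_base (by norm_num) (by omega)]
  rw [h4]
  push_cast
  have h5 : (0 : ℝ) ≤ Nat.log 2 n := by positivity
  nlinarith

end RowMachine

/-! ### The theorem: word size and constants -/

theorem theorem4p6 :
    ∃ (P : WordRAM.Prog) (c : ℕ) (C : ℝ),
      ∀ (n : ℕ) (G : SimpleGraph (Fin n)) (adj : Fin n → List (Fin n)),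
        2 ≤ n → G.Connected → G.IsChordal → WordRAM.IsAdjList G adj →
        ∃ (t : ℕ) (s : WordRAM.State),
          WordRAM.Exec (n ^ c) P (WordRAM.initial adj) t s ∧
          (t : ℝ) ≤ C * (G.edgeSet.ncard : ℝ) * Real.log n ∧
          ∀ v : Fin n,
            (s.mem v : ℕ∞) ≤ G.eccent v ∧ G.eccent v ≤ (s.mem v : ℕ∞) + 1 := by
  refine ⟨.seq (RowMachine.bases 16) RowMachine.eccentricities.comp, 10, 100000,
    fun n G adj hn hG hc hadj => ?_⟩
  have hM := RowMachine.sum_length_nbOf hadj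
  set m := G.edgeSet.ncard with hm
  have hsize : RowMachine.inputSize adj = n + 2 + 2 * m := by rw [RowMachine.inputSize, hM]
  have hnm : n ≤ m + 1 := by
    have := hG.card_vert_le_card_edgeSet_add_one
    rwa [Nat.card_fin, Nat.card_coe_set_eq] at this
  have hmn : 2 * m ≤ n * n := by
    rw [← hM]
    refine (Finset.sum_le_card_nsmul _ _ n fun v hv => ?_).trans (by simp)
    exact (RowMachine.isGraph_nbOf hadj).length_le (Finset.mem_range.1 hv)
  -- With 2 * m ≤ n ^ 2 and n ≥ 2 the left side is at most 144 * n ^ 2, which is less than 2 ^ 8 * n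
  -- ^ 2.
  have hW : 18 * (4 * (n + 2 + 2 * m)) ≤ n ^ 10 := by
    have h1 : 2 ^ 8 * n ^ 2 ≤ n ^ 8 * n ^ 2 :=
      Nat.mul_le_mul_right _ (Nat.pow_le_pow_left hn 8)
    have h2 : n ^ 10 = n ^ 8 * n ^ 2 := by ring
    have h3 : 2 * n ≤ n * n := Nat.mul_le_mul_right _ hn
    rw [h2]
    refine le_trans ?_ h1
    rw [pow_two]
    omega
  obtain ⟨t, σ, s, h1, h2, h3, h4⟩ := RowMachine.exists_exec (L := 4 * (n + 2 + 2 * m))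
    (W := n ^ 10) (by rw [hsize]) hW (RowMachine.run_eccentricities
    (L := 4 * (n + 2 + 2 * m)) (RowMachine.isInput_initial (by rw [hsize]; omega)) rfl (by omega)
    hadj hG hc (by rw [hM]; omega) rfl rfl)
  refine ⟨t, σ, h1, ?_, fun v => ?_⟩
  · have hg := RowMachine.natCast_log_le hn
    rw [hM] at h2
    set g := Nat.log 2 (2 * n) + 2
    -- Connectedness gives n ≤ m + 1 ≤ 2 * m. So 3000 becomes 12000, the 110 steps for the base
    -- addresses are absorbed in 12500, and the factor 8 of the logarithm leads to 100000.
    have h5 : g * (n + 2 * m) ≤ g * (4 * m) := Nat.mul_le_mul_left _ (by omega)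
    have h6 : 2 * 1 ≤ g * m := Nat.mul_le_mul (by omega) (by omega)
    have h7 : t ≤ 12500 * (m * g) := by
      have : g * (4 * m) = 4 * (g * m) := by ring
      rw [mul_comm m g]
      omega
    calc (t : ℝ) ≤ ((12500 * (m * g) : ℕ) : ℝ) := by exact_mod_cast h7
      _ = 12500 * (m * (g : ℝ)) := by push_cast; ring
      _ ≤ 12500 * (m * (8 * Real.log n)) := by gcongr
      _ = 100000 * m * Real.log n := by ring
  · rw [h4 v (by omega)]
    obtain ⟨⟨u, hu⟩, hv⟩ := h3 v
    have hd : ∀ u, (G.dist v u : ℕ∞) = G.edist v u := fun u => (hG v u).coe_dist_eq_edist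
    refine ⟨?_, (G.eccent_le_iff v _).2 fun u => ?_⟩
    · refine le_trans ?_ (SimpleGraph.edist_le_eccent (v := u))
      rw [← hd]
      exact_mod_cast hu
    · rw [← hd]
      exact_mod_cast hv u
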